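/- **Proposition 4.1.** Let $k\ge 3$, let $\Omega=(a,b)\times(c,d)$, let $a=x_0<\dots<x_M=b$, $c=y_0<\dots<y_N=d$ be a rectangular mesh with elements $\tau_{ij}=[x_{i-1},x_i]\times[y_{j-1},y_j]$; let $h$ and $h_{\min}$ be the maximal and minimal edge lengths, and suppose $h\le\sigma h_{\min}$ (quasi-uniformity). *Polynomials.* Let $J_n^{2,2}$ be the standard Jacobi polynomials on $[-1,1]$ and $L_n=J_n^{0,0}$ the Legendre polynomials. Put $J_n^{-2,-2}(s)=(1-s)^2(1+s)^2J^{2,2}_{n-4}(s)$ for $n\ge4$, and let $J_0^{-2,-2},\dots,J_3^{-2,-2}$ be the cubic Hermite basis $\frac14(s+2)(1-s)^2$, $\frac14(2-s)(1+s)^2$, $\frac14(s+1)(1-s)^2$, $\frac14(s-1)(1+s)^2$. *Projection.* For $v$ on $[-1,1]$, the coefficients of its expansion $v=\sum_p v_pJ_p^{-2,-2}$ are $v_0=v(-1)$, $v_1=v(1)$, $v_2=v'(-1)$, $v_3=v'(1)$, and for $p\ge4$ $$v_p=\frac{\int_{-1}^1\bigl(v-\sum_{q\le3}v_qJ_q^{-2,-2}\bigr)J_{p-4}^{2,2}\,ds}{\int_{-1}^1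 (J_{p-4}^{2,2})^2(1-s)^2(1+s)^2\,ds}.$$ On each $\tau_{ij}$, mapped affinely to $[-1,1]^2$, let $u_{pq}$ be the coefficients obtained by applying this in $x$ and then in $y$. The truncated Jacobi projection $u_I$ is given on $\tau_{ij}$ by $\sum_{p=0}^k\sum_{q=0}^k u_{pq}J_p^{-2,-2}(s)J_q^{-2,-2}(t)$, where $(s,t)\in[-1,1]^2$ are the mapped coordinates of $(x,y)\in\tau_{ij}$. *Special points.* On $[-1,1]$ consider the zeros of $J_{k+1}^{-2,-2}$ other than $\pm1$; the Lobatto points, i.e. the zeros of $\partial_sJ_{k+1}^{-2,-2}$; and the Gauss points, i.e. the zeros of $L_{k-1}$. Mapped to the mesh intervals in $x$ and in $y$ they give: the set $\mathcal R$ of points both of whose coordinates are mapped zeros of $J_{k+1}^{-2,-2}$ other than $\pm1$; the set $\mathcal L$ of points both of whose coordinates are mapped Lobatto points; the Lobatto lines $\mathcal E^l_x$ ($x$ a mapped Lobatto point, $y\in[c,d]$) and $\mathcal E^l_y$ ($y$ a mapped Lobatto point, $x\in[a,b]$); and the Gauss lines $\mathcal E^g_x,\mathcal E^g_y$, defined likewise.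 Let $l\ge2$ and $u\in W^{l,\infty}(\Omega)\cap C^2(\overline\Omega)$. (For $l\ge3$ the second condition only selects the continuous representative of $u$.) Then $u_I$ belongs to the space of $C^1(\overline\Omega)$ functions that are polynomials of degree at most $k$ in each variable on every element. Moreover, there is a constant $K$ depending only on $k$ and $\sigma$ such that, with $\|\cdot\|_{r,m}$ and $|\cdot|_{r,m}$ the norm and seminorm of $W^{r,m}(\Omega)$ and $r$ an integer: 1. $\|u-u_I\|_{0,\infty}\le K h^r\|u\|_{r,\infty}$ for $2\le r\le\min(k+1,l)$, and $\|u-u_I\|_{0,2}\le K h^r\|u\|_{r,2}$ for $4\le r\le\min(k+1,l)$. For all $2\le r\le\min(k+1,l)$ one still has $\|u-u_I\|_{0,2}\le K_u h^r\|u\|_{r,2}$ with a constant $K_u$ that may depend on $k,\sigma,\Omega,l,u$ but not on the mesh. 2. $(u-u_I)(x_i,y_j)=0$ and $\nabla(u-u_I)(x_i,y_j)=0$ at all mesh nodes. 3. $|(u-u_I)(P)|\le K h^r|u|_{r,\infty}$ for all $P\in\mathcal R$ and $2\le r\le\min(k+2,l)$. 4. $|\partial_x(u-u_I)(P_1)|+|\partial_y(u-u_I)(Q_1)|\le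 K h^{r-1}|u|_{r,\infty}$ for all $P_1\in\mathcal E_x^l$, $Q_1\in\mathcal E_y^l$ and $2\le r\le\min(k+2,l)$. 5. $|\partial_{xx}^2(u-u_I)(P_2)|+|\partial_{yy}^2(u-u_I)(Q_2)|+|\partial_{xy}^2(u-u_I)(P_3)|\le K h^{r-2}|u|_{r,\infty}$ for all $P_2\in\mathcal E_x^g$, $Q_2\in\mathcal E_y^g$, $P_3\in\mathcal L$ and $2\le r\le\min(k+2,l)$. Derivatives at points of $\partial\Omega$ are one-sided. -/

import Mathlib

open MeasureTheory Set Polynomial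
open scoped ENNReal ContDiff

namespace JacobiProjection

noncomputable section

/-! ### Sobolev spaces on open subsets of the plane -/

/-- The classical mixed partial derivative `∂_x^i ∂_y^j φ` on the whole plane
(only applied to smooth functions). -/
def classicalDeriv (i j : ℕ) (φ : ℝ × ℝ → ℝ) : ℝ × ℝ → ℝ :=
  (fun (f : ℝ × ℝ → ℝ) (P : ℝ × ℝ) => deriv (fun s => f (s, P.2)) P.1)^[i]
    ((fun (f : ℝ × ℝ → ℝ) (P : ℝ × ℝ) => deriv (fun t => f (P.1, t)) P.2)^[j] φ)

/-- `g` is the weak derivative `∂_x^i ∂_y^j u` on the open set `Ω`. -/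
def IsWeakDeriv (Ω : Set (ℝ × ℝ)) (u : ℝ × ℝ → ℝ) (i j : ℕ) (g : ℝ × ℝ → ℝ) : Prop :=
  LocallyIntegrableOn g Ω ∧
    ∀ φ : ℝ × ℝ → ℝ, ContDiff ℝ ∞ φ → HasCompactSupport φ → tsupport φ ⊆ Ω →
      ∫ P in Ω, u P * classicalDeriv i j φ P = (-1) ^ (i + j) * ∫ P in Ω, g P * φ P

/-- The Sobolev space `W^{l,p}(Ω)`. -/
def MemSobolev (l : ℕ) (p : ℝ≥0∞) (Ω : Set (ℝ × ℝ)) (u : ℝ × ℝ → ℝ) : Prop :=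
  LocallyIntegrableOn u Ω ∧
    ∀ i j : ℕ, i + j ≤ l → ∃ g, IsWeakDeriv Ω u i j g ∧ MemLp g p (volume.restrict Ω)

open Classical in
/-- A representative of the weak derivative `∂_x^i ∂_y^j u` on `Ω`; weak derivatives are unique
almost everywhere. The value is `0` if there is no weak derivative. -/
def weakDeriv (Ω : Set (ℝ × ℝ)) (u : ℝ × ℝ → ℝ) (i j : ℕ) : ℝ × ℝ → ℝ :=
  if h : ∃ g, IsWeakDeriv Ω u i j g then h.choose else 0

/-- `(∑_{(i,j) ∈ S} ‖∂_x^i ∂_y^j u‖_{L^p(Ω)}^p)^{1/p}`, and the maximum of the norms if `p = ∞`. -/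
def sobolevSum (S : Finset (ℕ × ℕ)) (p : ℝ≥0∞) (Ω : Set (ℝ × ℝ)) (u : ℝ × ℝ → ℝ) : ℝ :=
  if p = ⊤ then
    (S.sup fun s => eLpNorm (weakDeriv Ω u s.1 s.2) ⊤ (volume.restrict Ω)).toReal
  else
    (∑ s ∈ S, (eLpNorm (weakDeriv Ω u s.1 s.2) p (volume.restrict Ω)).toReal ^ p.toReal) ^
      (1 / p.toReal)

/-- The norm `‖u‖_{r,p,Ω}` of `u ∈ W^{r,p}(Ω)`. -/
def sobolevNorm (r : ℕ) (p : ℝ≥0∞) (Ω : Set (ℝ × ℝ)) (u : ℝ × ℝ → ℝ) : ℝ :=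
  sobolevSum ((Finset.range (r + 1)).biUnion Finset.HasAntidiagonal.antidiagonal) p Ω u

/-- The seminorm `|u|_{r,p,Ω}` of `u ∈ W^{r,p}(Ω)`: only derivatives of order exactly `r`. -/
def sobolevSeminorm (r : ℕ) (p : ℝ≥0∞) (Ω : Set (ℝ × ℝ)) (u : ℝ × ℝ → ℝ) : ℝ :=
  sobolevSum (Finset.HasAntidiagonal.antidiagonal r) p Ω u

/-! ### Jacobi polynomials -/

/-- The standard Jacobi polynomial `J_n^{α,β}` for natural parameters `α, β`:
`∑_m (n+α choose n-m) (n+β choose m) ((X-1)/2)^m ((X+1)/2)^(n-m)`. -/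
def jacobi (α β n : ℕ) : ℝ[X] :=
  ∑ m ∈ Finset.range (n + 1),
    C (((n + α).choose (n - m) * (n + β).choose m : ℕ) : ℝ) *
      (C (1 / 2) * (X - 1)) ^ m * (C (1 / 2) * (X + 1)) ^ (n - m)

/-- The Legendre polynomial `L_n = J_n^{0,0}`. -/
def legendre (n : ℕ) : ℝ[X] := jacobi 0 0 n

/-- The polynomials `J_n^{-2,-2}`: for `n ≤ 3` the cubic Hermite basis
`ψ_{-1}, ψ_1, χ_{-1}, χ_1`, and `(1-s)^2 (1+s)^2 J_{n-4}^{2,2}(s)` for `n ≥ 4`. -/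
def jacobiNeg : ℕ → ℝ[X]
  | 0 => C (1 / 4) * (X + 2) * (1 - X) ^ 2
  | 1 => C (1 / 4) * (2 - X) * (1 + X) ^ 2
  | 2 => C (1 / 4) * (X + 1) * (1 - X) ^ 2
  | 3 => C (1 / 4) * (X - 1) * (1 + X) ^ 2
  | n + 4 => (1 - X) ^ 2 * (1 + X) ^ 2 * jacobi 2 2 n

/-- The cubic Hermite interpolant of `v` on `[-1, 1]`. -/
def hermite (v : ℝ → ℝ) (s : ℝ) : ℝ :=
  v (-1) * (jacobiNeg 0).eval s + v 1 * (jacobiNeg 1).eval s +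
    derivWithin v (Icc (-1) 1) (-1) * (jacobiNeg 2).eval s +
    derivWithin v (Icc (-1) 1) 1 * (jacobiNeg 3).eval s

/-- The coefficients `v_p` of the Jacobi expansion `v = ∑_p v_p J_p^{-2,-2}` on `[-1, 1]`.
The first four are the values and the derivatives at the end points, since all `J_p^{-2,-2}` with
`p ≥ 4` vanish there to second order. The others result from testing the rest of the expansion,
`v - hermite v = ∑_{p ≥ 4} v_p (1-s)^2 (1+s)^2 J_{p-4}^{2,2}`, with `J_{p-4}^{2,2}`, because the
`J_n^{2,2}` are orthogonal with respect to the weight `(1-s)^2 (1+s)^2`. -/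
def jacobiCoeff : ℕ → (ℝ → ℝ) → ℝ
  | 0, v => v (-1)
  | 1, v => v 1
  | 2, v => derivWithin v (Icc (-1) 1) (-1)
  | 3, v => derivWithin v (Icc (-1) 1) 1
  | n + 4, v =>
    (∫ s in (-1 : ℝ)..1, (v s - hermite v s) * (jacobi 2 2 n).eval s) /
      ∫ s in (-1 : ℝ)..1, (jacobi 2 2 n).eval s ^ 2 * ((1 - s) ^ 2 * (1 + s) ^ 2)

/-! ### Rectangular meshes and the finite element space -/

/-- A rectangular partition of `[a,b] × [c,d]`, given by `a = x 0 < ⋯ < x M = b` and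
`c = y 0 < ⋯ < y N = d`; the values of `x` beyond `M` and of `y` beyond `N` play no role. -/
structure RectMesh (a b c d : ℝ) where
  M : ℕ
  N : ℕ
  M_pos : 0 < M
  N_pos : 0 < N
  x : ℕ → ℝ
  y : ℕ → ℝ
  x_zero : x 0 = a
  x_last : x M = b
  y_zero : y 0 = c
  y_last : y N = d
  x_lt : ∀ i < M, x i < x (i + 1)
  y_lt : ∀ j < N, y j < y (j + 1)

namespace RectMesh

variable {a b c d : ℝ} (T : RectMesh a b c d)

/-- The mesh size: the maximal length of all edges. -/
def h : ℝ :=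
  max ((Finset.range T.M).sup' (Finset.nonempty_range_iff.mpr T.M_pos.ne')
        fun i => T.x (i + 1) - T.x i)
      ((Finset.range T.N).sup' (Finset.nonempty_range_iff.mpr T.N_pos.ne')
        fun j => T.y (j + 1) - T.y j)

/-- The minimal length of all edges. -/
def hmin : ℝ :=
  min ((Finset.range T.M).inf' (Finset.nonempty_range_iff.mpr T.M_pos.ne')
        fun i => T.x (i + 1) - T.x i)
      ((Finset.range T.N).inf' (Finset.nonempty_range_iff.mpr T.N_pos.ne')
        fun j => T.y (j + 1) - T.y j)

/-- The closed element `[x_i, x_{i+1}] × [y_j, y_{j+1}]`, for `i < M`, `j < N`. -/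
def elem (i j : ℕ) : Set (ℝ × ℝ) :=
  Icc (T.x i) (T.x (i + 1)) ×ˢ Icc (T.y j) (T.y (j + 1))

end RectMesh

/-- The point of `[p, q]` that corresponds to `s ∈ [-1, 1]`. -/
def fromRef (p q s : ℝ) : ℝ := (p + q + (q - p) * s) / 2

/-- The point of `[-1, 1]` that corresponds to `t ∈ [p, q]`. -/
def toRef (p q t : ℝ) : ℝ := (2 * t - q - p) / (q - p)

namespace RectMesh

variable {a b c d : ℝ} (T : RectMesh a b c d)

/-- The finite element space `V_h`: functions in `C^1` of the closed rectangle whose restriction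
to each closed element is a polynomial of degree at most `k` in each of the two variables. -/
def MemV (k : ℕ) (v : ℝ × ℝ → ℝ) : Prop :=
  ContDiffOn ℝ 1 v (Icc a b ×ˢ Icc c d) ∧
    ∀ i < T.M, ∀ j < T.N, ∃ A : ℕ → ℕ → ℝ, ∀ P ∈ T.elem i j,
      v P = ∑ p ∈ Finset.range (k + 1), ∑ q ∈ Finset.range (k + 1), A p q * P.1 ^ p * P.2 ^ q

/-- The coefficients `u_{pq}` of the Jacobi expansion
`u = ∑_p ∑_q u_{pq} J_p^{-2,-2}(s) J_q^{-2,-2}(t)` on the element with index `(i, j)`, where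
`(s, t) ∈ [-1, 1]^2` are the reference coordinates. -/
def coeff (u : ℝ × ℝ → ℝ) (i j p q : ℕ) : ℝ :=
  jacobiCoeff q fun t => jacobiCoeff p fun s =>
    u (fromRef (T.x i) (T.x (i + 1)) s, fromRef (T.y j) (T.y (j + 1)) t)

/-- The truncated Jacobi expansion of `u` on the element with index `(i, j)`. -/
def localProj (k : ℕ) (u : ℝ × ℝ → ℝ) (i j : ℕ) (P : ℝ × ℝ) : ℝ :=
  ∑ p ∈ Finset.range (k + 1), ∑ q ∈ Finset.range (k + 1),
    T.coeff u i j p q * (jacobiNeg p).eval (toRef (T.x i) (T.x (i + 1)) P.1) *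
      (jacobiNeg q).eval (toRef (T.y j) (T.y (j + 1)) P.2)

/-- The truncated Jacobi projection `u_I`. At a point that lies on several closed elements the
element with the smallest indices is used. -/
def proj (k : ℕ) (u : ℝ × ℝ → ℝ) (P : ℝ × ℝ) : ℝ :=
  T.localProj k u (sInf {i | P.1 ≤ T.x (i + 1)}) (sInf {j | P.2 ≤ T.y (j + 1)}) P

/-- The error `u - u_I`. -/
def err (k : ℕ) (u : ℝ × ℝ → ℝ) (P : ℝ × ℝ) : ℝ := u P - T.proj k u P

end RectMesh

/-! ### Pointwise derivatives on the closed rectangle (one-sided at its boundary) -/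

/-- The partial derivative `∂_x f` on `[a,b] × ℝ`. -/
def dX (a b : ℝ) (f : ℝ × ℝ → ℝ) (P : ℝ × ℝ) : ℝ :=
  derivWithin (fun s => f (s, P.2)) (Icc a b) P.1

/-- The partial derivative `∂_y f` on `ℝ × [c,d]`. -/
def dY (c d : ℝ) (f : ℝ × ℝ → ℝ) (P : ℝ × ℝ) : ℝ :=
  derivWithin (fun t => f (P.1, t)) (Icc c d) P.2

/-! ### Special points and lines -/

/-- The zeros of `J_{k+1}^{-2,-2}` except `-1` and `1`. -/
def jacobiRoots (k : ℕ) : Set ℝ := {s | s ∈ Ioo (-1) 1 ∧ (jacobiNeg (k + 1)).eval s = 0}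

/-- The Gauss-Lobatto points: the zeros of `∂_s J_{k+1}^{-2,-2}`. -/
def lobattoPoints (k : ℕ) : Set ℝ :=
  {s | s ∈ Icc (-1) 1 ∧ (derivative (jacobiNeg (k + 1))).eval s = 0}

/-- The Gauss points of degree `k-1`: the zeros of `L_{k-1}`. -/
def gaussPoints (k : ℕ) : Set ℝ := {s | s ∈ Icc (-1) 1 ∧ (legendre (k - 1)).eval s = 0}

namespace RectMesh

variable {a b c d : ℝ} (T : RectMesh a b c d)

/-- The images in all mesh intervals in the `x`-direction of the points of `S ⊆ [-1,1]`. -/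
def gridX (S : Set ℝ) : Set ℝ := {t | ∃ i < T.M, ∃ s ∈ S, t = fromRef (T.x i) (T.x (i + 1)) s}

/-- The images in all mesh intervals in the `y`-direction of the points of `S ⊆ [-1,1]`. -/
def gridY (S : Set ℝ) : Set ℝ := {t | ∃ j < T.N, ∃ s ∈ S, t = fromRef (T.y j) (T.y (j + 1)) s}

end RectMesh

end

end JacobiProjection

open JacobiProjection

namespace JacobiProjection

/-! ### Jacobi polynomials: Rodrigues' formula and orthogonality -/

/-! One variable. The functionals `jacobiCoeff` are biorthogonal to the polynomials `jacobiNeg`, and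
for n ≥ 3 the first n + 1 of these span the polynomials of degree at most n. Truncation at k
therefore reproduces degree k, and on degree k + 1 its error is a multiple of `jacobiNeg (k + 1)`
(`errFunctional_sum`). So the functional that sends v to the a-th derivative of the error at s
annihilates degree k always, and degree k + 1 as well if the a-th derivative of `jacobiNeg (k + 1)`
vanishes at s. This extra order is the superconvergence: the roots serve a = 0, the Lobatto points a
= 1, and the Gauss points a = 2, because by Rodrigues' formula the second derivative of `jacobiNeg
(k + 1)` is a multiple of the Legendre polynomial of degree k - 1. A functional bounded in C^m that
annihilates degree less than r is controlled by the r-th derivative, as one sees by subtracting a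
Taylor polynomial (`SmoothFunctional.abs_le_sup`, `SmoothFunctional.abs_le_integral`).

Two variables. Let D, P and E = D - P stand for evaluation of a derivative, the same for the
projection, and the error. Then D⊗D - P⊗P equals E⊗D + D⊗E - E⊗E and also E⊗D + P⊗E. Every summand
is a product of functionals that annihilate degrees less than i and less than j with i + j = r, and
is thus bounded by ∂_x^i ∂_y^j (`refErr_sup_bound`, `refErr_L2_bound`). Scaling to an element yields
the powers of h; quasi-uniformity pays for the derivatives of the error.

From smooth functions to u. Evaluating a mollification of u at points pulled towards the centre of
the rectangle gives smooth functions whose derivatives are dominated by the weak derivatives of u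
with constant 1, and converge uniformly wherever those are continuous up to the boundary
(`exists_mixedConv`). The coefficients involve only u, its gradient and one mixed second derivative
(`RectMesh.coeff_eq`), so they converge too and the bounds pass to the limit (`error_bound`,
`eLpNorm_err_bound`).

Gluing. On an edge, the local expansion and its first normal derivative are determined by data of u
that both neighbours share, so u_I is C^1 (`RectMesh.contDiffOn_proj`). The nodal identities hold
because the first four coefficients are endpoint values and slopes (`RectMesh.err_node`). The mean
square estimate down to r = 2 comes from the maximum norm, its constant containing quotients of
norms of u. -/

theorem rodrigues (α β n : ℕ) :
    C ((2 : ℝ) ^ n * n.factorial) * ((X - 1) ^ α * (X + 1) ^ β * jacobi α β n) =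
      derivative^[n] ((X - 1) ^ (n + α) * (X + 1) ^ (n + β)) := by
  have e1 : (X - 1 : ℝ[X]) = X - C 1 := by simp
  have e2 : (X + 1 : ℝ[X]) = X + C 1 := by simp
  -- Leibniz' rule: the summands of the n-fold derivative match those in the definition of `jacobi`
  -- one by one, up to the common factor.
  rw [iterate_derivative_mul, jacobi, Finset.mul_sum, Finset.mul_sum]
  refine Finset.sum_congr rfl fun m hm => ?_
  have hm' : m ≤ n := Nat.lt_succ_iff.mp (Finset.mem_range.mp hm)
  rw [e1, e2, iterate_derivative_X_sub_pow, iterate_derivative_X_add_pow, mul_pow, mul_pow]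
  have h1 : n + α - (n - m) = α + m := by omega
  have h2 : n + β - m = β + (n - m) := by omega
  rw [h1, h2, pow_add, pow_add, Nat.descFactorial_eq_factorial_mul_choose,
    Nat.descFactorial_eq_factorial_mul_choose, ← Nat.choose_mul_factorial_mul_factorial hm']
  simp only [nsmul_eq_mul]
  have h3 : (C ((2 : ℝ) ^ n) : ℝ[X]) * (C (1 / 2) ^ m * C (1 / 2) ^ (n - m)) = 1 := by
    rw [← pow_add, Nat.add_sub_cancel' hm', ← C_pow, ← C_mul, ← mul_pow]
    norm_num
  have h4 : ∀ q : ℕ, (C (q : ℝ) : ℝ[X]) = (q : ℝ[X]) := fun q => by simp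
  simp only [C_mul, h4, Nat.cast_mul]
  linear_combination ((n.choose m : ℝ[X]) * m.factorial * (n - m).factorial *
    ((n + α).choose (n - m)) * ((n + β).choose m) * (X - C 1) ^ α * (X - C 1) ^ m *
    (X + C 1) ^ β * (X + C 1) ^ (n - m)) * h3

theorem rodrigues_scale_ne_zero (n : ℕ) : (2 : ℝ) ^ n * n.factorial ≠ 0 := by positivity

theorem jacobiNeg_add_four (n : ℕ) :
    jacobiNeg (n + 4) = (X - 1) ^ 2 * (X + 1) ^ 2 * jacobi 2 2 n := by
  rw [jacobiNeg]; ring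

/-- Rodrigues' formula is used twice: `jacobiNeg (n + 4)` is a multiple of the n-th derivative of
(X^2 - 1)^(n+2), and the derivative of order n + 2 of the same polynomial is a multiple of L_{n+2}.
The constant is the quotient of the two scales 2^(n+2) (n+2)! and 2^n n!. -/
theorem derivative_iterate_jacobiNeg (n : ℕ) :
    derivative^[2] (jacobiNeg (n + 4)) = C (4 * (n + 1) * (n + 2) : ℝ) * legendre (n + 2) := by
  have h1 := rodrigues 2 2 n
  have h2 := rodrigues 0 0 (n + 2)
  rw [← jacobiNeg_add_four] at h1
  have h3 : C ((2 : ℝ) ^ n * n.factorial) * derivative^[2] (jacobiNeg (n + 4)) =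
      C ((2 : ℝ) ^ (n + 2) * (n + 2).factorial) * legendre (n + 2) := by
    rw [← iterate_derivative_C_mul, h1, ← Function.iterate_add_apply, add_comm 2 n, legendre]
    simpa using h2.symm
  have h5 : (C ((2 : ℝ) ^ n * n.factorial) : ℝ[X]) ≠ 0 :=
    C_ne_zero.mpr (rodrigues_scale_ne_zero n)
  apply mul_left_cancel₀ h5
  rw [h3, ← mul_assoc, ← C_mul]
  congr 2
  rw [Nat.factorial_succ, Nat.factorial_succ]
  push_cast
  ring

theorem natDegree_sub_one_pow_mul (a b : ℕ) :
    ((X - 1 : ℝ[X]) ^ a * (X + 1) ^ b).natDegree = a + b := by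
  have e1 : (X - 1 : ℝ[X]) = X - C 1 := by simp
  have e2 : (X + 1 : ℝ[X]) = X + C 1 := by simp
  rw [e1, e2, ((monic_X_sub_C (1 : ℝ)).pow a).natDegree_mul ((monic_X_add_C (1 : ℝ)).pow b)]
  simp only [natDegree_pow, natDegree_X_sub_C, natDegree_X_add_C, mul_one]

theorem natDegree_jacobi_two (n : ℕ) : (jacobi 2 2 n).natDegree = n ∧ jacobi 2 2 n ≠ 0 := by
  have e1 : (X - 1 : ℝ[X]) = X - C 1 := by simp
  have e2 : (X + 1 : ℝ[X]) = X + C 1 := by simp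
  have h1 := rodrigues 2 2 n
  have hm : ((X - 1 : ℝ[X]) ^ 2 * (X + 1) ^ 2).Monic := by
    rw [e1, e2]; exact ((monic_X_sub_C (1 : ℝ)).pow 2).mul ((monic_X_add_C (1 : ℝ)).pow 2)
  have hm' : ((X - 1 : ℝ[X]) ^ (n + 2) * (X + 1) ^ (n + 2)).Monic := by
    rw [e1, e2]; exact ((monic_X_sub_C (1 : ℝ)).pow _).mul ((monic_X_add_C (1 : ℝ)).pow _)
  have hd := natDegree_sub_one_pow_mul (n + 2) (n + 2)
  -- The top coefficient of the n-th derivative of a monic polynomial of degree 2n + 4 is a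
  -- descending factorial, hence nonzero; Rodrigues' formula carries this over to `jacobi 2 2 n`.
  have hc : (derivative^[n] ((X - 1 : ℝ[X]) ^ (n + 2) * (X + 1) ^ (n + 2))).coeff (n + 4) ≠ 0 := by
    rw [coeff_iterate_derivative, show n + 4 + n = n + 2 + (n + 2) by ring, ← hd,
      hm'.coeff_natDegree, nsmul_eq_mul, mul_one, Nat.cast_ne_zero, Ne,
      Nat.descFactorial_eq_zero_iff_lt]
    omega
  have hne : jacobi 2 2 n ≠ 0 := by
    intro h0
    rw [h0, mul_zero, mul_zero] at h1
    exact hc (by rw [← h1]; simp)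
  refine ⟨?_, hne⟩
  have h2 := congrArg natDegree h1
  have h3 := natDegree_iterate_derivative ((X - 1 : ℝ[X]) ^ (n + 2) * (X + 1) ^ (n + 2)) n
  have h4 := le_natDegree_of_ne_zero hc
  rw [natDegree_C_mul (rodrigues_scale_ne_zero n), hm.natDegree_mul' hne,
    natDegree_sub_one_pow_mul] at h2
  omega

theorem natDegree_jacobiNeg_le (p : ℕ) : (jacobiNeg p).natDegree ≤ max p 3 := by
  rcases p with _ | _ | _ | _ | n
  · rw [jacobiNeg]; refine le_trans ?_ (le_max_right _ _); compute_degree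
  · rw [jacobiNeg]; refine le_trans ?_ (le_max_right _ _); compute_degree
  · rw [jacobiNeg]; refine le_trans ?_ (le_max_right _ _); compute_degree
  · rw [jacobiNeg]; refine le_trans ?_ (le_max_right _ _); compute_degree
  · rw [jacobiNeg_add_four]
    refine natDegree_mul_le.trans ?_
    rw [natDegree_sub_one_pow_mul, (natDegree_jacobi_two n).1]
    omega

theorem integral_iterate_derivative_mul (n : ℕ) (W q : ℝ[X])
    (h1 : ∀ i < n, (derivative^[i] W).eval 1 = 0) (h2 : ∀ i < n, (derivative^[i] W).eval (-1) = 0) :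
    ∫ s in (-1 : ℝ)..1, (derivative^[n] W).eval s * q.eval s =
      (-1) ^ n * ∫ s in (-1 : ℝ)..1, W.eval s * (derivative^[n] q).eval s := by
  induction n generalizing q with
  | zero => simp
  | succ n ih =>
    have h3 := intervalIntegral.integral_mul_deriv_eq_deriv_mul (a := -1) (b := 1)
      (u := fun s => q.eval s) (v := fun s => (derivative^[n] W).eval s)
      (u' := fun s => (derivative q).eval s) (v' := fun s => (derivative^[n + 1] W).eval s)
      (fun s _ => q.hasDerivAt s)
      (fun s _ => by
        rw [Function.iterate_succ_apply']; exact (derivative^[n] W).hasDerivAt s)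
      ((derivative q).continuous.intervalIntegrable _ _)
      ((derivative^[n + 1] W).continuous.intervalIntegrable _ _)
    simp only [h1 n n.lt_succ_self, h2 n n.lt_succ_self, mul_zero, sub_zero, zero_sub] at h3
    calc ∫ s in (-1 : ℝ)..1, (derivative^[n + 1] W).eval s * q.eval s
        = -∫ s in (-1 : ℝ)..1, (derivative^[n] W).eval s * (derivative q).eval s := by
          simp only [mul_comm (eval _ (derivative^[n + 1] W)), h3, mul_comm (eval _ (derivative q))]
      _ = _ := by
          rw [ih (derivative q) (fun i hi => h1 i (by omega)) (fun i hi => h2 i (by omega)),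
            ← Function.iterate_succ_apply]
          ring

/-- By Rodrigues' formula the first factor is, up to scale, the n-th derivative of a polynomial with
zeros of order n + 2 at ±1. Integrating by parts n times leaves no boundary terms, and n derivatives
kill `q`. -/
theorem integral_jacobiNeg_mul (n : ℕ) (q : ℝ[X]) (hq : q.degree < n) :
    ∫ s in (-1 : ℝ)..1, (jacobiNeg (n + 4)).eval s * q.eval s = 0 := by
  have h1 := rodrigues 2 2 n
  rw [← jacobiNeg_add_four] at h1
  set W : ℝ[X] := (X - 1) ^ (n + 2) * (X + 1) ^ (n + 2) with hW
  have key := integral_iterate_derivative_mul n W q (fun i hi => by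
      have hdvd : (X - 1 : ℝ[X]) ∣ derivative^[i] W :=
        (dvd_pow_self _ (by omega)).trans (pow_sub_dvd_iterate_derivative_of_pow_dvd (n := n + 2) i
          (Dvd.intro _ rfl))
      exact eval_eq_zero_of_dvd_of_eval_eq_zero hdvd (by simp)) (fun i hi => by
      have hdvd : (X + 1 : ℝ[X]) ∣ derivative^[i] W :=
        (dvd_pow_self _ (by omega)).trans (pow_sub_dvd_iterate_derivative_of_pow_dvd (n := n + 2) i
          (Dvd.intro_left _ rfl))
      exact eval_eq_zero_of_dvd_of_eval_eq_zero hdvd (by simp))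
  rw [iterate_derivative_eq_zero_of_degree_lt hq, ← h1] at key
  simp only [eval_mul, eval_C, eval_zero, mul_zero, intervalIntegral.integral_zero, mul_assoc,
    intervalIntegral.integral_const_mul] at key
  have h2 := rodrigues_scale_ne_zero n
  simpa [h2, Nat.factorial_ne_zero] using key

theorem jacobi_two_span (n : ℕ) (w : ℝ[X]) (hw : w.degree < n) :
    ∃ c : ℕ → ℝ, w = ∑ m ∈ Finset.range n, C (c m) * jacobi 2 2 m := by
  induction n generalizing w with
  | zero =>
    refine ⟨0, ?_⟩
    simpa using hw
  | succ n ih =>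
    obtain ⟨hd, hne⟩ := natDegree_jacobi_two n
    have hl : (jacobi 2 2 n).coeff n ≠ 0 := by
      conv => enter [1, 2]; rw [← hd]
      exact leadingCoeff_ne_zero.mpr hne
    set e : ℝ := w.coeff n / (jacobi 2 2 n).coeff n with he
    have hlt : (w - C e * jacobi 2 2 n).degree < n := by
      rw [degree_lt_iff_coeff_zero]
      intro m hm
      rcases hm.eq_or_lt with rfl | hm
      · simp [he, hl]
      · rw [coeff_sub, coeff_C_mul, coeff_eq_zero_of_natDegree_lt (p := jacobi 2 2 n) (by omega),
          (degree_lt_iff_coeff_zero _ _).mp hw m (by exact_mod_cast hm)]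
        simp
    obtain ⟨c, hc⟩ := ih _ hlt
    refine ⟨fun m => if m = n then e else c m, ?_⟩
    have h1 : ∑ m ∈ Finset.range n, C (if m = n then e else c m) * jacobi 2 2 m =
        w - C e * jacobi 2 2 n := by
      rw [hc]
      exact Finset.sum_congr rfl fun m hm => by rw [if_neg (Finset.mem_range.mp hm).ne]
    simp only [Finset.sum_range_succ, h1, if_true]
    ring

/-- After subtraction of the cubic Hermite interpolant the remainder has double zeros at ±1. It is
thus divisible by (X - 1)^2 (X + 1)^2, and the quotient, of degree less than n, is expanded in the
`jacobi 2 2 m`. -/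
theorem jacobiNeg_span (n : ℕ) (v : ℝ[X]) (hv : v.degree < (n + 4 : ℕ)) :
    ∃ c : ℕ → ℝ, v = ∑ p ∈ Finset.range (n + 4), C (c p) * jacobiNeg p := by
  set d0 := v.eval (-1)
  set d1 := v.eval 1
  set d2 := (derivative v).eval (-1)
  set d3 := (derivative v).eval 1
  set H : ℝ[X] := C d0 * jacobiNeg 0 + C d1 * jacobiNeg 1 + C d2 * jacobiNeg 2 +
    C d3 * jacobiNeg 3 with hH
  set R := v - H with hR
  have e0 : R.eval (-1) = 0 := by
    simp [hR, hH, jacobiNeg, d0]; ring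
  have e1 : R.eval 1 = 0 := by
    simp [hR, hH, jacobiNeg, d1]; ring
  have e2 : (derivative R).eval (-1) = 0 := by
    simp [hR, hH, jacobiNeg, d2, derivative_pow]; ring
  have e3 : (derivative R).eval 1 = 0 := by
    simp [hR, hH, jacobiNeg, d3, derivative_pow]; ring
  have dbl : ∀ (x : ℝ) (Q : ℝ[X]), Q.eval x = 0 → (derivative Q).eval x = 0 →
      (X - C x) ^ 2 ∣ Q := by
    intro x Q h h'
    obtain ⟨Q1, rfl⟩ := dvd_iff_isRoot.mpr h
    have : Q1.IsRoot x := by simpa using h'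
    obtain ⟨Q2, rfl⟩ := dvd_iff_isRoot.mpr this
    exact ⟨Q2, by ring⟩
  have cop : IsCoprime ((X - C (-1 : ℝ)) ^ 2) ((X - C 1) ^ 2) :=
    (isCoprime_X_sub_C_of_isUnit_sub (by norm_num)).pow
  obtain ⟨w, hw⟩ := cop.mul_dvd (dbl _ _ e0 e2) (dbl _ _ e1 e3)
  have hw' : R = (X - 1) ^ 2 * (X + 1) ^ 2 * w := by
    rw [hw, C_neg, C_1]; ring
  have hRd : R.degree < (n + 4 : ℕ) := by
    have : ∀ p, (jacobiNeg p).natDegree ≤ max p 3 := natDegree_jacobiNeg_le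
    have h3 : ∀ (p : ℕ) (d : ℝ), p ≤ 3 → (C d * jacobiNeg p).degree < (n + 4 : ℕ) := by
      intro p d hp
      refine lt_of_le_of_lt degree_le_natDegree ?_
      have h4 := natDegree_C_mul_le d (jacobiNeg p)
      have h5 := this p
      exact_mod_cast (show (C d * jacobiNeg p).natDegree < n + 4 by omega)
    refine (degree_sub_le _ _).trans_lt (max_lt hv ?_)
    refine (degree_add_le _ _).trans_lt (max_lt ((degree_add_le _ _).trans_lt
      (max_lt ((degree_add_le _ _).trans_lt (max_lt ?_ ?_)) ?_)) ?_)
    all_goals exact h3 _ _ (by norm_num)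
  have hwd : w.degree < n := by
    by_cases hw0 : w = 0
    · simp [hw0]
    have hm : ((X - 1 : ℝ[X]) ^ 2 * (X + 1) ^ 2).Monic := by
      rw [show (X - 1 : ℝ[X]) = X - C 1 by simp, show (X + 1 : ℝ[X]) = X + C 1 by simp]
      exact ((monic_X_sub_C (1 : ℝ)).pow 2).mul ((monic_X_add_C (1 : ℝ)).pow 2)
    have hR0 : R ≠ 0 := by
      rw [hw']; exact mul_ne_zero hm.ne_zero hw0
    rw [degree_eq_natDegree hR0, hw', hm.natDegree_mul' hw0, natDegree_sub_one_pow_mul] at hRd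
    rw [degree_eq_natDegree hw0]
    norm_cast at hRd ⊢
    omega
  obtain ⟨c, hc⟩ := jacobi_two_span n w hwd
  -- The endpoint data are the first four coefficients; those of the quotient follow, shifted by
  -- four.
  refine ⟨fun p => if p = 0 then d0 else if p = 1 then d1 else if p = 2 then d2 else
    if p = 3 then d3 else c (p - 4), ?_⟩
  have hv' : v = H + R := by rw [hR]; ring
  have h4 : ∀ m, jacobiNeg (4 + m) = (X - 1) ^ 2 * (X + 1) ^ 2 * jacobi 2 2 m := fun m => by
    rw [add_comm, jacobiNeg_add_four]
  rw [hv', hw', hc, hH, add_comm n 4, Finset.sum_range_add, Finset.mul_sum]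
  congr 1
  · simp [Finset.sum_range_succ]
  · refine Finset.sum_congr rfl fun m _ => ?_
    rw [h4]
    have : (4 + m ≠ 0) ∧ (4 + m ≠ 1) ∧ (4 + m ≠ 2) ∧ (4 + m ≠ 3) := by omega
    simp only [this, if_false, Nat.add_sub_cancel_left]
    ring

/-! ### Biorthogonality of the basis and the coefficients -/

theorem jacobiNeg_eval_one (p : ℕ) : (jacobiNeg p).eval 1 = if p = 1 then 1 else 0 := by
  rcases p with _ | _ | _ | _ | n <;> simp [jacobiNeg]
  norm_num

theorem jacobiNeg_eval_neg_one (p : ℕ) : (jacobiNeg p).eval (-1) = if p = 0 then 1 else 0 := by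
  rcases p with _ | _ | _ | _ | n <;> simp [jacobiNeg]
  norm_num

theorem derivative_jacobiNeg_eval_one (p : ℕ) :
    (derivative (jacobiNeg p)).eval 1 = if p = 3 then 1 else 0 := by
  rcases p with _ | _ | _ | _ | n <;> simp [jacobiNeg, derivative_pow] <;> norm_num

theorem derivative_jacobiNeg_eval_neg_one (p : ℕ) :
    (derivative (jacobiNeg p)).eval (-1) = if p = 2 then 1 else 0 := by
  rcases p with _ | _ | _ | _ | n <;> simp [jacobiNeg, derivative_pow] <;> norm_num

theorem uniqueDiffWithinAt_ref {s : ℝ} (hs : s ∈ Icc (-1 : ℝ) 1) :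
    UniqueDiffWithinAt ℝ (Icc (-1 : ℝ) 1) s :=
  uniqueDiffOn_Icc (by norm_num) s hs

theorem derivWithin_eval_ref (q : ℝ[X]) {s : ℝ} (hs : s ∈ Icc (-1 : ℝ) 1) :
    derivWithin (fun s => q.eval s) (Icc (-1) 1) s = (derivative q).eval s :=
  (q.hasDerivAt s).hasDerivWithinAt.derivWithin (uniqueDiffWithinAt_ref hs)

theorem weighted_norm_pos (n : ℕ) :
    0 < ∫ s in (-1 : ℝ)..1, (jacobi 2 2 n).eval s ^ 2 * ((1 - s) ^ 2 * (1 + s) ^ 2) := by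
  have hc : Continuous fun s : ℝ => (jacobi 2 2 n).eval s ^ 2 * ((1 - s) ^ 2 * (1 + s) ^ 2) := by
    have := (jacobi 2 2 n).continuous
    fun_prop
  refine intervalIntegral.integral_pos (by norm_num) hc.continuousOn (fun s _ => by positivity) ?_
  by_contra! hle
  refine (natDegree_jacobi_two n).2 (Polynomial.eq_zero_of_infinite_isRoot _
    ((Ioo_infinite (show (-1 : ℝ) < 1 by norm_num)).mono fun s hs => ?_))
  have h1 := hle s (Ioo_subset_Icc_self hs)
  have h2 : 0 < (1 - s) ^ 2 * (1 + s) ^ 2 :=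
    mul_pos (pow_pos (by linarith [hs.2]) 2) (pow_pos (by linarith [hs.1]) 2)
  have h3 : (jacobi 2 2 n).eval s ^ 2 ≤ 0 := by
    by_contra! h
    exact absurd (mul_pos h h2) (not_lt.mpr h1)
  exact pow_eq_zero_iff (two_ne_zero) |>.mp (le_antisymm h3 (sq_nonneg _))

theorem hermite_jacobiNeg (q : ℕ) (s : ℝ) :
    hermite (fun s => (jacobiNeg q).eval s) s = if q < 4 then (jacobiNeg q).eval s else 0 := by
  rw [hermite, derivWithin_eval_ref _ (by norm_num), derivWithin_eval_ref _ (by norm_num)]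
  simp only [jacobiNeg_eval_one, jacobiNeg_eval_neg_one, derivative_jacobiNeg_eval_one,
    derivative_jacobiNeg_eval_neg_one]
  rcases q with _ | _ | _ | _ | n <;> simp

theorem jacobiCoeff_jacobiNeg (p q : ℕ) :
    jacobiCoeff p (fun s => (jacobiNeg q).eval s) = if p = q then 1 else 0 := by
  have e : ∀ a b : ℕ, (if a = b then (1 : ℝ) else 0) = if b = a then 1 else 0 := fun a b => by
    simp only [eq_comm]
  rcases p with _ | _ | _ | _ | n
  · rw [jacobiCoeff, jacobiNeg_eval_neg_one, e]
  · rw [jacobiCoeff, jacobiNeg_eval_one, e]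
  · rw [jacobiCoeff, derivWithin_eval_ref _ (by norm_num), derivative_jacobiNeg_eval_neg_one, e]
  · rw [jacobiCoeff, derivWithin_eval_ref _ (by norm_num), derivative_jacobiNeg_eval_one, e]
  · simp only [jacobiCoeff, hermite_jacobiNeg]
    by_cases hq : q < 4
    · have : n + 4 ≠ q := by omega
      simp [hq, this]
    obtain ⟨m, rfl⟩ : ∃ m, q = m + 4 := ⟨q - 4, by omega⟩
    simp only [hq, if_false, sub_zero]
    rcases lt_trichotomy n m with h | h | h
    · rw [integral_jacobiNeg_mul, zero_div, if_neg (by omega)]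
      rw [degree_eq_natDegree (natDegree_jacobi_two n).2, (natDegree_jacobi_two n).1]
      exact_mod_cast h
    · subst h
      rw [if_pos rfl, div_eq_one_iff_eq (weighted_norm_pos n).ne']
      congr 1
      ext s
      rw [jacobiNeg_add_four]
      simp
      ring
    -- The weight may be attached to either polynomial; here it goes to the one of higher degree, so
    -- that the other one is orthogonal to it.
    · rw [show (fun s => (jacobiNeg (m + 4)).eval s * (jacobi 2 2 n).eval s) =
          fun s => (jacobiNeg (n + 4)).eval s * (jacobi 2 2 m).eval s by
        ext s
        simp only [jacobiNeg_add_four, eval_mul]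
        ring]
      rw [integral_jacobiNeg_mul, zero_div, if_neg (by omega)]
      rw [degree_eq_natDegree (natDegree_jacobi_two m).2, (natDegree_jacobi_two m).1]
      exact_mod_cast h

/-- The functional `c₀ v(-1) + c₁ v(1) + c₂ v'(-1) + c₃ v'(1) + ∫ v W` on the reference interval. -/
noncomputable def endpointFunctional (c : Fin 4 → ℝ) (W : ℝ[X]) (v v' : ℝ → ℝ) : ℝ :=
  c 0 * v (-1) + c 1 * v 1 + c 2 * v' (-1) + c 3 * v' 1 + ∫ s in (-1 : ℝ)..1, v s * W.eval s

/-- One shape for all coefficients: endpoint values, endpoint slopes and an integral against a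
polynomial. Bounds, limits and derivatives in a parameter are then treated once for all p. -/
theorem exists_jacobiCoeff_eq (p : ℕ) :
    ∃ (c : Fin 4 → ℝ) (W : ℝ[X]), ∀ v : ℝ → ℝ, ContinuousOn v (Icc (-1) 1) →
      jacobiCoeff p v = endpointFunctional c W v (derivWithin v (Icc (-1) 1)) := by
  rcases p with _ | _ | _ | _ | n
  · exact ⟨![1, 0, 0, 0], 0, fun v _ => by simp [jacobiCoeff, endpointFunctional]⟩
  · exact ⟨![0, 1, 0, 0], 0, fun v _ => by simp [jacobiCoeff, endpointFunctional]⟩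
  · exact ⟨![0, 0, 1, 0], 0, fun v _ => by simp [jacobiCoeff, endpointFunctional]⟩
  · exact ⟨![0, 0, 0, 1], 0, fun v _ => by simp [jacobiCoeff, endpointFunctional]⟩
  · set D := ∫ s in (-1 : ℝ)..1, (jacobi 2 2 n).eval s ^ 2 * ((1 - s) ^ 2 * (1 + s) ^ 2) with hD
    have hD0 : D ≠ 0 := (weighted_norm_pos n).ne'
    set I : ℕ → ℝ := fun q => ∫ s in (-1 : ℝ)..1, (jacobiNeg q).eval s * (jacobi 2 2 n).eval s
      with hI
    -- The Hermite interpolant is linear in the four endpoint data, so its integral against `jacobi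
    -- 2 2 n` moves into the constants; `D` is the normalising weighted norm.
    refine ⟨![-I 0 / D, -I 1 / D, -I 2 / D, -I 3 / D], C (1 / D) * jacobi 2 2 n, fun v hv => ?_⟩
    have hv' : IntervalIntegrable (fun s => v s * (jacobi 2 2 n).eval s) volume (-1) 1 := by
      apply ContinuousOn.intervalIntegrable
      rw [uIcc_of_le (by norm_num)]
      exact hv.mul (jacobi 2 2 n).continuous.continuousOn
    have hi : ∀ (q : ℕ) (e : ℝ), IntervalIntegrable
        (fun s => e * ((jacobiNeg q).eval s * (jacobi 2 2 n).eval s)) volume (-1) 1 := fun q e =>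
      (continuous_const.mul ((jacobiNeg q).continuous.mul
        (jacobi 2 2 n).continuous)).intervalIntegrable _ _
    have h1 : ∫ s in (-1 : ℝ)..1, (v s - hermite v s) * (jacobi 2 2 n).eval s =
        (∫ s in (-1 : ℝ)..1, v s * (jacobi 2 2 n).eval s) - (v (-1) * I 0 + v 1 * I 1 +
          derivWithin v (Icc (-1) 1) (-1) * I 2 + derivWithin v (Icc (-1) 1) 1 * I 3) := by
      simp only [hI, ← intervalIntegral.integral_const_mul]
      rw [← intervalIntegral.integral_add (hi _ _) (hi _ _), ← intervalIntegral.integral_add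
        ((hi _ _).add (hi _ _)) (hi _ _), ← intervalIntegral.integral_add
        (((hi _ _).add (hi _ _)).add (hi _ _)) (hi _ _), ← intervalIntegral.integral_sub hv'
        ((((hi _ _).add (hi _ _)).add (hi _ _)).add (hi _ _))]
      congr 1
      ext s
      rw [hermite]
      ring
    have h2 : ∫ s in (-1 : ℝ)..1, v s * (C (1 / D) * jacobi 2 2 n).eval s =
        (∫ s in (-1 : ℝ)..1, v s * (jacobi 2 2 n).eval s) / D := by
      rw [← intervalIntegral.integral_div]
      congr 1
      ext s
      simp only [eval_mul, eval_C]
      ring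
    rw [jacobiCoeff, h1, endpointFunctional, h2, ← hD]
    simp
    field_simp
    ring

/-! ### Partial derivatives of smooth functions on the plane -/

/-- The classical partial derivative in the first variable. -/
noncomputable def pdX (f : ℝ × ℝ → ℝ) (P : ℝ × ℝ) : ℝ := deriv (fun s => f (s, P.2)) P.1

/-- The classical partial derivative in the second variable. -/
noncomputable def pdY (f : ℝ × ℝ → ℝ) (P : ℝ × ℝ) : ℝ := deriv (fun t => f (P.1, t)) P.2

theorem classicalDeriv_eq (i j : ℕ) (f : ℝ × ℝ → ℝ) :
    classicalDeriv i j f = pdX^[i] (pdY^[j] f) := rfl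

section smooth

variable {f : ℝ × ℝ → ℝ}

theorem pdX_eq_fderiv {P : ℝ × ℝ} (hf : DifferentiableAt ℝ f P) : pdX f P = fderiv ℝ f P (1, 0) := by
  have h1 : HasDerivAt (fun s : ℝ => (s, P.2)) ((1 : ℝ), (0 : ℝ)) P.1 :=
    (hasDerivAt_id _).prodMk (hasDerivAt_const _ _)
  exact (hf.hasFDerivAt.comp_hasDerivAt (f := fun s : ℝ => (s, P.2)) P.1 h1).deriv

theorem pdY_eq_fderiv {P : ℝ × ℝ} (hf : DifferentiableAt ℝ f P) : pdY f P = fderiv ℝ f P (0, 1) := by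
  have h1 : HasDerivAt (fun s : ℝ => (P.1, s)) ((0 : ℝ), (1 : ℝ)) P.2 :=
    (hasDerivAt_const _ _).prodMk (hasDerivAt_id _)
  exact (hf.hasFDerivAt.comp_hasDerivAt (f := fun s : ℝ => (P.1, s)) P.2 h1).deriv

theorem hasDerivAt_pdX (hf : Differentiable ℝ f) (x y : ℝ) :
    HasDerivAt (fun s => f (s, y)) (pdX f (x, y)) x := by
  have : DifferentiableAt ℝ (fun s => f (s, y)) x :=
    (hf (x, y)).comp (f := fun s : ℝ => (s, y)) x
      (differentiableAt_id.prodMk (differentiableAt_const _))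
  exact this.hasDerivAt

theorem hasDerivAt_pdY (hf : Differentiable ℝ f) (x y : ℝ) :
    HasDerivAt (fun t => f (x, t)) (pdY f (x, y)) y := by
  have : DifferentiableAt ℝ (fun t => f (x, t)) y :=
    (hf (x, y)).comp (f := fun t : ℝ => (x, t)) y
      ((differentiableAt_const _).prodMk differentiableAt_id)
  exact this.hasDerivAt

theorem differentiable_of_smooth {E : Type*} [NormedAddCommGroup E] [NormedSpace ℝ E] {g : E → ℝ}
    (hg : ContDiff ℝ ∞ g) : Differentiable ℝ g :=
  hg.differentiable (by simp)

theorem contDiff_pdX (hf : ContDiff ℝ ∞ f) : ContDiff ℝ ∞ (pdX f) := by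
  rw [show pdX f = fun P => fderiv ℝ f P (1, 0) from
    funext fun P => pdX_eq_fderiv (differentiable_of_smooth hf P)]
  exact (hf.fderiv_right (m := ∞) (by simp)).clm_apply contDiff_const

theorem contDiff_pdY (hf : ContDiff ℝ ∞ f) : ContDiff ℝ ∞ (pdY f) := by
  rw [show pdY f = fun P => fderiv ℝ f P (0, 1) from
    funext fun P => pdY_eq_fderiv (differentiable_of_smooth hf P)]
  exact (hf.fderiv_right (m := ∞) (by simp)).clm_apply contDiff_const

theorem pdX_pdY_comm (hf : ContDiff ℝ ∞ f) : pdX (pdY f) = pdY (pdX f) := by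
  have hd : Differentiable ℝ (fderiv ℝ f) :=
    (hf.fderiv_right (m := ∞) (by simp)).differentiable (by simp)
  have h1 : pdY f = fun P => fderiv ℝ f P (0, 1) :=
    funext fun P => pdY_eq_fderiv (differentiable_of_smooth hf P)
  have h2 : pdX f = fun P => fderiv ℝ f P (1, 0) :=
    funext fun P => pdX_eq_fderiv (differentiable_of_smooth hf P)
  ext P
  rw [pdX_eq_fderiv (differentiable_of_smooth (contDiff_pdY hf) P),
    pdY_eq_fderiv (differentiable_of_smooth (contDiff_pdX hf) P), h1, h2,
    fderiv_clm_apply (hd P) (differentiableAt_const _),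
    fderiv_clm_apply (hd P) (differentiableAt_const _)]
  have := (hf.contDiffAt (x := P)).isSymmSndFDerivAt
    (by rw [minSmoothness_of_isRCLikeNormedField]; exact ENat.LEInfty.out)
  simpa using this.eq (1, 0) (0, 1)

theorem contDiff_pdX_iterate (hf : ContDiff ℝ ∞ f) (i : ℕ) : ContDiff ℝ ∞ (pdX^[i] f) := by
  induction i with
  | zero => exact hf
  | succ i ih => rw [Function.iterate_succ_apply']; exact contDiff_pdX ih

theorem contDiff_pdY_iterate (hf : ContDiff ℝ ∞ f) (i : ℕ) : ContDiff ℝ ∞ (pdY^[i] f) := by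
  induction i with
  | zero => exact hf
  | succ i ih => rw [Function.iterate_succ_apply']; exact contDiff_pdY ih

theorem contDiff_classicalDeriv (hf : ContDiff ℝ ∞ f) (i j : ℕ) :
    ContDiff ℝ ∞ (classicalDeriv i j f) :=
  contDiff_pdX_iterate (contDiff_pdY_iterate hf j) i

theorem pdX_classicalDeriv (i j : ℕ) : pdX (classicalDeriv i j f) = classicalDeriv (i + 1) j f := by
  rw [classicalDeriv_eq, classicalDeriv_eq, Function.iterate_succ_apply']

theorem pdY_pdX_iterate (hf : ContDiff ℝ ∞ f) (i : ℕ) : pdY (pdX^[i] f) = pdX^[i] (pdY f) := by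
  induction i with
  | zero => rfl
  | succ i ih =>
    rw [Function.iterate_succ_apply', Function.iterate_succ_apply', ← ih,
      pdX_pdY_comm (contDiff_pdX_iterate hf i)]

theorem pdY_classicalDeriv (hf : ContDiff ℝ ∞ f) (i j : ℕ) :
    pdY (classicalDeriv i j f) = classicalDeriv i (j + 1) f := by
  rw [classicalDeriv_eq, classicalDeriv_eq, Function.iterate_succ_apply',
    pdY_pdX_iterate (contDiff_pdY_iterate hf j)]

theorem contDiff_slice_fst (hf : ContDiff ℝ ∞ f) (t : ℝ) : ContDiff ℝ ∞ fun s => f (s, t) :=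
  hf.comp (contDiff_id.prodMk contDiff_const)

theorem contDiff_slice_snd (hf : ContDiff ℝ ∞ f) (s : ℝ) : ContDiff ℝ ∞ fun t => f (s, t) :=
  hf.comp (contDiff_const.prodMk contDiff_id)

theorem iteratedDeriv_slice_fst (i : ℕ) (s t : ℝ) :
    iteratedDeriv i (fun s => f (s, t)) s = classicalDeriv i 0 f (s, t) := by
  induction i generalizing s with
  | zero => simp [classicalDeriv_eq]
  | succ i ih =>
    rw [iteratedDeriv_succ, funext fun s => ih s, ← pdX_classicalDeriv]
    rfl

theorem iteratedDeriv_slice_snd (j : ℕ) (s t : ℝ) :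
    iteratedDeriv j (fun t => f (s, t)) t = classicalDeriv 0 j f (s, t) := by
  induction j generalizing t with
  | zero => simp [classicalDeriv_eq]
  | succ j ih =>
    rw [iteratedDeriv_succ, funext fun t => ih t, classicalDeriv_eq, classicalDeriv_eq,
      Function.iterate_succ_apply']
    rfl

theorem classicalDeriv_fst_classicalDeriv_snd (i j : ℕ) :
    classicalDeriv i 0 (classicalDeriv 0 j f) = classicalDeriv i j f := rfl

end smooth

/-! ### Differentiation under the integral sign on a closed strip -/

/-- By the fundamental theorem w(s,τ) = w(s,c) + ∫_c^τ w'(s,θ) dθ. After integration in s and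
exchange of the integrals, the function to be differentiated is a primitive of a continuous
function. -/
theorem hasDerivWithinAt_integral_strip {p q c d : ℝ} (hpq : p ≤ q) (hcd : c ≤ d)
    {w w' : ℝ × ℝ → ℝ} (hw : ContinuousOn w (Icc p q ×ˢ Icc c d))
    (hw' : ContinuousOn w' (Icc p q ×ˢ Icc c d))
    (hd : ∀ s ∈ Icc p q, ∀ t ∈ Icc c d,
      HasDerivWithinAt (fun t => w (s, t)) (w' (s, t)) (Icc c d) t)
    {t : ℝ} (ht : t ∈ Icc c d) :
    HasDerivWithinAt (fun t => ∫ s in p..q, w (s, t)) (∫ s in p..q, w' (s, t)) (Icc c d) t := by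
  -- Clamping both arguments extends `w'` continuously to the plane, so the primitive is
  -- differentiable on both sides even at the ends of [c, d].
  set W : ℝ → ℝ → ℝ := fun τ s => w' (projIcc p q hpq s, projIcc c d hcd τ) with hW
  have hWc : Continuous (Function.uncurry W) := by
    refine hw'.comp_continuous ?_ fun z => ⟨(projIcc p q hpq z.2).2, (projIcc c d hcd z.1).2⟩
    exact (continuous_subtype_val.comp (continuous_projIcc.comp continuous_snd)).prodMk
      (continuous_subtype_val.comp (continuous_projIcc.comp continuous_fst))
  have hWe : ∀ s ∈ Icc p q, ∀ τ ∈ Icc c d, W τ s = w' (s, τ) := fun s hs τ hτ => by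
    simp only [hW, projIcc_of_mem hpq hs, projIcc_of_mem hcd hτ]
  have hG : Continuous fun τ => ∫ s in p..q, W τ s :=
    intervalIntegral.continuous_parametric_intervalIntegral_of_continuous' hWc p q
  have hslice : ∀ τ ∈ Icc c d, ContinuousOn (fun s => w (s, τ)) (Icc p q) := fun τ hτ =>
    hw.comp (by fun_prop) fun s hs => ⟨hs, hτ⟩
  have hint : ∀ τ ∈ Icc c d, IntervalIntegrable (fun s => w (s, τ)) volume p q := fun τ hτ =>
    ContinuousOn.intervalIntegrable (by rw [uIcc_of_le hpq]; exact hslice τ hτ)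
  have key : ∀ τ ∈ Icc c d, ∫ s in p..q, w (s, τ) =
      (∫ s in p..q, w (s, c)) + ∫ θ in c..τ, ∫ s in p..q, W θ s := by
    intro τ hτ
    have hc : c ∈ Icc c d := ⟨le_rfl, hcd⟩
    rw [intervalIntegral_intervalIntegral_swap, ← sub_eq_iff_eq_add',
      ← intervalIntegral.integral_sub (hint τ hτ) (hint c hc)]
    · refine intervalIntegral.integral_congr fun s hs => ?_
      rw [uIcc_of_le hpq] at hs
      symm
      refine intervalIntegral.integral_eq_sub_of_hasDerivAt_of_le (f := fun t => w (s, t)) hτ.1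
        (fun θ hθ => ?_) (fun θ hθ => ?_) ?_
      · exact ((hd s hs θ ⟨hθ.1, hθ.2.trans hτ.2⟩).continuousWithinAt).mono
          (Icc_subset_Icc_right hτ.2)
      · have hθ' : θ ∈ Icc c d := ⟨hθ.1.le, hθ.2.le.trans hτ.2⟩
        rw [hWe s hs θ hθ']
        exact (hd s hs θ hθ').hasDerivAt (Icc_mem_nhds hθ.1 (hθ.2.trans_le hτ.2))
      · exact (hWc.comp (by fun_prop : Continuous fun θ : ℝ => (θ, s))).intervalIntegrable _ _
    · have : IsCompact (uIcc c τ ×ˢ uIcc p q) := isCompact_uIcc.prod isCompact_uIcc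
      exact (hWc.continuousOn.integrableOn_compact this).mono_set
        (prod_mono uIoc_subset_uIcc uIoc_subset_uIcc)
  have h1 : HasDerivAt (fun τ => (∫ s in p..q, w (s, c)) + ∫ θ in c..τ, ∫ s in p..q, W θ s)
      (∫ s in p..q, W t s) t :=
    ((hG.integral_hasStrictDerivAt c t).hasDerivAt).const_add _
  have h2 : ∫ s in p..q, W t s = ∫ s in p..q, w' (s, t) := by
    refine intervalIntegral.integral_congr fun s hs => ?_
    rw [uIcc_of_le hpq] at hs
    exact hWe s hs t ht
  rw [← h2]
  exact h1.hasDerivWithinAt.congr key (key t ht)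

/-! ### Taylor polynomials on the reference interval -/

/-- The polynomial `∑_{m<r} a_m (X+1)^m / m!`. -/
noncomputable def taylorPoly (a : ℕ → ℝ) (r : ℕ) : ℝ[X] :=
  ∑ m ∈ Finset.range r, C (a m / m.factorial) * (X + 1) ^ m

/-- The coefficient sequence shifts exactly as the derivatives of a function do when the function is
replaced by its derivative. The inductions on the order of the remainder rest on this. -/
theorem derivative_taylorPoly (a : ℕ → ℝ) (r : ℕ) :
    derivative (taylorPoly a (r + 1)) = taylorPoly (fun m => a (m + 1)) r := by
  rw [taylorPoly, Finset.sum_range_succ', taylorPoly, derivative_add, derivative_sum]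
  simp only [pow_zero, mul_one, derivative_C, add_zero]
  refine Finset.sum_congr rfl fun m _ => ?_
  rw [derivative_C_mul, derivative_pow, show (X + 1 : ℝ[X]) = X + C 1 by simp,
    derivative_X_add_C, mul_one, Nat.add_sub_cancel, ← mul_assoc, ← C_mul]
  congr 2
  rw [Nat.factorial_succ]
  push_cast
  have : (m.factorial : ℝ) ≠ 0 := by positivity
  field_simp

theorem taylorPoly_eval_neg_one (a : ℕ → ℝ) (r : ℕ) : (taylorPoly a (r + 1)).eval (-1) = a 0 := by
  rw [taylorPoly, Finset.sum_range_succ']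
  simp [eval_finsetSum]

theorem degree_taylorPoly_lt (a : ℕ → ℝ) (r : ℕ) : (taylorPoly a r).degree < r := by
  rw [← mem_degreeLT]
  refine Submodule.sum_mem _ fun m hm => ?_
  rw [mem_degreeLT]
  refine lt_of_le_of_lt ?_ (Nat.cast_lt.mpr (Finset.mem_range.mp hm))
  rw [show (X + 1 : ℝ[X]) = X + C 1 by simp]
  refine (degree_mul_le _ _).trans ?_
  rw [degree_pow, degree_X_add_C]
  calc (C (a m / m.factorial)).degree + m • (1 : WithBot ℕ) ≤ 0 + m • (1 : WithBot ℕ) := by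
        gcongr; exact degree_C_le
    _ = m := by simp

theorem contDiff_eval (q : ℝ[X]) : ContDiff ℝ ∞ fun s => q.eval s := by
  simpa using q.contDiff_aeval (𝕜 := ℝ) ∞

theorem deriv_sub_eval {v : ℝ → ℝ} (hv : ContDiff ℝ ∞ v) (q : ℝ[X]) :
    deriv (fun s => v s - q.eval s) = fun s => deriv v s - (derivative q).eval s := by
  ext s
  exact ((differentiable_of_smooth hv s).hasDerivAt.sub (q.hasDerivAt s)).deriv

theorem contDiff_deriv {v : ℝ → ℝ} (hv : ContDiff ℝ ∞ v) : ContDiff ℝ ∞ (deriv v) :=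
  (contDiff_infty_iff_deriv.mp hv).2

theorem abs_le_of_deriv_bound {e : ℝ → ℝ} (he : Differentiable ℝ e) (h0 : e (-1) = 0) {B : ℝ}
    (hB : ∀ s ∈ Icc (-1 : ℝ) 1, |deriv e s| ≤ B) {s : ℝ} (hs : s ∈ Icc (-1 : ℝ) 1) :
    |e s| ≤ 2 * B := by
  have h1 := (convex_Icc (-1 : ℝ) 1).norm_image_sub_le_of_norm_deriv_le (f := e)
    (fun x _ => he x) hB (show (-1 : ℝ) ∈ Icc (-1 : ℝ) 1 by norm_num) hs
  rw [h0, sub_zero, Real.norm_eq_abs, Real.norm_eq_abs,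
    abs_of_nonneg (a := s - -1) (by linarith [hs.1])] at h1
  have hB0 : 0 ≤ B := (abs_nonneg _).trans (hB s hs)
  nlinarith [hs.2]

theorem abs_le_integral_abs_deriv {e : ℝ → ℝ} (he : ContDiff ℝ ∞ e) (h0 : e (-1) = 0) {s : ℝ}
    (hs : s ∈ Icc (-1 : ℝ) 1) : |e s| ≤ ∫ σ in (-1 : ℝ)..1, |deriv e σ| := by
  have hc : Continuous (deriv e) := (contDiff_deriv he).continuous
  have h1 : ∫ σ in (-1 : ℝ)..s, deriv e σ = e s - e (-1) :=
    intervalIntegral.integral_eq_sub_of_hasDerivAt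
      (fun x _ => (differentiable_of_smooth he x).hasDerivAt) (hc.intervalIntegrable _ _)
  rw [h0, sub_zero] at h1
  rw [← h1]
  refine (intervalIntegral.abs_integral_le_integral_abs hs.1).trans ?_
  exact intervalIntegral.integral_mono_interval le_rfl hs.1 hs.2
    (Filter.Eventually.of_forall fun _ => abs_nonneg _) (hc.abs.intervalIntegrable _ _)

/-- The remainder vanishes at -1 and is recovered from its derivative by integration over a length
of at most 2; each integration costs one factor 2. -/
theorem taylorPoly_sup_bound (r : ℕ) {v : ℝ → ℝ} (hv : ContDiff ℝ ∞ v) {B : ℝ}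
    (hB : ∀ s ∈ Icc (-1 : ℝ) 1, |iteratedDeriv r v s| ≤ B) {i : ℕ} (hi : i ≤ r) {s : ℝ}
    (hs : s ∈ Icc (-1 : ℝ) 1) :
    |iteratedDeriv i (fun s => v s - (taylorPoly (fun m => iteratedDeriv m v (-1)) r).eval s) s| ≤
      2 ^ r * B := by
  induction r generalizing v i s with
  | zero =>
    obtain rfl : i = 0 := by omega
    simpa [taylorPoly] using hB s hs
  | succ r ih =>
    have hB0 : 0 ≤ B := (abs_nonneg _).trans (hB s hs)
    have h1 := deriv_sub_eval hv (taylorPoly (fun m => iteratedDeriv m v (-1)) (r + 1))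
    simp only [derivative_taylorPoly, iteratedDeriv_succ'] at h1
    have h2 := fun i hi s hs => ih (contDiff_deriv hv) (i := i) (s := s)
      (by simpa only [iteratedDeriv_succ'] using hB) hi hs
    rcases i with _ | i
    · rw [iteratedDeriv_zero]
      refine (abs_le_of_deriv_bound (e := fun s => v s - _)
        (differentiable_of_smooth (hv.sub (contDiff_eval _)))
        (by simp [taylorPoly_eval_neg_one]) (B := 2 ^ r * B) ?_ hs).trans_eq (by ring)
      intro s hs
      rw [h1]
      simpa using h2 0 (by omega) s hs
    · rw [iteratedDeriv_succ', h1]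
      refine (h2 i (by omega) s hs).trans ?_
      rw [pow_succ]
      nlinarith [show 0 ≤ 2 ^ r * B by positivity]

/-- The innermost integration is estimated by the L^1 norm of the top derivative, the others as for
the supremum. At least one integration must take place, whence i < r. -/
theorem taylorPoly_integral_bound (r : ℕ) {v : ℝ → ℝ} (hv : ContDiff ℝ ∞ v) {i : ℕ} (hi : i < r)
    {s : ℝ} (hs : s ∈ Icc (-1 : ℝ) 1) :
    |iteratedDeriv i (fun s => v s - (taylorPoly (fun m => iteratedDeriv m v (-1)) r).eval s) s| ≤
      2 ^ r * ∫ σ in (-1 : ℝ)..1, |iteratedDeriv r v σ| := by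
  induction r generalizing v i s with
  | zero => omega
  | succ r ih =>
    have hI0 : 0 ≤ ∫ σ in (-1 : ℝ)..1, |iteratedDeriv (r + 1) v σ| :=
      intervalIntegral.integral_nonneg (by norm_num) fun _ _ => abs_nonneg _
    have h1 := deriv_sub_eval hv (taylorPoly (fun m => iteratedDeriv m v (-1)) (r + 1))
    simp only [derivative_taylorPoly, iteratedDeriv_succ'] at h1
    have h2 := fun i hi s hs => ih (contDiff_deriv hv) (i := i) (s := s) hi hs
    simp only [← iteratedDeriv_succ'] at h2 h1
    rcases i with _ | i
    · rw [iteratedDeriv_zero]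
      rcases r with _ | r
      · have h3 := abs_le_integral_abs_deriv (hv.sub (contDiff_eval (taylorPoly (fun m =>
          iteratedDeriv m v (-1)) 1))) (by simp [taylorPoly]) hs
        rw [h1] at h3
        simp only [taylorPoly, Finset.range_zero, Finset.sum_empty, eval_zero, sub_zero] at h3 ⊢
        simp only [zero_add, iteratedDeriv_one] at hI0 ⊢
        linarith
      · refine (abs_le_of_deriv_bound (e := fun s => v s - _)
          (differentiable_of_smooth (hv.sub (contDiff_eval _)))
          (by simp [taylorPoly_eval_neg_one]) (B := 2 ^ (r + 1) *
            ∫ σ in (-1 : ℝ)..1, |iteratedDeriv (r + 1 + 1) v σ|) ?_ hs).trans_eq (by ring)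
        intro s hs
        rw [h1]
        simpa using h2 0 (by omega) s hs
    · rw [iteratedDeriv_succ', h1]
      refine (h2 i (by omega) s hs).trans ?_
      rw [pow_succ]
      nlinarith [show 0 ≤ 2 ^ r * ∫ σ in (-1 : ℝ)..1, |iteratedDeriv (r + 1) v σ| by positivity]

/-! ### Functionals on smooth functions of one variable -/

/-- A linear functional on smooth functions that is bounded by `C` times the `C^m` norm on `[-1,1]`
and commutes with differentiation with respect to a parameter. -/
structure SmoothFunctional (m : ℕ) (C : ℝ) (F : (ℝ → ℝ) → ℝ) : Prop where
  map_add : ∀ v w : ℝ → ℝ, ContDiff ℝ ∞ v → ContDiff ℝ ∞ w → F (fun s => v s + w s) = F v + F w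
  map_const_mul : ∀ (e : ℝ) (v : ℝ → ℝ), ContDiff ℝ ∞ v → F (fun s => e * v s) = e * F v
  bound : ∀ (v : ℝ → ℝ) (B : ℝ), ContDiff ℝ ∞ v →
    (∀ i ≤ m, ∀ s ∈ Icc (-1 : ℝ) 1, |iteratedDeriv i v s| ≤ B) → |F v| ≤ C * B
  hasDerivAt : ∀ f : ℝ × ℝ → ℝ, ContDiff ℝ ∞ f → ∀ t,
    HasDerivAt (fun t => F fun s => f (s, t)) (F fun s => pdY f (s, t)) t

/-- `F` annihilates the polynomials of degree less than `r`. -/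
def Annihilates (r : ℕ) (F : (ℝ → ℝ) → ℝ) : Prop :=
  ∀ q : ℝ[X], q.degree < r → F (fun s => q.eval s) = 0

namespace SmoothFunctional

variable {m n : ℕ} {C C' : ℝ} {F G : (ℝ → ℝ) → ℝ}

theorem map_zero (hF : SmoothFunctional m C F) : F (fun _ => 0) = 0 := by
  simpa using hF.map_const_mul 0 (fun _ => 0) contDiff_const

theorem const_nonneg (hF : SmoothFunctional m C F) : 0 ≤ C := by
  have := hF.bound (fun _ => 0) 1 contDiff_const fun i _ s _ => by simp
  rw [hF.map_zero] at this
  simpa using this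

theorem mono (hF : SmoothFunctional m C F) (hmn : m ≤ n) (hC : C ≤ C') :
    SmoothFunctional n C' F where
  map_add := hF.map_add
  map_const_mul := hF.map_const_mul
  bound v B hv hB := (hF.bound v B hv fun i hi => hB i (hi.trans hmn)).trans (by
    have : 0 ≤ B := (abs_nonneg _).trans (hB 0 (Nat.zero_le _) 0 (by norm_num))
    gcongr)
  hasDerivAt := hF.hasDerivAt

theorem add (hF : SmoothFunctional m C F) (hG : SmoothFunctional m C' G) :
    SmoothFunctional m (C + C') fun v => F v + G v where
  map_add v w hv hw := by rw [hF.map_add v w hv hw, hG.map_add v w hv hw]; ring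
  map_const_mul e v hv := by rw [hF.map_const_mul e v hv, hG.map_const_mul e v hv]; ring
  bound v B hv hB := by
    rw [add_mul]
    exact (abs_add_le _ _).trans (add_le_add (hF.bound v B hv hB) (hG.bound v B hv hB))
  hasDerivAt f hf t := (hF.hasDerivAt f hf t).add (hG.hasDerivAt f hf t)

theorem const_mul (hF : SmoothFunctional m C F) (e : ℝ) :
    SmoothFunctional m (|e| * C) fun v => e * F v where
  map_add v w hv hw := by rw [hF.map_add v w hv hw]; ring
  map_const_mul e v hv := by rw [hF.map_const_mul e v hv]; ring
  bound v B hv hB := by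
    rw [abs_mul, mul_assoc]
    exact mul_le_mul_of_nonneg_left (hF.bound v B hv hB) (abs_nonneg _)
  hasDerivAt f hf t := (hF.hasDerivAt f hf t).const_mul e

theorem sub (hF : SmoothFunctional m C F) (hG : SmoothFunctional m C' G) :
    SmoothFunctional m (C + C') fun v => F v - G v := by
  have := hF.add (hG.const_mul (-1))
  simpa [sub_eq_add_neg] using this

theorem sum {ι : Type*} (S : Finset ι) {F : ι → (ℝ → ℝ) → ℝ} {C : ι → ℝ}
    (hF : ∀ p ∈ S, SmoothFunctional m (C p) (F p)) :
    SmoothFunctional m (∑ p ∈ S, C p) fun v => ∑ p ∈ S, F p v := by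
  classical
  induction S using Finset.induction_on with
  | empty =>
    simp only [Finset.sum_empty]
    exact ⟨by simp, by simp, by simp, fun f hf t => hasDerivAt_const _ _⟩
  | insert a S ha ih =>
    simp only [Finset.sum_insert ha]
    exact (hF a (by simp)).add (ih fun p hp => hF p (by simp [hp]))

theorem map_sum (hF : SmoothFunctional m C F) {ι : Type*} (S : Finset ι) (v : ι → ℝ → ℝ)
    (hv : ∀ p ∈ S, ContDiff ℝ ∞ (v p)) : F (fun s => ∑ p ∈ S, v p s) = ∑ p ∈ S, F (v p) := by
  classical
  induction S using Finset.induction_on with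
  | empty => simpa using hF.map_zero
  | insert a S ha ih =>
    simp only [Finset.sum_insert ha]
    rw [hF.map_add _ _ (hv a (by simp)) (ContDiff.sum fun p hp => hv p (by simp [hp])),
      ih fun p hp => hv p (by simp [hp])]

/-- Bramble–Hilbert argument: the functional does not see the Taylor polynomial, and the remainder
is small in C^m because m ≤ r. -/
theorem abs_le_sup (hF : SmoothFunctional m C F) {r : ℕ} (hr : Annihilates r F) (hm : m ≤ r)
    {v : ℝ → ℝ} (hv : ContDiff ℝ ∞ v) {B : ℝ}
    (hB : ∀ s ∈ Icc (-1 : ℝ) 1, |iteratedDeriv r v s| ≤ B) : |F v| ≤ C * (2 ^ r * B) := by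
  set T := taylorPoly (fun m => iteratedDeriv m v (-1)) r with hT
  have h1 := hF.map_add (fun s => v s - T.eval s) (fun s => T.eval s)
    (hv.sub (contDiff_eval T)) (contDiff_eval T)
  simp only [sub_add_cancel] at h1
  rw [h1, hr T (degree_taylorPoly_lt _ _), add_zero]
  exact hF.bound _ _ (hv.sub (contDiff_eval T)) fun i hi s hs =>
    taylorPoly_sup_bound r hv hB (hi.trans hm) hs

theorem abs_le_integral (hF : SmoothFunctional m C F) {r : ℕ} (hr : Annihilates r F) (hm : m < r)
    {v : ℝ → ℝ} (hv : ContDiff ℝ ∞ v) :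
    |F v| ≤ C * (2 ^ r * ∫ σ in (-1 : ℝ)..1, |iteratedDeriv r v σ|) := by
  set T := taylorPoly (fun m => iteratedDeriv m v (-1)) r with hT
  have h1 := hF.map_add (fun s => v s - T.eval s) (fun s => T.eval s)
    (hv.sub (contDiff_eval T)) (contDiff_eval T)
  simp only [sub_add_cancel] at h1
  rw [h1, hr T (degree_taylorPoly_lt _ _), add_zero]
  exact hF.bound _ _ (hv.sub (contDiff_eval T)) fun i hi s hs =>
    taylorPoly_integral_bound r hv (hi.trans_lt hm) hs

theorem iteratedDeriv_param (hF : SmoothFunctional m C F) {f : ℝ × ℝ → ℝ} (hf : ContDiff ℝ ∞ f)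
    (j : ℕ) : iteratedDeriv j (fun t => F fun s => f (s, t)) =
      fun t => F fun s => classicalDeriv 0 j f (s, t) := by
  induction j with
  | zero => simp [classicalDeriv_eq]
  | succ j ih =>
    rw [iteratedDeriv_succ, ih]
    ext t
    rw [(hF.hasDerivAt _ (contDiff_classicalDeriv hf 0 j) t).deriv, pdY_classicalDeriv hf]

theorem contDiff_param (hF : SmoothFunctional m C F) {f : ℝ × ℝ → ℝ} (hf : ContDiff ℝ ∞ f) :
    ContDiff ℝ ∞ fun t => F fun s => f (s, t) := by
  refine contDiff_of_differentiable_iteratedDeriv fun j _ => ?_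
  rw [hF.iteratedDeriv_param hf]
  exact fun t => (hF.hasDerivAt _ (contDiff_classicalDeriv hf 0 j) t).differentiableAt

/-- The inner functional is a smooth function of t, and j derivatives in t pass through it. The
bound of `G` by j derivatives and that of `F` by i derivatives thus combine into a single mixed
derivative. -/
theorem tensor_abs_le_sup (hF : SmoothFunctional m C F) (hG : SmoothFunctional n C' G) {i j : ℕ}
    (hFi : Annihilates i F) (hGj : Annihilates j G) (hmi : m ≤ i) (hnj : n ≤ j)
    {f : ℝ × ℝ → ℝ} (hf : ContDiff ℝ ∞ f) {B : ℝ}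
    (hB : ∀ s ∈ Icc (-1 : ℝ) 1, ∀ t ∈ Icc (-1 : ℝ) 1, |classicalDeriv i j f (s, t)| ≤ B) :
    |G fun t => F fun s => f (s, t)| ≤ C' * (2 ^ j * (C * (2 ^ i * B))) := by
  refine hG.abs_le_sup hGj hnj (hF.contDiff_param hf) fun t ht => ?_
  rw [hF.iteratedDeriv_param hf]
  refine hF.abs_le_sup hFi hmi (contDiff_slice_fst (contDiff_classicalDeriv hf 0 j) t)
    fun s hs => ?_
  rw [iteratedDeriv_slice_fst, classicalDeriv_fst_classicalDeriv_snd]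
  exact hB s hs t ht

theorem tensor_abs_le_integral (hF : SmoothFunctional m C F) (hG : SmoothFunctional n C' G)
    {i j : ℕ} (hFi : Annihilates i F) (hGj : Annihilates j G) (hmi : m < i) (hnj : n < j)
    {f : ℝ × ℝ → ℝ} (hf : ContDiff ℝ ∞ f) :
    |G fun t => F fun s => f (s, t)| ≤ C' * (2 ^ j * (C * (2 ^ i *
      ∫ t in (-1 : ℝ)..1, ∫ s in (-1 : ℝ)..1, |classicalDeriv i j f (s, t)|))) := by
  refine (hG.abs_le_integral hGj hnj (hF.contDiff_param hf)).trans ?_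
  have hC' := hG.const_nonneg
  rw [hF.iteratedDeriv_param hf]
  have h1 : ∀ t, |F fun s => classicalDeriv 0 j f (s, t)| ≤
      C * 2 ^ i * ∫ s in (-1 : ℝ)..1, |classicalDeriv i j f (s, t)| := fun t => by
    refine (hF.abs_le_integral hFi hmi
      (contDiff_slice_fst (contDiff_classicalDeriv hf 0 j) t)).trans_eq ?_
    simp only [iteratedDeriv_slice_fst, classicalDeriv_fst_classicalDeriv_snd]
    ring
  have hc := (contDiff_classicalDeriv hf i j).continuous
  have hc2 : Continuous fun t => ∫ s in (-1 : ℝ)..1, |classicalDeriv i j f (s, t)| :=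
    intervalIntegral.continuous_parametric_intervalIntegral_of_continuous'
      (f := fun t s => |classicalDeriv i j f (s, t)|) (by fun_prop) _ _
  have h2 : ∫ t in (-1 : ℝ)..1, |F fun s => classicalDeriv 0 j f (s, t)| ≤
      C * 2 ^ i * ∫ t in (-1 : ℝ)..1, ∫ s in (-1 : ℝ)..1, |classicalDeriv i j f (s, t)| := by
    rw [← intervalIntegral.integral_const_mul]
    refine intervalIntegral.integral_mono_on (by norm_num) ?_ ?_ fun t _ => h1 t
    · exact (hF.contDiff_param (contDiff_classicalDeriv hf 0 j)).continuous.abs.intervalIntegrable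
        _ _
    · exact (hc2.const_mul _).intervalIntegrable _ _
  rw [← mul_assoc C]
  gcongr

end SmoothFunctional

/-! ### The Jacobi coefficients as functionals -/

theorem endpointFunctional_bound (c : Fin 4 → ℝ) (W : ℝ[X]) :
    ∃ C : ℝ, 0 ≤ C ∧ ∀ (v v' : ℝ → ℝ) (B : ℝ), (∀ s ∈ Icc (-1 : ℝ) 1, |v s| ≤ B) →
      (∀ s ∈ Icc (-1 : ℝ) 1, |v' s| ≤ B) → |endpointFunctional c W v v'| ≤ C * B := by
  obtain ⟨M, hM⟩ := isCompact_Icc.exists_bound_of_continuousOn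
    (s := Icc (-1 : ℝ) 1) W.continuous.continuousOn
  have hM0 : 0 ≤ M := (norm_nonneg _).trans (hM 0 (by norm_num))
  refine ⟨|c 0| + |c 1| + |c 2| + |c 3| + 2 * M, by positivity, fun v v' B hv hv' => ?_⟩
  have hB0 : 0 ≤ B := (abs_nonneg _).trans (hv 0 (by norm_num))
  have h1 : |∫ s in (-1 : ℝ)..1, v s * W.eval s| ≤ B * M * |1 - (-1 : ℝ)| := by
    rw [← Real.norm_eq_abs]
    refine intervalIntegral.norm_integral_le_of_norm_le_const fun s hs => ?_
    rw [uIoc_of_le (by norm_num)] at hs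
    rw [norm_mul]
    exact mul_le_mul (hv s (Ioc_subset_Icc_self hs)) (hM s (Ioc_subset_Icc_self hs))
      (norm_nonneg _) hB0
  norm_num at h1
  rw [endpointFunctional]
  have h2 : ∀ i x, |x| ≤ B → |c i * x| ≤ |c i| * B := fun i x hx => by
    rw [abs_mul]; gcongr
  calc _ ≤ |c 0 * v (-1)| + |c 1 * v 1| + |c 2 * v' (-1)| + |c 3 * v' 1| +
        |∫ s in (-1 : ℝ)..1, v s * W.eval s| :=
      (abs_add_le _ _).trans (by gcongr; exact (abs_add_le _ _).trans (by
        gcongr; exact (abs_add_le _ _).trans (by gcongr; exact abs_add_le _ _)))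
    _ ≤ |c 0| * B + |c 1| * B + |c 2| * B + |c 3| * B + B * M * 2 := by
      gcongr
      · exact h2 _ _ (hv _ (by norm_num))
      · exact h2 _ _ (hv _ (by norm_num))
      · exact h2 _ _ (hv' _ (by norm_num))
      · exact h2 _ _ (hv' _ (by norm_num))
    _ = _ := by ring

theorem derivWithin_ref_of_smooth {v : ℝ → ℝ} (hv : Differentiable ℝ v) {s : ℝ}
    (hs : s ∈ Icc (-1 : ℝ) 1) : derivWithin v (Icc (-1) 1) s = deriv v s :=
  (hv s).derivWithin (uniqueDiffWithinAt_ref hs)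

theorem exists_jacobiCoeff_eq_of_smooth (p : ℕ) :
    ∃ (c : Fin 4 → ℝ) (W : ℝ[X]), ∀ v : ℝ → ℝ, ContDiff ℝ ∞ v →
      jacobiCoeff p v = endpointFunctional c W v (deriv v) := by
  obtain ⟨c, W, h⟩ := exists_jacobiCoeff_eq p
  refine ⟨c, W, fun v hv => ?_⟩
  rw [h v hv.continuous.continuousOn, endpointFunctional, endpointFunctional,
    derivWithin_ref_of_smooth (differentiable_of_smooth hv) (by norm_num),
    derivWithin_ref_of_smooth (differentiable_of_smooth hv) (by norm_num)]

theorem smoothFunctional_jacobiCoeff (p : ℕ) : ∃ C, SmoothFunctional 1 C (jacobiCoeff p) := by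
  obtain ⟨c, W, h⟩ := exists_jacobiCoeff_eq_of_smooth p
  obtain ⟨C, _, hC⟩ := endpointFunctional_bound c W
  have hi : ∀ v : ℝ → ℝ, ContDiff ℝ ∞ v →
      IntervalIntegrable (fun s => v s * W.eval s) volume (-1) 1 := fun v hv =>
    (hv.continuous.mul W.continuous).intervalIntegrable _ _
  refine ⟨C, ?_, ?_, ?_, ?_⟩
  · intro v w hv hw
    have hd : deriv (fun s => v s + w s) = fun s => deriv v s + deriv w s := by
      ext s
      exact deriv_fun_add (differentiable_of_smooth hv s) (differentiable_of_smooth hw s)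
    rw [h v hv, h w hw, h _ (hv.add hw), hd]
    simp only [endpointFunctional, add_mul]
    rw [intervalIntegral.integral_add (hi v hv) (hi w hw)]
    ring
  · intro e v hv
    have hd : deriv (fun s => e * v s) = fun s => e * deriv v s := by
      ext s
      exact deriv_const_mul e (differentiable_of_smooth hv s)
    rw [h v hv, h _ (contDiff_const.mul hv), hd]
    simp only [endpointFunctional, mul_assoc]
    rw [intervalIntegral.integral_const_mul]
    ring
  · intro v B hv hB
    rw [h v hv]
    refine hC _ _ _ (fun s hs => ?_) (fun s hs => ?_)
    · simpa using hB 0 (by norm_num) s hs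
    · simpa using hB 1 le_rfl s hs
  · intro f hf t
    have e : ∀ g : ℝ × ℝ → ℝ, ContDiff ℝ ∞ g → ∀ t, jacobiCoeff p (fun s => g (s, t)) =
        c 0 * g (-1, t) + c 1 * g (1, t) + c 2 * pdX g (-1, t) + c 3 * pdX g (1, t) +
          ∫ s in (-1 : ℝ)..1, g (s, t) * W.eval s := fun g hg t => by
      rw [h _ (contDiff_slice_fst hg t)]
      rfl
    -- Symmetry of the second derivatives turns the slope of ∂_t f into the t-derivative of the
    -- slope of f.
    rw [e _ (contDiff_pdY hf), funext (e f hf), pdX_pdY_comm hf]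
    have hy : ∀ g : ℝ × ℝ → ℝ, ContDiff ℝ ∞ g → ∀ s t,
        HasDerivAt (fun t => g (s, t)) (pdY g (s, t)) t := fun g hg s t =>
      hasDerivAt_pdY (differentiable_of_smooth hg) s t
    have hX := contDiff_pdX hf
    refine (((((hy f hf _ t).const_mul _).add ((hy f hf _ t).const_mul _)).add
      ((hy _ hX _ t).const_mul _)).add ((hy _ hX _ t).const_mul _)).add ?_
    -- Any strip with `t` in its interior would do; there the derivative within the strip is the
    -- ordinary one.
    have hst := hasDerivWithinAt_integral_strip (p := -1) (q := 1) (c := t - 1) (d := t + 1)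
      (by norm_num) (by linarith) (w := fun P => f P * W.eval P.1)
      (w' := fun P => pdY f P * W.eval P.1)
      (hf.continuous.mul (W.continuous.comp continuous_fst)).continuousOn
      ((contDiff_pdY hf).continuous.mul (W.continuous.comp continuous_fst)).continuousOn
      (fun s _ t _ => ((hy f hf s t).mul_const (W.eval s)).hasDerivWithinAt) (t := t)
      ⟨by linarith, by linarith⟩
    exact hst.hasDerivAt (Icc_mem_nhds (by linarith) (by linarith))

theorem smoothFunctional_iteratedDeriv {a m : ℕ} (ham : a ≤ m) {s : ℝ}
    (hs : s ∈ Icc (-1 : ℝ) 1) : SmoothFunctional m 1 fun v => iteratedDeriv a v s where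
  map_add v w hv hw := iteratedDeriv_fun_add (hv.contDiffAt.of_le (by exact_mod_cast le_top))
    (hw.contDiffAt.of_le (by exact_mod_cast le_top))
  map_const_mul e v hv := iteratedDeriv_const_mul_field e v
  bound v B hv hB := by rw [one_mul]; exact hB a ham s hs
  hasDerivAt f hf t := by
    simp only [iteratedDeriv_slice_fst]
    have := hasDerivAt_pdY (differentiable_of_smooth (contDiff_classicalDeriv hf a 0)) s t
    rw [pdY_classicalDeriv hf] at this
    exact this

/-- The value at `s` of the `a`-th derivative of the one-dimensional projection. -/
noncomputable def projFunctional (k a : ℕ) (s : ℝ) (v : ℝ → ℝ) : ℝ :=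
  ∑ p ∈ Finset.range (k + 1), (derivative^[a] (jacobiNeg p)).eval s * jacobiCoeff p v

/-- The value at `s` of the `a`-th derivative of the one-dimensional projection error. -/
noncomputable def errFunctional (k a : ℕ) (s : ℝ) (v : ℝ → ℝ) : ℝ :=
  iteratedDeriv a v s - projFunctional k a s v

theorem smoothFunctional_proj (k : ℕ) :
    ∃ C, 0 ≤ C ∧ ∀ a ≤ 2, ∀ s ∈ Icc (-1 : ℝ) 1, SmoothFunctional 1 C (projFunctional k a s) := by
  choose C hC using smoothFunctional_jacobiCoeff
  have hM : ∀ p a : ℕ, ∃ M : ℝ, ∀ s ∈ Icc (-1 : ℝ) 1,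
      ‖(derivative^[a] (jacobiNeg p)).eval s‖ ≤ M := fun p a =>
    isCompact_Icc.exists_bound_of_continuousOn (derivative^[a] (jacobiNeg p)).continuous.continuousOn
  choose M hM using hM
  have hM0 : ∀ p a, 0 ≤ M p a := fun p a => (norm_nonneg _).trans (hM p a 0 (by norm_num))
  have hC0 := fun p => (hC p).const_nonneg
  refine ⟨∑ p ∈ Finset.range (k + 1), (M p 0 + M p 1 + M p 2) * C p,
    Finset.sum_nonneg fun p _ => mul_nonneg (add_nonneg (add_nonneg (hM0 _ _) (hM0 _ _))
      (hM0 _ _)) (hC0 p), fun a ha s hs => ?_⟩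
  refine SmoothFunctional.sum _ fun p _ => ((hC p).const_mul _).mono le_rfl ?_
  refine mul_le_mul_of_nonneg_right ?_ (hC0 p)
  have h1 := hM p a s hs
  rw [Real.norm_eq_abs] at h1
  have := hM0 p
  have h3 := this 0
  have h4 := this 1
  have h5 := this 2
  interval_cases a <;> linarith

/-- Evaluation of the a-th derivative is bounded in C^a, while the coefficients contain first
derivatives; hence `max a 1`. -/
theorem smoothFunctional_err (k : ℕ) :
    ∃ C, 0 ≤ C ∧ ∀ a ≤ 2, ∀ s ∈ Icc (-1 : ℝ) 1,
      SmoothFunctional (max a 1) C (errFunctional k a s) := by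
  obtain ⟨C, hC0, hC⟩ := smoothFunctional_proj k
  refine ⟨1 + C, by positivity, fun a ha s hs => ?_⟩
  exact (smoothFunctional_iteratedDeriv (le_max_left a 1) hs).sub
    ((hC a ha s hs).mono (le_max_right _ _) le_rfl)

theorem jacobiCoeff_sum (n : ℕ) (c : ℕ → ℝ) (p : ℕ) (hp : p < n) :
    jacobiCoeff p (fun s => (∑ q ∈ Finset.range n, C (c q) * jacobiNeg q).eval s) = c p := by
  obtain ⟨K, hK⟩ := smoothFunctional_jacobiCoeff p
  simp only [eval_finsetSum, eval_mul, eval_C]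
  rw [hK.map_sum _ (fun q s => c q * (jacobiNeg q).eval s)
    fun q _ => contDiff_const.mul (contDiff_eval _)]
  simp only [hK.map_const_mul _ _ (contDiff_eval _), jacobiCoeff_jacobiNeg]
  simp [hp]

theorem iteratedDeriv_eval (q : ℝ[X]) (a : ℕ) (s : ℝ) :
    iteratedDeriv a (fun s => q.eval s) s = (derivative^[a] q).eval s := by
  induction a generalizing s with
  | zero => simp
  | succ a ih =>
    rw [iteratedDeriv_succ, funext ih, Function.iterate_succ_apply', Polynomial.deriv]

/-- Biorthogonality reproduces all terms but the last one. Superconvergence occurs where this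
surviving term vanishes. -/
theorem errFunctional_sum (k a : ℕ) (s : ℝ) (c : ℕ → ℝ) :
    errFunctional k a s (fun s => (∑ q ∈ Finset.range (k + 2), C (c q) * jacobiNeg q).eval s) =
      c (k + 1) * (derivative^[a] (jacobiNeg (k + 1))).eval s := by
  have h1 : projFunctional k a s (fun s =>
      (∑ q ∈ Finset.range (k + 2), C (c q) * jacobiNeg q).eval s) =
      ∑ p ∈ Finset.range (k + 1), (derivative^[a] (jacobiNeg p)).eval s * c p :=
    Finset.sum_congr rfl fun p hp => by
      rw [jacobiCoeff_sum (k + 2) c p (by have := Finset.mem_range.mp hp; omega)]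
  rw [errFunctional, h1, iteratedDeriv_eval, iterate_derivative_sum, eval_finsetSum,
    Finset.sum_range_succ (n := k + 1)]
  simp only [iterate_derivative_C_mul, eval_mul, eval_C, mul_comm (c _)]
  ring

theorem errFunctional_annihilates {k : ℕ} (hk : 3 ≤ k) {r : ℕ} (hr : r ≤ k + 1) (a : ℕ) (s : ℝ) :
    Annihilates r (errFunctional k a s) := by
  intro q hq
  obtain ⟨n, rfl⟩ : ∃ n, k = n + 3 := ⟨k - 3, by omega⟩
  obtain ⟨c, rfl⟩ := jacobiNeg_span n q (hq.trans_le (by exact_mod_cast hr))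
  have := errFunctional_sum (n + 3) a s fun p => if p < n + 4 then c p else 0
  rw [Finset.sum_range_succ] at this
  simp only [lt_irrefl, if_false, C_0, zero_mul, add_zero] at this
  rw [← this]
  congr 1
  ext s
  congr 1
  exact Finset.sum_congr rfl fun p hp => by rw [if_pos (Finset.mem_range.mp hp)]

theorem errFunctional_annihilates_of_eval_eq_zero {k : ℕ} (hk : 3 ≤ k) {r : ℕ} (hr : r ≤ k + 2)
    {a : ℕ} {s : ℝ} (h : r = k + 2 → (derivative^[a] (jacobiNeg (k + 1))).eval s = 0) :
    Annihilates r (errFunctional k a s) := by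
  rcases hr.lt_or_eq with hr | hr
  · exact errFunctional_annihilates hk (by omega) a s
  intro q hq
  obtain ⟨n, rfl⟩ : ∃ n, k = n + 3 := ⟨k - 3, by omega⟩
  obtain ⟨c, rfl⟩ := jacobiNeg_span (n + 1) q (hq.trans_le (by exact_mod_cast hr.le))
  have := errFunctional_sum (n + 3) a s c
  rw [h hr, mul_zero] at this
  exact this

/-- Constants are reproduced, and their derivatives vanish. This lets a derivative of the projection
replace an error functional when the order 1 is enough. -/
theorem projFunctional_annihilates {k : ℕ} (hk : 3 ≤ k) {a : ℕ} (ha : 1 ≤ a) (s : ℝ) :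
    Annihilates 1 (projFunctional k a s) := by
  intro q hq
  have h1 := errFunctional_annihilates hk (r := 1) (by omega) a s q hq
  rw [errFunctional, iteratedDeriv_eval, iterate_derivative_eq_zero_of_degree_lt
    (hq.trans_le (by exact_mod_cast ha)), eval_zero, zero_sub, neg_eq_zero] at h1
  exact h1

theorem iteratedDeriv_annihilates (a : ℕ) (s : ℝ) :
    Annihilates a fun v => iteratedDeriv a v s := by
  intro q hq
  simp only [iteratedDeriv_eval, iterate_derivative_eq_zero_of_degree_lt hq, eval_zero]

/-! ### The two-dimensional projection on the reference square -/

/-- The derivative `∂_s^a ∂_t^b` at `(s,t)` of the error of the tensor product projection. -/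
noncomputable def refErr (k a b : ℕ) (f : ℝ × ℝ → ℝ) (s t : ℝ) : ℝ :=
  classicalDeriv a b f (s, t) - ∑ p ∈ Finset.range (k + 1), ∑ q ∈ Finset.range (k + 1),
    jacobiCoeff q (fun t => jacobiCoeff p fun s => f (s, t)) *
      (derivative^[a] (jacobiNeg p)).eval s * (derivative^[b] (jacobiNeg q)).eval t

theorem projFunctional_projFunctional (k a b : ℕ) {f : ℝ × ℝ → ℝ} (hf : ContDiff ℝ ∞ f) (s t : ℝ) :
    projFunctional k b t (fun t => projFunctional k a s fun s => f (s, t)) =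
      ∑ p ∈ Finset.range (k + 1), ∑ q ∈ Finset.range (k + 1),
        jacobiCoeff q (fun t => jacobiCoeff p fun s => f (s, t)) *
          (derivative^[a] (jacobiNeg p)).eval s * (derivative^[b] (jacobiNeg q)).eval t := by
  choose C hC using smoothFunctional_jacobiCoeff
  rw [projFunctional, Finset.sum_comm]
  refine Finset.sum_congr rfl fun q _ => ?_
  simp only [projFunctional]
  rw [(hC q).map_sum _ (fun p t => (derivative^[a] (jacobiNeg p)).eval s *
    jacobiCoeff p fun s => f (s, t))
    fun p _ => contDiff_const.mul ((hC p).contDiff_param hf), Finset.mul_sum]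
  refine Finset.sum_congr rfl fun p _ => ?_
  rw [(hC q).map_const_mul _ _ ((hC p).contDiff_param hf)]
  ring

theorem classicalDeriv_snd_classicalDeriv_fst {f : ℝ × ℝ → ℝ} (hf : ContDiff ℝ ∞ f) (a b : ℕ) :
    classicalDeriv 0 b (classicalDeriv a 0 f) = classicalDeriv a b f := by
  induction b with
  | zero => rfl
  | succ b ih =>
    rw [← pdY_classicalDeriv hf, ← ih, classicalDeriv_eq 0, classicalDeriv_eq 0,
      Function.iterate_succ_apply']
    rfl

theorem refErr_eq (k a b : ℕ) {f : ℝ × ℝ → ℝ} (hf : ContDiff ℝ ∞ f) (s t : ℝ) :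
    refErr k a b f s t = iteratedDeriv b (fun t => iteratedDeriv a (fun s => f (s, t)) s) t -
      projFunctional k b t (fun t => projFunctional k a s fun s => f (s, t)) := by
  rw [refErr, projFunctional_projFunctional k a b hf]
  congr 1
  simp only [iteratedDeriv_slice_fst]
  rw [iteratedDeriv_slice_snd, classicalDeriv_snd_classicalDeriv_fst hf]

/-! ### Error bounds on the reference square for smooth functions -/

theorem SmoothFunctional.map_sub {m : ℕ} {C : ℝ} {F : (ℝ → ℝ) → ℝ} (hF : SmoothFunctional m C F)
    {v w : ℝ → ℝ} (hv : ContDiff ℝ ∞ v) (hw : ContDiff ℝ ∞ w) :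
    F (fun s => v s - w s) = F v - F w := by
  have h1 := hF.map_add v (fun s => -1 * w s) hv (contDiff_const.mul hw)
  rw [hF.map_const_mul (-1) w hw] at h1
  simpa [sub_eq_add_neg] using h1

/-- A common bound for all the functionals that occur in the error analysis. -/
theorem exists_functional_const (k : ℕ) :
    ∃ M : ℝ, 0 ≤ M ∧ ∀ a ≤ 2, ∀ s ∈ Icc (-1 : ℝ) 1,
      SmoothFunctional a M (fun v => iteratedDeriv a v s) ∧
      SmoothFunctional 1 M (projFunctional k a s) ∧
      SmoothFunctional (max a 1) M (errFunctional k a s) := by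
  obtain ⟨C, hC0, hC⟩ := smoothFunctional_proj k
  obtain ⟨C', hC0', hC'⟩ := smoothFunctional_err k
  refine ⟨1 + C + C', by positivity, fun a ha s hs => ⟨?_, ?_, ?_⟩⟩
  · exact (smoothFunctional_iteratedDeriv le_rfl hs).mono le_rfl (by linarith)
  · exact (hC a ha s hs).mono le_rfl (by linarith)
  · exact (hC' a ha s hs).mono le_rfl (by linarith)

/-! ### Tensor decompositions of the error on the reference square -/

section decomposition

variable {f : ℝ × ℝ → ℝ} (hf : ContDiff ℝ ∞ f) {k a b : ℕ} (ha : a ≤ 2) (hb : b ≤ 2) {s t : ℝ}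
  (hs : s ∈ Icc (-1 : ℝ) 1) (ht : t ∈ Icc (-1 : ℝ) 1)
include hf ha hb hs ht

/-- This is E⊗D + P⊗E, and the next lemma gives D⊗E + E⊗P. They serve the derivatives of second
order; the symmetric splitting with E⊗E serves the lower orders. -/
theorem refErr_eq_deriv_err_add_err_proj :
    refErr k a b f s t = iteratedDeriv b (fun t => errFunctional k a s fun s => f (s, t)) t +
      errFunctional k b t fun t => projFunctional k a s fun s => f (s, t) := by
  obtain ⟨M, _, hM⟩ := exists_functional_const k
  have h1 := (hM b hb t ht).1.map_sub ((hM a ha s hs).1.contDiff_param hf)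
    ((hM a ha s hs).2.1.contDiff_param hf)
  rw [refErr_eq k a b hf]
  simp only [errFunctional] at h1 ⊢
  rw [h1]
  ring

theorem refErr_eq_err_deriv_add_proj_err :
    refErr k a b f s t = (errFunctional k b t fun t => iteratedDeriv a (fun s => f (s, t)) s) +
      projFunctional k b t fun t => errFunctional k a s fun s => f (s, t) := by
  obtain ⟨M, _, hM⟩ := exists_functional_const k
  have h1 := (hM b hb t ht).2.1.map_sub ((hM a ha s hs).1.contDiff_param hf)
    ((hM a ha s hs).2.1.contDiff_param hf)
  rw [refErr_eq k a b hf]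
  simp only [errFunctional] at h1 ⊢
  rw [h1]
  ring

theorem refErr_eq_sub_err_err :
    refErr k a b f s t = iteratedDeriv b (fun t => errFunctional k a s fun s => f (s, t)) t +
      (errFunctional k b t fun t => iteratedDeriv a (fun s => f (s, t)) s) -
      errFunctional k b t fun t => errFunctional k a s fun s => f (s, t) := by
  rw [refErr_eq_err_deriv_add_proj_err hf ha hb hs ht]
  simp only [errFunctional]
  ring

end decomposition

/-- The total order r is distributed over the two factors of every product so that each factor
annihilates up to its share and is bounded in a C^m with m at most that share. For r = k + 2, an
error functional receives the full share k + 2 only if it is paired with an undifferentiated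
evaluation, and just then a zero of a derivative of `jacobiNeg (k + 1)` is required; for a = b = 1
no share exceeds k + 1. -/
theorem refErr_sup_bound {k : ℕ} (hk : 3 ≤ k) :
    ∃ K : ℝ, 0 ≤ K ∧ ∀ (f : ℝ × ℝ → ℝ), ContDiff ℝ ∞ f → ∀ (r : ℕ) (B : ℝ), 2 ≤ r → r ≤ k + 2 →
      (∀ i j : ℕ, i + j = r → ∀ s ∈ Icc (-1 : ℝ) 1, ∀ t ∈ Icc (-1 : ℝ) 1,
        |classicalDeriv i j f (s, t)| ≤ B) →
      ∀ a b : ℕ, a + b ≤ 2 → ∀ s ∈ Icc (-1 : ℝ) 1, ∀ t ∈ Icc (-1 : ℝ) 1,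
        (r = k + 2 → b = 0 → (derivative^[a] (jacobiNeg (k + 1))).eval s = 0) →
        (r = k + 2 → a = 0 → (derivative^[b] (jacobiNeg (k + 1))).eval t = 0) →
        |refErr k a b f s t| ≤ K * B := by
  obtain ⟨M, hM0, hM⟩ := exists_functional_const k
  -- At most three products, each with two functional constants and 2^i 2^j = 2^r from the Taylor
  -- remainders.
  refine ⟨3 * (M * M * 2 ^ (k + 2)), by positivity, ?_⟩
  intro f hf r B hr2 hrk hB a b hab s hs t ht hcs hct
  have hB0 : 0 ≤ B := (abs_nonneg _).trans (hB r 0 (by omega) 0 (by norm_num) 0 (by norm_num))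
  obtain ⟨hF0, hF1, hFE⟩ := hM a (by omega) s hs
  obtain ⟨hG0, hG1, hGE⟩ := hM b (by omega) t ht
  set T := M * M * 2 ^ (k + 2) * B with hT
  have hT0 : 0 ≤ T := by positivity
  have key : ∀ {m n : ℕ} {F G : (ℝ → ℝ) → ℝ}, SmoothFunctional m M F → SmoothFunctional n M G →
      ∀ i j : ℕ, i + j = r → Annihilates i F → Annihilates j G → m ≤ i → n ≤ j →
      |G fun t => F fun s => f (s, t)| ≤ T := by
    intro m n F G hF hG i j hij hFi hGj hmi hnj
    refine (hF.tensor_abs_le_sup hG hFi hGj hmi hnj hf (hB i j hij)).trans ?_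
    calc M * (2 ^ j * (M * (2 ^ i * B))) = M * M * 2 ^ (i + j) * B := by rw [pow_add]; ring
      _ ≤ T := by
        rw [hij, hT]
        gcongr
        norm_num
  have aFE : b ≤ 1 → Annihilates (r - b) (errFunctional k a s) := fun _ =>
    errFunctional_annihilates_of_eval_eq_zero hk (by omega) fun h => hcs (by omega) (by omega)
  have aGE : a ≤ 1 → Annihilates (r - a) (errFunctional k b t) := fun _ =>
    errFunctional_annihilates_of_eval_eq_zero hk (by omega) fun h => hct (by omega) (by omega)
  have aFE1 : Annihilates (r - 1) (errFunctional k a s) :=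
    errFunctional_annihilates hk (by omega) a s
  have aGE1 : Annihilates (r - 1) (errFunctional k b t) :=
    errFunctional_annihilates hk (by omega) b t
  -- For a + b ≤ 1 both error functionals are bounded in C^1, so E⊗E may take the orders 1 and r -
  -- 1. If a = 2 and r = 2, the factor E in x would use up the whole order; in P⊗E the first factor
  -- is bounded in C^1 and annihilates constants, so that the orders 1 and r - 1 suffice again.
  by_cases h1 : a + b ≤ 1
  · rw [refErr_eq_sub_err_err hf (by omega) (by omega) hs ht]
    have e1 := key hFE hG0 (r - b) b (by omega) (aFE (by omega)) (iteratedDeriv_annihilates b t)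
      (by omega) le_rfl
    have e2 := key hF0 hGE a (r - a) (by omega) (iteratedDeriv_annihilates a s) (aGE (by omega))
      le_rfl (by omega)
    have e3 := key hFE hGE 1 (r - 1) (by omega) (errFunctional_annihilates hk (by omega) a s) aGE1
      (by omega) (by omega)
    refine (abs_sub _ _).trans ((add_le_add (abs_add_le _ _) le_rfl).trans ?_)
    rw [hT] at e1 e2 e3
    linarith
  by_cases h2 : 1 ≤ a
  · rw [refErr_eq_deriv_err_add_err_proj hf (by omega) (by omega) hs ht]
    have e1 := key hFE hG0 (r - b) b (by omega) (aFE (by omega)) (iteratedDeriv_annihilates b t)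
      (by omega) le_rfl
    have e2 := key hF1 hGE 1 (r - 1) (by omega) (projFunctional_annihilates hk h2 s) aGE1
      (by omega) (by omega)
    refine (abs_add_le _ _).trans ?_
    linarith
  · rw [refErr_eq_err_deriv_add_proj_err hf (by omega) (by omega) hs ht]
    have e1 := key hF0 hGE a (r - a) (by omega) (iteratedDeriv_annihilates a s) (aGE (by omega))
      le_rfl (by omega)
    have e2 := key hFE hG1 (r - 1) 1 (by omega) aFE1
      (projFunctional_annihilates hk (by omega) t) (by omega) (by omega)
    refine (abs_add_le _ _).trans ?_
    linarith

/-- Cauchy–Schwarz on an interval of length 2, obtained from the nonnegative integral of the squared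
deviation of |g| from its mean `I / 2`. -/
theorem sq_integral_abs_le {g : ℝ → ℝ} (hg : Continuous g) :
    (∫ σ in (-1 : ℝ)..1, |g σ|) ^ 2 ≤ 2 * ∫ σ in (-1 : ℝ)..1, g σ ^ 2 := by
  set I := ∫ σ in (-1 : ℝ)..1, |g σ| with hI
  have h1 : 0 ≤ ∫ σ in (-1 : ℝ)..1, (|g σ| - I / 2) ^ 2 :=
    intervalIntegral.integral_nonneg (by norm_num) fun _ _ => sq_nonneg _
  have h2 : ∫ σ in (-1 : ℝ)..1, (|g σ| - I / 2) ^ 2 =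
      (∫ σ in (-1 : ℝ)..1, g σ ^ 2) - I * I + (I / 2) ^ 2 * 2 := by
    have : (fun σ => (|g σ| - I / 2) ^ 2) = fun σ => g σ ^ 2 - I * |g σ| + (I / 2) ^ 2 := by
      ext σ
      rw [sub_sq, sq_abs]
      ring
    rw [this, intervalIntegral.integral_add, intervalIntegral.integral_sub,
      intervalIntegral.integral_const_mul, intervalIntegral.integral_const]
    · norm_num
      ring
    all_goals exact Continuous.intervalIntegrable (by fun_prop) _ _
  nlinarith

theorem continuous_integral_fst {g : ℝ × ℝ → ℝ} (hg : Continuous g) (p q : ℝ) :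
    Continuous fun t => ∫ s in p..q, g (s, t) :=
  intervalIntegral.continuous_parametric_intervalIntegral_of_continuous'
    (f := fun t s => g (s, t)) (by fun_prop) _ _

theorem continuous_integral_snd {g : ℝ × ℝ → ℝ} (hg : Continuous g) (p q : ℝ) :
    Continuous fun s => ∫ t in p..q, g (s, t) :=
  intervalIntegral.continuous_parametric_intervalIntegral_of_continuous'
    (f := fun s t => g (s, t)) (by fun_prop) _ _

theorem integral_integral_mono {f g : ℝ × ℝ → ℝ} (hf : Continuous f) (hg : Continuous g)
    {p q c d : ℝ} (hpq : p ≤ q) (hcd : c ≤ d)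
    (h : ∀ s ∈ Icc p q, ∀ t ∈ Icc c d, f (s, t) ≤ g (s, t)) :
    ∫ t in c..d, ∫ s in p..q, f (s, t) ≤ ∫ t in c..d, ∫ s in p..q, g (s, t) := by
  refine intervalIntegral.integral_mono_on hcd
    ((continuous_integral_fst hf p q).intervalIntegrable _ _)
    ((continuous_integral_fst hg p q).intervalIntegrable _ _) fun t ht => ?_
  exact intervalIntegral.integral_mono_on hpq (Continuous.intervalIntegrable (by fun_prop) _ _)
    (Continuous.intervalIntegrable (by fun_prop) _ _) fun s hs => h s hs t ht

theorem integral_integral_swap_of_continuous {g : ℝ × ℝ → ℝ} (hg : Continuous g) (p q c d : ℝ) :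
    ∫ t in c..d, ∫ s in p..q, g (s, t) = ∫ s in p..q, ∫ t in c..d, g (s, t) := by
  refine intervalIntegral_intervalIntegral_swap (F := fun t s => g (s, t)) ?_
  have h1 : Continuous (Function.uncurry fun t s => g (s, t)) := by fun_prop
  exact (h1.continuousOn.integrableOn_compact (isCompact_uIcc.prod isCompact_uIcc)).mono_set
    (prod_mono uIoc_subset_uIcc uIoc_subset_uIcc)

theorem continuous_refErr (k a b : ℕ) {f : ℝ × ℝ → ℝ} (hf : ContDiff ℝ ∞ f) :
    Continuous fun P : ℝ × ℝ => refErr k a b f P.1 P.2 := by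
  simp only [refErr]
  refine ((contDiff_classicalDeriv hf a b).continuous.comp (by fun_prop)).sub ?_
  refine continuous_finsetSum _ fun p _ => continuous_finsetSum _ fun q _ => ?_
  exact (continuous_const.mul ((derivative^[a] (jacobiNeg p)).continuous.comp continuous_fst)).mul
    ((derivative^[b] (jacobiNeg q)).continuous.comp continuous_snd)

/-- The error functional is bounded in C^1, so its bound by an L^1 norm needs a share of at least 2.
The product E⊗E has to split r into two such shares, here 2 and r - 2, which forces r ≥ 4. -/
theorem refErr_L2_bound {k : ℕ} (hk : 3 ≤ k) :
    ∃ K : ℝ, 0 ≤ K ∧ ∀ (f : ℝ × ℝ → ℝ), ContDiff ℝ ∞ f → ∀ r : ℕ, 4 ≤ r → r ≤ k + 1 →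
      ∫ t in (-1 : ℝ)..1, ∫ s in (-1 : ℝ)..1, refErr k 0 0 f s t ^ 2 ≤
        K * ∫ t in (-1 : ℝ)..1, ∫ s in (-1 : ℝ)..1, (classicalDeriv r 0 f (s, t) ^ 2 +
          classicalDeriv 0 r f (s, t) ^ 2 + classicalDeriv 2 (r - 2) f (s, t) ^ 2) := by
  obtain ⟨M, hM0, hM⟩ := exists_functional_const k
  set N := M * 2 ^ (k + 2) + M * M * 2 ^ (k + 2) with hN
  have hN0 : 0 ≤ N := by positivity
  -- A factor 3 comes from squaring a sum of three terms. The largest weight of the three integrals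
  -- is 16: the factor 4 of the double Cauchy–Schwarz step times the area 4 of the square.
  refine ⟨48 * N ^ 2, by positivity, ?_⟩
  intro f hf r hr4 hrk
  set g1 := classicalDeriv r 0 f
  set g2 := classicalDeriv 0 r f
  set g3 := classicalDeriv 2 (r - 2) f
  have c1 : Continuous g1 := (contDiff_classicalDeriv hf _ _).continuous
  have c2 : Continuous g2 := (contDiff_classicalDeriv hf _ _).continuous
  have c3 : Continuous g3 := (contDiff_classicalDeriv hf _ _).continuous
  set A1 : ℝ → ℝ := fun t => ∫ s in (-1 : ℝ)..1, g1 (s, t) ^ 2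
  set A2 : ℝ → ℝ := fun s => ∫ t in (-1 : ℝ)..1, g2 (s, t) ^ 2
  set A3 : ℝ := ∫ t in (-1 : ℝ)..1, ∫ s in (-1 : ℝ)..1, g3 (s, t) ^ 2 with hA3
  have cA1 : Continuous A1 := continuous_integral_fst (g := fun P => g1 P ^ 2) (by fun_prop) _ _
  have cA2 : Continuous A2 := continuous_integral_snd (g := fun P => g2 P ^ 2) (by fun_prop) _ _
  have pw : ∀ s ∈ Icc (-1 : ℝ) 1, ∀ t ∈ Icc (-1 : ℝ) 1,
      refErr k 0 0 f s t ^ 2 ≤ 3 * N ^ 2 * (2 * A1 t + 2 * A2 s + 4 * A3) := by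
    intro s hs t ht
    obtain ⟨hF0, hF1, hFE⟩ := hM 0 (by omega) s hs
    obtain ⟨hG0, hG1, hGE⟩ := hM 0 (by omega) t ht
    have hp : ∀ x : ℝ, 0 ≤ x → M * (2 ^ r * x) ≤ N * x := fun x hx => by
      have h1 : M * 2 ^ r ≤ N := by
        have : (2 : ℝ) ^ r ≤ 2 ^ (k + 2) := pow_le_pow_right₀ (by norm_num) (by omega)
        have h3 : 0 ≤ M * M * 2 ^ (k + 2) := by positivity
        rw [hN]; nlinarith
      calc M * (2 ^ r * x) = (M * 2 ^ r) * x := by ring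
        _ ≤ N * x := by gcongr
    set I1 := ∫ σ in (-1 : ℝ)..1, |g1 (σ, t)|
    set I2 := ∫ τ in (-1 : ℝ)..1, |g2 (s, τ)|
    set I3 := ∫ τ in (-1 : ℝ)..1, ∫ σ in (-1 : ℝ)..1, |g3 (σ, τ)| with hI3
    have i1 : 0 ≤ I1 := intervalIntegral.integral_nonneg (by norm_num) fun _ _ => abs_nonneg _
    have i2 : 0 ≤ I2 := intervalIntegral.integral_nonneg (by norm_num) fun _ _ => abs_nonneg _
    have i3 : 0 ≤ I3 := intervalIntegral.integral_nonneg (by norm_num) fun _ _ =>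
      intervalIntegral.integral_nonneg (by norm_num) fun _ _ => abs_nonneg _
    have aE : ∀ r' ≤ k + 1, ∀ s, Annihilates r' (errFunctional k 0 s) := fun r' hr' s =>
      errFunctional_annihilates hk hr' 0 s
    have e1 : |errFunctional k 0 s fun s => f (s, t)| ≤ N * I1 := by
      refine (hFE.abs_le_integral (aE r hrk s) (by simp; omega) (contDiff_slice_fst hf t)).trans ?_
      simp only [iteratedDeriv_slice_fst]
      exact hp _ i1
    have e2 : |errFunctional k 0 t fun t => f (s, t)| ≤ N * I2 := by
      refine (hGE.abs_le_integral (aE r hrk t) (by simp; omega) (contDiff_slice_snd hf s)).trans ?_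
      simp only [iteratedDeriv_slice_snd]
      exact hp _ i2
    have e3 : |errFunctional k 0 t fun t => errFunctional k 0 s fun s => f (s, t)| ≤ N * I3 := by
      refine (hFE.tensor_abs_le_integral hGE (aE 2 (by omega) s) (aE (r - 2) (by omega) t)
        (by simp) (by simp; omega) hf).trans ?_
      calc M * (2 ^ (r - 2) * (M * (2 ^ 2 * I3))) = M * M * 2 ^ (r - 2 + 2) * I3 := by
            rw [pow_add]; ring
        _ ≤ N * I3 := by
          gcongr
          have : (2 : ℝ) ^ (r - 2 + 2) ≤ 2 ^ (k + 2) :=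
            pow_le_pow_right₀ (by norm_num) (by omega)
          have h3 : 0 ≤ M * 2 ^ (k + 2) := by positivity
          rw [hN]
          nlinarith [mul_nonneg hM0 hM0]
    have q1 : I1 ^ 2 ≤ 2 * A1 t := sq_integral_abs_le (g := fun σ => g1 (σ, t)) (by fun_prop)
    have q2 : I2 ^ 2 ≤ 2 * A2 s := sq_integral_abs_le (g := fun τ => g2 (s, τ)) (by fun_prop)
    have q3 : I3 ^ 2 ≤ 4 * A3 := by
      have cI : Continuous fun τ => ∫ σ in (-1 : ℝ)..1, |g3 (σ, τ)| :=
        continuous_integral_fst (g := fun P => |g3 P|) (by fun_prop) _ _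
      have h1 := sq_integral_abs_le cI
      have h2 : ∫ τ in (-1 : ℝ)..1, (∫ σ in (-1 : ℝ)..1, |g3 (σ, τ)|) ^ 2 ≤
          ∫ τ in (-1 : ℝ)..1, 2 * ∫ σ in (-1 : ℝ)..1, g3 (σ, τ) ^ 2 := by
        refine intervalIntegral.integral_mono_on (by norm_num)
          ((cI.pow 2).intervalIntegrable _ _) ?_ fun τ _ =>
            sq_integral_abs_le (g := fun σ => g3 (σ, τ)) (by fun_prop)
        exact ((continuous_integral_fst (g := fun P => g3 P ^ 2) (by fun_prop) _ _).const_mul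
          2).intervalIntegrable _ _
      rw [intervalIntegral.integral_const_mul, ← hA3] at h2
      have h3 : |I3| ^ 2 = I3 ^ 2 := sq_abs _
      have h4 : (∫ τ in (-1 : ℝ)..1, abs (∫ x in (-1 : ℝ)..1, |g3 (x, τ)|)) = I3 := by
        refine intervalIntegral.integral_congr fun τ _ => ?_
        exact abs_of_nonneg (intervalIntegral.integral_nonneg (by norm_num) fun _ _ => abs_nonneg _)
      rw [h4] at h1
      linarith
    have e : |refErr k 0 0 f s t| ≤ N * (I1 + I2 + I3) := by
      rw [refErr_eq_sub_err_err hf (by omega) (by omega) hs ht]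
      simp only [iteratedDeriv_zero]
      refine (abs_sub _ _).trans ((add_le_add (abs_add_le _ _) le_rfl).trans ?_)
      linarith
    calc refErr k 0 0 f s t ^ 2 = |refErr k 0 0 f s t| ^ 2 := (sq_abs _).symm
      _ ≤ (N * (I1 + I2 + I3)) ^ 2 := by gcongr
      _ = N ^ 2 * (I1 + I2 + I3) ^ 2 := by ring
      _ ≤ N ^ 2 * (3 * (I1 ^ 2 + I2 ^ 2 + I3 ^ 2)) := by
        gcongr
        nlinarith [sq_nonneg (I1 - I2), sq_nonneg (I1 - I3), sq_nonneg (I2 - I3)]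
      _ ≤ N ^ 2 * (3 * (2 * A1 t + 2 * A2 s + 4 * A3)) := by gcongr
      _ = _ := by ring
  have hlhs := integral_integral_mono (f := fun P => refErr k 0 0 f P.1 P.2 ^ 2)
    (g := fun P => 3 * N ^ 2 * (2 * A1 P.2 + 2 * A2 P.1 + 4 * A3))
    ((continuous_refErr k 0 0 hf).pow 2) (by fun_prop) (p := -1) (q := 1) (c := -1) (d := 1)
    (by norm_num) (by norm_num) pw
  refine hlhs.trans ?_
  have hA2 : ∫ s in (-1 : ℝ)..1, A2 s = ∫ t in (-1 : ℝ)..1, ∫ s in (-1 : ℝ)..1, g2 (s, t) ^ 2 :=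
    (integral_integral_swap_of_continuous (g := fun P => g2 P ^ 2) (by fun_prop) _ _ _ _).symm
  have hin : ∀ t, ∫ s in (-1 : ℝ)..1, (3 * N ^ 2 * (2 * A1 t + 2 * A2 s + 4 * A3)) =
      3 * N ^ 2 * (4 * A1 t + 2 * (∫ s in (-1 : ℝ)..1, A2 s) + 8 * A3) := fun t => by
    rw [intervalIntegral.integral_const_mul, intervalIntegral.integral_add,
      intervalIntegral.integral_add, intervalIntegral.integral_const_mul,
      intervalIntegral.integral_const_mul,
      intervalIntegral.integral_const, intervalIntegral.integral_const]
    · simp only [smul_eq_mul]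
      ring
    all_goals exact Continuous.intervalIntegrable (by fun_prop) _ _
  have hout : ∫ t in (-1 : ℝ)..1, ∫ s in (-1 : ℝ)..1,
      (3 * N ^ 2 * (2 * A1 t + 2 * A2 s + 4 * A3)) =
      3 * N ^ 2 * (4 * (∫ t in (-1 : ℝ)..1, A1 t) + 4 * (∫ s in (-1 : ℝ)..1, A2 s) + 16 * A3) := by
    simp only [hin]
    rw [intervalIntegral.integral_const_mul, intervalIntegral.integral_add,
      intervalIntegral.integral_add, intervalIntegral.integral_const_mul,
      intervalIntegral.integral_const, intervalIntegral.integral_const]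
    · simp only [smul_eq_mul]
      ring
    all_goals exact Continuous.intervalIntegrable (by fun_prop) _ _
  have hrhs : ∫ t in (-1 : ℝ)..1, ∫ s in (-1 : ℝ)..1,
      (g1 (s, t) ^ 2 + g2 (s, t) ^ 2 + g3 (s, t) ^ 2) =
      (∫ t in (-1 : ℝ)..1, A1 t) + (∫ s in (-1 : ℝ)..1, A2 s) + A3 := by
    rw [hA2, hA3]
    have c2' := continuous_integral_fst (g := fun P => g2 P ^ 2) (by fun_prop) (-1) 1
    have c3' := continuous_integral_fst (g := fun P => g3 P ^ 2) (by fun_prop) (-1) 1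
    have cA12 : Continuous fun t => A1 t + ∫ s in (-1 : ℝ)..1, g2 (s, t) ^ 2 := cA1.add c2'
    rw [← intervalIntegral.integral_add (cA1.intervalIntegrable _ _)
      (c2'.intervalIntegrable _ _), ← intervalIntegral.integral_add
      (cA12.intervalIntegrable _ _) (c3'.intervalIntegrable _ _)]
    congr 1
    ext t
    rw [intervalIntegral.integral_add, intervalIntegral.integral_add]
    all_goals exact Continuous.intervalIntegrable (by fun_prop) _ _
  rw [hrhs, hout]
  have p1 : 0 ≤ ∫ t in (-1 : ℝ)..1, A1 t := intervalIntegral.integral_nonneg (by norm_num)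
    fun _ _ => intervalIntegral.integral_nonneg (by norm_num) fun _ _ => sq_nonneg _
  have p2 : 0 ≤ ∫ s in (-1 : ℝ)..1, A2 s := intervalIntegral.integral_nonneg (by norm_num)
    fun _ _ => intervalIntegral.integral_nonneg (by norm_num) fun _ _ => sq_nonneg _
  have hNN : 0 ≤ N ^ 2 := sq_nonneg N
  nlinarith [mul_nonneg hNN p1, mul_nonneg hNN p2]

/-! ### Affine maps between the reference interval and the mesh intervals -/

theorem toRef_fromRef {p q : ℝ} (h : p < q) (s : ℝ) : toRef p q (fromRef p q s) = s := by
  have : q - p ≠ 0 := by linarith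
  rw [toRef, fromRef]
  field_simp
  ring

theorem fromRef_toRef {p q : ℝ} (h : p < q) (x : ℝ) : fromRef p q (toRef p q x) = x := by
  have : q - p ≠ 0 := by linarith
  rw [toRef, fromRef]
  field_simp
  ring

theorem fromRef_eq (p q s : ℝ) : fromRef p q s = (q - p) / 2 * s + (p + q) / 2 := by
  rw [fromRef]; ring

theorem fromRef_mem {p q : ℝ} (h : p < q) {s : ℝ} (hs : s ∈ Icc (-1 : ℝ) 1) :
    fromRef p q s ∈ Icc p q := by
  rw [fromRef]
  constructor <;> nlinarith [hs.1, hs.2]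

theorem toRef_mem {p q : ℝ} (h : p < q) {x : ℝ} (hx : x ∈ Icc p q) :
    toRef p q x ∈ Icc (-1 : ℝ) 1 := by
  have h0 : 0 < q - p := by linarith
  rw [toRef]
  constructor
  · rw [le_div_iff₀ h0]; linarith [hx.1]
  · rw [div_le_iff₀ h0]; linarith [hx.2]

theorem fromRef_neg_one (p q : ℝ) : fromRef p q (-1) = p := by rw [fromRef]; ring

theorem fromRef_one (p q : ℝ) : fromRef p q 1 = q := by rw [fromRef]; ring

theorem hasDerivAt_fromRef (p q s : ℝ) : HasDerivAt (fromRef p q) ((q - p) / 2) s := by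
  rw [funext (fromRef_eq p q)]
  simpa using ((hasDerivAt_id s).const_mul ((q - p) / 2)).add_const ((p + q) / 2)

theorem hasDerivAt_toRef {p q : ℝ} (x : ℝ) : HasDerivAt (toRef p q) (2 / (q - p)) x := by
  have : toRef p q = fun x => (2 * x - q - p) / (q - p) := rfl
  rw [this]
  simpa using ((((hasDerivAt_id x).const_mul 2).sub_const q).sub_const p).div_const (q - p)

theorem continuous_fromRef (p q : ℝ) : Continuous (fromRef p q) := by
  rw [funext (fromRef_eq p q)]; fun_prop

/-- The pull-back of a function on the element `[p,q] × [p',q']` to the reference square. -/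
noncomputable def pullback (p q p' q' : ℝ) (f : ℝ × ℝ → ℝ) (S : ℝ × ℝ) : ℝ :=
  f (fromRef p q S.1, fromRef p' q' S.2)

theorem contDiff_pullback (p q p' q' : ℝ) {f : ℝ × ℝ → ℝ} (hf : ContDiff ℝ ∞ f) :
    ContDiff ℝ ∞ (pullback p q p' q' f) := by
  refine hf.comp (ContDiff.prodMk ?_ ?_)
  · simp only [fromRef_eq]; fun_prop
  · simp only [fromRef_eq]; fun_prop

theorem pdX_const_mul_pullback (e p q p' q' : ℝ) {f : ℝ × ℝ → ℝ} (hf : ContDiff ℝ ∞ f) :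
    pdX (fun S => e * pullback p q p' q' f S) =
      fun S => (e * ((q - p) / 2)) * pullback p q p' q' (pdX f) S := by
  ext S
  have h1 := (hasDerivAt_pdX (differentiable_of_smooth hf) (fromRef p q S.1)
    (fromRef p' q' S.2)).comp S.1 (hasDerivAt_fromRef p q S.1)
  rw [pdX]
  refine ((h1.const_mul e).deriv).trans ?_
  simp only [pullback]
  ring

theorem pdY_const_mul_pullback (e p q p' q' : ℝ) {f : ℝ × ℝ → ℝ} (hf : ContDiff ℝ ∞ f) :
    pdY (fun S => e * pullback p q p' q' f S) =
      fun S => (e * ((q' - p') / 2)) * pullback p q p' q' (pdY f) S := by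
  ext S
  have h1 := (hasDerivAt_pdY (differentiable_of_smooth hf) (fromRef p q S.1)
    (fromRef p' q' S.2)).comp S.2 (hasDerivAt_fromRef p' q' S.2)
  rw [pdY]
  refine ((h1.const_mul e).deriv).trans ?_
  simp only [pullback]
  ring

theorem classicalDeriv_pullback (p q p' q' : ℝ) {f : ℝ × ℝ → ℝ} (hf : ContDiff ℝ ∞ f) (i j : ℕ) :
    classicalDeriv i j (pullback p q p' q' f) = fun S =>
      (((q' - p') / 2) ^ j * ((q - p) / 2) ^ i) * pullback p q p' q' (classicalDeriv i j f) S := by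
  have h1 : ∀ j, pdY^[j] (pullback p q p' q' f) =
      fun S => ((q' - p') / 2) ^ j * pullback p q p' q' (pdY^[j] f) S := by
    intro j
    induction j with
    | zero => ext S; simp
    | succ j ih =>
      rw [Function.iterate_succ_apply', ih, pdY_const_mul_pullback _ _ _ _ _
        (contDiff_pdY_iterate hf j), Function.iterate_succ_apply']
      simp only [pow_succ]
  rw [classicalDeriv_eq, h1]
  induction i with
  | zero => simp [classicalDeriv_eq]
  | succ i ih =>
    rw [Function.iterate_succ_apply', ih, pdX_const_mul_pullback _ _ _ _ _
      (contDiff_classicalDeriv hf i j), pdX_classicalDeriv]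
    simp only [pow_succ, mul_assoc]

namespace RectMesh

variable {a b c d : ℝ} (T : RectMesh a b c d)

theorem x_step_le_h {i : ℕ} (hi : i < T.M) : T.x (i + 1) - T.x i ≤ T.h :=
  le_max_of_le_left (Finset.le_sup' (fun i => T.x (i + 1) - T.x i) (Finset.mem_range.mpr hi))

theorem y_step_le_h {j : ℕ} (hj : j < T.N) : T.y (j + 1) - T.y j ≤ T.h :=
  le_max_of_le_right (Finset.le_sup' (fun i => T.y (i + 1) - T.y i) (Finset.mem_range.mpr hj))

theorem hmin_le_x_step {i : ℕ} (hi : i < T.M) : T.hmin ≤ T.x (i + 1) - T.x i :=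
  min_le_of_left_le (Finset.inf'_le (fun i => T.x (i + 1) - T.x i) (Finset.mem_range.mpr hi))

theorem hmin_le_y_step {j : ℕ} (hj : j < T.N) : T.hmin ≤ T.y (j + 1) - T.y j :=
  min_le_of_right_le (Finset.inf'_le (fun i => T.y (i + 1) - T.y i) (Finset.mem_range.mpr hj))

theorem h_pos : 0 < T.h :=
  (sub_pos.mpr (T.x_lt 0 T.M_pos)).trans_le (T.x_step_le_h T.M_pos)

theorem hmin_pos : 0 < T.hmin := by
  simp only [hmin, lt_min_iff, Finset.lt_inf'_iff, Finset.mem_range, sub_pos]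
  exact ⟨fun i hi => T.x_lt i hi, fun j hj => T.y_lt j hj⟩

/-- The derivative `∂_x^m ∂_y^n` of the truncated Jacobi expansion on the element `(i, j)`. -/
noncomputable def localDeriv (k : ℕ) (u : ℝ × ℝ → ℝ) (i j m n : ℕ) (P : ℝ × ℝ) : ℝ :=
  ∑ p ∈ Finset.range (k + 1), ∑ q ∈ Finset.range (k + 1),
    T.coeff u i j p q *
      ((2 / (T.x (i + 1) - T.x i)) ^ m *
        (derivative^[m] (jacobiNeg p)).eval (toRef (T.x i) (T.x (i + 1)) P.1)) *
      ((2 / (T.y (j + 1) - T.y j)) ^ n *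
        (derivative^[n] (jacobiNeg q)).eval (toRef (T.y j) (T.y (j + 1)) P.2))

theorem localDeriv_zero_zero (k : ℕ) (u : ℝ × ℝ → ℝ) (i j : ℕ) :
    T.localDeriv k u i j 0 0 = T.localProj k u i j := by
  ext P
  simp [localDeriv, localProj]

theorem sub_localDeriv_eq {i j : ℕ} (hi : i < T.M) (hj : j < T.N) (k m n : ℕ) {f : ℝ × ℝ → ℝ}
    (hf : ContDiff ℝ ∞ f) (P : ℝ × ℝ) :
    classicalDeriv m n f P - T.localDeriv k f i j m n P =
      (2 / (T.x (i + 1) - T.x i)) ^ m * (2 / (T.y (j + 1) - T.y j)) ^ n *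
        refErr k m n (pullback (T.x i) (T.x (i + 1)) (T.y j) (T.y (j + 1)) f)
          (toRef (T.x i) (T.x (i + 1)) P.1) (toRef (T.y j) (T.y (j + 1)) P.2) := by
  have hx := T.x_lt i hi
  have hy := T.y_lt j hj
  have hx0 : T.x (i + 1) - T.x i ≠ 0 := by linarith
  have hy0 : T.y (j + 1) - T.y j ≠ 0 := by linarith
  rw [refErr, classicalDeriv_pullback _ _ _ _ hf, localDeriv, mul_sub, Finset.mul_sum]
  simp only [pullback, fromRef_toRef hx, fromRef_toRef hy, Prod.mk.eta]
  congr 1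
  · have e1 : (2 / (T.x (i + 1) - T.x i)) ^ m * ((T.x (i + 1) - T.x i) / 2) ^ m = 1 := by
      rw [← mul_pow]; field_simp; simp
    have e2 : (2 / (T.y (j + 1) - T.y j)) ^ n * ((T.y (j + 1) - T.y j) / 2) ^ n = 1 := by
      rw [← mul_pow]; field_simp; simp
    linear_combination (-(2 / (T.y (j + 1) - T.y j)) ^ n * ((T.y (j + 1) - T.y j) / 2) ^ n *
      classicalDeriv m n f P) * e1 - classicalDeriv m n f P * e2
  · refine Finset.sum_congr rfl fun p _ => ?_
    rw [Finset.mul_sum]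
    refine Finset.sum_congr rfl fun q _ => ?_
    rw [coeff]
    ring

end RectMesh

/-! ### Scaled error bounds on one element for smooth functions -/

theorem smooth_error_bound {k : ℕ} (hk : 3 ≤ k) (σ : ℝ) :
    ∃ K : ℝ, 0 ≤ K ∧ ∀ (a b c d : ℝ) (T : RectMesh a b c d), T.h ≤ σ * T.hmin →
      ∀ i < T.M, ∀ j < T.N, ∀ f : ℝ × ℝ → ℝ, ContDiff ℝ ∞ f → ∀ (r : ℕ) (B : ℝ), 2 ≤ r → r ≤ k + 2 →
      (∀ i' j' : ℕ, i' + j' = r → ∀ P ∈ T.elem i j, |classicalDeriv i' j' f P| ≤ B) →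
      ∀ m n : ℕ, m + n ≤ 2 → ∀ s ∈ Icc (-1 : ℝ) 1, ∀ t ∈ Icc (-1 : ℝ) 1,
        (r = k + 2 → n = 0 → (derivative^[m] (jacobiNeg (k + 1))).eval s = 0) →
        (r = k + 2 → m = 0 → (derivative^[n] (jacobiNeg (k + 1))).eval t = 0) →
        |classicalDeriv m n f (fromRef (T.x i) (T.x (i + 1)) s, fromRef (T.y j) (T.y (j + 1)) t) -
          T.localDeriv k f i j m n
            (fromRef (T.x i) (T.x (i + 1)) s, fromRef (T.y j) (T.y (j + 1)) t)| ≤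
          K * T.h ^ (r - (m + n)) * B := by
  obtain ⟨K, hK0, hK⟩ := refErr_sup_bound hk
  -- Each derivative of the error costs 2 over an edge length, at most (2|σ| + 1) / h by
  -- quasi-uniformity. The summand 1 makes the base at least 1, so the exponent m + n may be raised
  -- to 2.
  refine ⟨(2 * |σ| + 1) ^ 2 * K, by positivity, ?_⟩
  intro a b c d T hσ i hi j hj f hf r B hr2 hrk hB m n hmn s hs t ht hcs hct
  have hx := T.x_lt i hi
  have hy := T.y_lt j hj
  have hh := T.h_pos
  set hx' := T.x (i + 1) - T.x i with hhx
  set hy' := T.y (j + 1) - T.y j with hhy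
  have hx0 : 0 < hx' := sub_pos.mpr hx
  have hy0 : 0 < hy' := sub_pos.mpr hy
  have hxh : hx' ≤ T.h := T.x_step_le_h hi
  have hyh : hy' ≤ T.h := T.y_step_le_h hj
  have hB0 : 0 ≤ B := (abs_nonneg _).trans (hB r 0 (by omega)
    (fromRef (T.x i) (T.x (i + 1)) 0, fromRef (T.y j) (T.y (j + 1)) 0)
    ⟨fromRef_mem hx (by norm_num), fromRef_mem hy (by norm_num)⟩)
  have hinv : ∀ w : ℝ, 0 < w → T.hmin ≤ w → 2 / w ≤ (2 * |σ| + 1) / T.h := by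
    intro w hw0 hw
    rw [div_le_div_iff₀ hw0 hh]
    have h1 : T.h ≤ |σ| * w := by
      have : σ * T.hmin ≤ |σ| * w := mul_le_mul (le_abs_self σ) hw T.hmin_pos.le (abs_nonneg _)
      exact hσ.trans this
    nlinarith
  have hS := hK _ (contDiff_pullback (T.x i) (T.x (i + 1)) (T.y j) (T.y (j + 1)) hf) r
    (T.h ^ r * B) hr2 hrk (by
      intro i' j' hij s hs t ht
      rw [classicalDeriv_pullback _ _ _ _ hf, abs_mul]
      refine mul_le_mul ?_ (hB i' j' hij _ ⟨fromRef_mem hx hs, fromRef_mem hy ht⟩)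
        (abs_nonneg _) (by positivity)
      rw [abs_of_nonneg (by positivity), ← hij, add_comm i' j', pow_add]
      exact mul_le_mul (pow_le_pow_left₀ (by positivity) (by linarith) _)
        (pow_le_pow_left₀ (by positivity) (by linarith) _) (by positivity) (by positivity)) m n hmn s hs t ht hcs hct
  rw [T.sub_localDeriv_eq hi hj k m n hf]
  simp only [toRef_fromRef hx, toRef_fromRef hy]
  rw [abs_mul, abs_of_nonneg (by positivity)]
  set Q := (2 * |σ| + 1) with hQ
  have hQ1 : 1 ≤ Q := by have := abs_nonneg σ; linarith
  calc (2 / hx') ^ m * (2 / hy') ^ n * |refErr k m n _ s t|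
      ≤ (Q / T.h) ^ m * (Q / T.h) ^ n * (K * (T.h ^ r * B)) := by
        exact mul_le_mul (mul_le_mul
          (pow_le_pow_left₀ (by positivity) (hinv _ hx0 (T.hmin_le_x_step hi)) _)
          (pow_le_pow_left₀ (by positivity) (hinv _ hy0 (T.hmin_le_y_step hj)) _)
          (by positivity) (by positivity)) hS (abs_nonneg _) (by positivity)
    _ = Q ^ (m + n) * K * (T.h ^ r / T.h ^ (m + n)) * B := by
        rw [← pow_add, div_pow]; ring
    _ ≤ Q ^ 2 * K * (T.h ^ r / T.h ^ (m + n)) * B := by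
        gcongr
    _ = Q ^ 2 * K * T.h ^ (r - (m + n)) * B := by
        rw [pow_sub₀ _ hh.ne' (by omega), div_eq_mul_inv]

theorem integral_comp_fromRef (g : ℝ → ℝ) (p q : ℝ) :
    (q - p) / 2 * ∫ s in (-1 : ℝ)..1, g (fromRef p q s) = ∫ x in p..q, g x := by
  simp only [fromRef_eq]
  rw [intervalIntegral.mul_integral_comp_mul_add]
  congr 1 <;> ring

theorem integral_integral_comp_fromRef (g : ℝ × ℝ → ℝ) (p q p' q' : ℝ) :
    (q - p) / 2 * ((q' - p') / 2) * ∫ t in (-1 : ℝ)..1, ∫ s in (-1 : ℝ)..1,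
      g (fromRef p q s, fromRef p' q' t) = ∫ y in p'..q', ∫ x in p..q, g (x, y) := by
  rw [← integral_comp_fromRef _ p' q', mul_comm ((q - p) / 2), mul_assoc,
    ← intervalIntegral.integral_const_mul]
  simp only [← integral_comp_fromRef _ p q]

/-- Only the value of the error is estimated: the area factor is the same on both sides, and edge
lengths enter solely through the pulled-back derivatives, where they are bounded above by h. -/
theorem smooth_L2_error_bound {k : ℕ} (hk : 3 ≤ k) :
    ∃ K : ℝ, 0 ≤ K ∧ ∀ (a b c d : ℝ) (T : RectMesh a b c d),
      ∀ i < T.M, ∀ j < T.N, ∀ f : ℝ × ℝ → ℝ, ContDiff ℝ ∞ f → ∀ r : ℕ, 4 ≤ r → r ≤ k + 1 →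
      ∫ y in T.y j..T.y (j + 1), ∫ x in T.x i..T.x (i + 1), (f (x, y) - T.localProj k f i j (x, y)) ^ 2
        ≤ K * (T.h ^ r) ^ 2 * ∫ y in T.y j..T.y (j + 1), ∫ x in T.x i..T.x (i + 1),
          (classicalDeriv r 0 f (x, y) ^ 2 + classicalDeriv 0 r f (x, y) ^ 2 +
            classicalDeriv 2 (r - 2) f (x, y) ^ 2) := by
  obtain ⟨K, hK0, hK⟩ := refErr_L2_bound hk
  refine ⟨K, hK0, ?_⟩
  intro a b c d T i hi j hj f hf r hr4 hrk
  have hx := T.x_lt i hi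
  have hy := T.y_lt j hj
  have hh := T.h_pos
  set p := T.x i
  set q := T.x (i + 1)
  set p' := T.y j
  set q' := T.y (j + 1)
  have hxh : (q - p) / 2 ≤ T.h := by have := T.x_step_le_h hi; linarith
  have hyh : (q' - p') / 2 ≤ T.h := by have := T.y_step_le_h hj; linarith
  set g1 := classicalDeriv r 0 f with hg1
  set g2 := classicalDeriv 0 r f with hg2
  set g3 := classicalDeriv 2 (r - 2) f with hg3
  have c1 : Continuous g1 := (contDiff_classicalDeriv hf _ _).continuous
  have c2 : Continuous g2 := (contDiff_classicalDeriv hf _ _).continuous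
  have c3 : Continuous g3 := (contDiff_classicalDeriv hf _ _).continuous
  have hF := contDiff_pullback p q p' q' hf
  have h1 := hK _ hF r hr4 hrk
  have e0 : ∀ s t, f (fromRef p q s, fromRef p' q' t) -
      T.localProj k f i j (fromRef p q s, fromRef p' q' t) =
      refErr k 0 0 (pullback p q p' q' f) s t := by
    intro s t
    have := T.sub_localDeriv_eq hi hj k 0 0 hf (fromRef p q s, fromRef p' q' t)
    rw [T.localDeriv_zero_zero] at this
    simp only [pow_zero, one_mul] at this
    rw [toRef_fromRef hx, toRef_fromRef hy] at this
    exact this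
  have hsc : ∀ i j : ℕ, i + j = r →
      ((((q' - p') / 2) ^ j * ((q - p) / 2) ^ i)) ^ 2 ≤ (T.h ^ r) ^ 2 := by
    intro i j hij
    rw [← hij, add_comm, pow_add]
    have : 0 ≤ (q' - p') / 2 := by linarith
    have : 0 ≤ (q - p) / 2 := by linarith
    gcongr
  have h2 : ∫ t in (-1 : ℝ)..1, ∫ s in (-1 : ℝ)..1,
      (classicalDeriv r 0 (pullback p q p' q' f) (s, t) ^ 2 +
        classicalDeriv 0 r (pullback p q p' q' f) (s, t) ^ 2 +
        classicalDeriv 2 (r - 2) (pullback p q p' q' f) (s, t) ^ 2) ≤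
      ∫ t in (-1 : ℝ)..1, ∫ s in (-1 : ℝ)..1, (T.h ^ r) ^ 2 *
        (g1 (fromRef p q s, fromRef p' q' t) ^ 2 + g2 (fromRef p q s, fromRef p' q' t) ^ 2 +
          g3 (fromRef p q s, fromRef p' q' t) ^ 2) := by
    have cx := continuous_fromRef p q
    have cy := continuous_fromRef p' q'
    have d1 := (contDiff_classicalDeriv hF r 0).continuous
    have d2 := (contDiff_classicalDeriv hF 0 r).continuous
    have d3 := (contDiff_classicalDeriv hF 2 (r - 2)).continuous
    refine integral_integral_mono
      (f := fun P => classicalDeriv r 0 (pullback p q p' q' f) P ^ 2 +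
        classicalDeriv 0 r (pullback p q p' q' f) P ^ 2 +
        classicalDeriv 2 (r - 2) (pullback p q p' q' f) P ^ 2)
      (g := fun P => (T.h ^ r) ^ 2 *
        (g1 (fromRef p q P.1, fromRef p' q' P.2) ^ 2 + g2 (fromRef p q P.1, fromRef p' q' P.2) ^ 2 +
          g3 (fromRef p q P.1, fromRef p' q' P.2) ^ 2))
      (by fun_prop) (by fun_prop) (by norm_num) (by norm_num) fun s _ t _ => ?_
    simp only [classicalDeriv_pullback _ _ _ _ hf, pullback, mul_pow, ← hg1, ← hg2, ← hg3, mul_add]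
    simp only [← mul_pow]
    have k1 := hsc r 0 (by omega)
    have k2 := hsc 0 r (by omega)
    have k3 := hsc 2 (r - 2) (by omega)
    simp only [mul_pow _ (g1 _), mul_pow _ (g2 _), mul_pow _ (g3 _)]
    gcongr
  simp only [intervalIntegral.integral_const_mul] at h2
  rw [← integral_integral_comp_fromRef (fun P => (f P - T.localProj k f i j P) ^ 2),
    ← integral_integral_comp_fromRef (fun P => g1 P ^ 2 + g2 P ^ 2 + g3 P ^ 2)]
  simp only [e0]
  have hpos : 0 ≤ (q - p) / 2 * ((q' - p') / 2) :=
    mul_nonneg (by linarith) (by linarith)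
  calc _ ≤ (q - p) / 2 * ((q' - p') / 2) * (K * ((T.h ^ r) ^ 2 * ∫ t in (-1 : ℝ)..1,
        ∫ s in (-1 : ℝ)..1, (g1 (fromRef p q s, fromRef p' q' t) ^ 2 +
          g2 (fromRef p q s, fromRef p' q' t) ^ 2 + g3 (fromRef p q s, fromRef p' q' t) ^ 2))) :=
        mul_le_mul_of_nonneg_left (h1.trans (mul_le_mul_of_nonneg_left h2 hK0)) hpos
    _ = _ := by ring

/-! ### Partial derivatives on the closed rectangle -/

section rectangle

variable {a b c d : ℝ} {f : ℝ × ℝ → ℝ}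

theorem uniqueDiffOn_rect (hab : a < b) (hcd : c < d) :
    UniqueDiffOn ℝ (Icc a b ×ˢ Icc c d : Set (ℝ × ℝ)) :=
  (uniqueDiffOn_Icc hab).prod (uniqueDiffOn_Icc hcd)

theorem hasDerivWithinAt_slice_fst {f' : ℝ × ℝ →L[ℝ] ℝ} {x y : ℝ} (hy : y ∈ Icc c d)
    (hf : HasFDerivWithinAt f f' (Icc a b ×ˢ Icc c d) (x, y)) :
    HasDerivWithinAt (fun s => f (s, y)) (f' (1, 0)) (Icc a b) x :=
  hf.comp_hasDerivWithinAt (f := fun s : ℝ => (s, y)) x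
    ((hasDerivWithinAt_id _ _).prodMk (hasDerivWithinAt_const _ _ _)) fun _ hs => ⟨hs, hy⟩

theorem hasDerivWithinAt_slice_snd {f' : ℝ × ℝ →L[ℝ] ℝ} {x y : ℝ} (hx : x ∈ Icc a b)
    (hf : HasFDerivWithinAt f f' (Icc a b ×ˢ Icc c d) (x, y)) :
    HasDerivWithinAt (fun t => f (x, t)) (f' (0, 1)) (Icc c d) y :=
  hf.comp_hasDerivWithinAt (f := fun t : ℝ => (x, t)) y
    ((hasDerivWithinAt_const _ _ _).prodMk (hasDerivWithinAt_id _ _)) fun _ hs => ⟨hx, hs⟩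

theorem hasDerivWithinAt_dX (hf : DifferentiableOn ℝ f (Icc a b ×ˢ Icc c d)) {x y : ℝ}
    (hx : x ∈ Icc a b) (hy : y ∈ Icc c d) :
    HasDerivWithinAt (fun s => f (s, y)) (dX a b f (x, y)) (Icc a b) x :=
  (hasDerivWithinAt_slice_fst hy (hf (x, y) ⟨hx, hy⟩).hasFDerivWithinAt).differentiableWithinAt
    |>.hasDerivWithinAt

theorem hasDerivWithinAt_dY (hf : DifferentiableOn ℝ f (Icc a b ×ˢ Icc c d)) {x y : ℝ}
    (hx : x ∈ Icc a b) (hy : y ∈ Icc c d) :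
    HasDerivWithinAt (fun t => f (x, t)) (dY c d f (x, y)) (Icc c d) y :=
  (hasDerivWithinAt_slice_snd hx (hf (x, y) ⟨hx, hy⟩).hasFDerivWithinAt).differentiableWithinAt
    |>.hasDerivWithinAt

theorem contDiffOn_dX (hab : a < b) (hcd : c < d) {m n : WithTop ℕ∞}
    (hf : ContDiffOn ℝ n f (Icc a b ×ˢ Icc c d)) (hmn : m + 1 ≤ n) :
    ContDiffOn ℝ m (dX a b f) (Icc a b ×ˢ Icc c d) := by
  refine ((hf.fderivWithin (uniqueDiffOn_rect hab hcd) hmn).clm_apply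
    (contDiffOn_const (c := ((1 : ℝ), (0 : ℝ))))).congr fun P hP => ?_
  have hd := hf.differentiableOn (fun h => by simp [h] at hmn) P hP
  exact (hasDerivWithinAt_slice_fst hP.2 hd.hasFDerivWithinAt).derivWithin
    (uniqueDiffOn_Icc hab _ hP.1)

theorem contDiffOn_dY (hab : a < b) (hcd : c < d) {m n : WithTop ℕ∞}
    (hf : ContDiffOn ℝ n f (Icc a b ×ˢ Icc c d)) (hmn : m + 1 ≤ n) :
    ContDiffOn ℝ m (dY c d f) (Icc a b ×ˢ Icc c d) := by
  refine ((hf.fderivWithin (uniqueDiffOn_rect hab hcd) hmn).clm_apply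
    (contDiffOn_const (c := ((0 : ℝ), (1 : ℝ))))).congr fun P hP => ?_
  have hd := hf.differentiableOn (fun h => by simp [h] at hmn) P hP
  exact (hasDerivWithinAt_slice_snd hP.1 hd.hasFDerivWithinAt).derivWithin
    (uniqueDiffOn_Icc hcd _ hP.2)

end rectangle

/-! ### The Jacobi coefficients of `C²` functions -/

theorem jacobiCoeff_congr (p : ℕ) {v w : ℝ → ℝ} (h : EqOn v w (Icc (-1) 1)) :
    jacobiCoeff p v = jacobiCoeff p w := by
  have h0 : v (-1) = w (-1) := h (by norm_num)
  have h1 : v 1 = w 1 := h (by norm_num)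
  have d0 : derivWithin v (Icc (-1) 1) (-1) = derivWithin w (Icc (-1) 1) (-1) :=
    derivWithin_congr h h0
  have d1 : derivWithin v (Icc (-1) 1) 1 = derivWithin w (Icc (-1) 1) 1 :=
    derivWithin_congr h h1
  rcases p with _ | _ | _ | _ | n
  · exact h0
  · exact h1
  · exact d0
  · exact d1
  · simp only [jacobiCoeff]
    congr 1
    refine intervalIntegral.integral_congr fun s hs => ?_
    rw [uIcc_of_le (by norm_num)] at hs
    simp only [hermite, h0, h1, d0, d1, h hs]

theorem jacobiCoeff_const_mul (p : ℕ) (e : ℝ) (v : ℝ → ℝ) :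
    jacobiCoeff p (fun s => e * v s) = e * jacobiCoeff p v := by
  have hd : ∀ x, derivWithin (fun s => e * v s) (Icc (-1) 1) x =
      e * derivWithin v (Icc (-1) 1) x := fun x => by
    rw [derivWithin_const_mul_field]
  rcases p with _ | _ | _ | _ | n
  · rfl
  · rfl
  · exact hd _
  · exact hd _
  · simp only [jacobiCoeff]
    rw [← mul_div_assoc, ← intervalIntegral.integral_const_mul]
    congr 2
    ext s
    simp only [hermite, hd]
    ring

theorem derivWithin_comp_fromRef {c d p q : ℝ} (hpq : p < q) (hsub : Icc p q ⊆ Icc c d)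
    {g : ℝ → ℝ} {g' : ℝ} {t : ℝ} (ht : t ∈ Icc (-1 : ℝ) 1)
    (hg : HasDerivWithinAt g g' (Icc c d) (fromRef p q t)) :
    derivWithin (fun t => g (fromRef p q t)) (Icc (-1) 1) t = (q - p) / 2 * g' := by
  have h1 := hg.comp t (hasDerivAt_fromRef p q t).hasDerivWithinAt
    (s := Icc (-1) 1) fun s hs => hsub (fromRef_mem hpq hs)
  rw [mul_comm]
  exact h1.derivWithin (uniqueDiffWithinAt_ref ht)

theorem endpointFunctional_congr (e : Fin 4 → ℝ) (W : ℝ[X]) {v v' w w' : ℝ → ℝ}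
    (h : EqOn v w (Icc (-1) 1)) (h' : EqOn v' w' (Icc (-1) 1)) :
    endpointFunctional e W v v' = endpointFunctional e W w w' := by
  have hi : ∫ s in (-1 : ℝ)..1, v s * W.eval s = ∫ s in (-1 : ℝ)..1, w s * W.eval s := by
    refine intervalIntegral.integral_congr fun s hs => ?_
    rw [uIcc_of_le (by norm_num)] at hs
    simp only [h hs]
  rw [endpointFunctional, endpointFunctional, hi, h (by norm_num : (-1 : ℝ) ∈ _),
    h (by norm_num : (1 : ℝ) ∈ _), h' (by norm_num : (-1 : ℝ) ∈ _), h' (by norm_num : (1 : ℝ) ∈ _)]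

theorem endpointFunctional_sub (e : Fin 4 → ℝ) (W : ℝ[X]) {v v' w w' : ℝ → ℝ}
    (hv : ContinuousOn v (Icc (-1) 1)) (hw : ContinuousOn w (Icc (-1) 1)) :
    endpointFunctional e W (fun s => v s - w s) (fun s => v' s - w' s) =
      endpointFunctional e W v v' - endpointFunctional e W w w' := by
  have hi : ∀ v : ℝ → ℝ, ContinuousOn v (Icc (-1) 1) →
      IntervalIntegrable (fun s => v s * W.eval s) volume (-1) 1 := fun v hv => by
    apply ContinuousOn.intervalIntegrable
    rw [uIcc_of_le (by norm_num)]
    exact hv.mul W.continuous.continuousOn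
  simp only [endpointFunctional, sub_mul]
  rw [intervalIntegral.integral_sub (hi v hv) (hi w hw)]
  ring

/-- `endpointFunctional` applied in the first variable on the mesh interval `[p,q]`. -/
noncomputable def stripFunctional (e : Fin 4 → ℝ) (W : ℝ[X]) (p q : ℝ) (v v' : ℝ × ℝ → ℝ)
    (y : ℝ) : ℝ :=
  endpointFunctional e W (fun s => v (fromRef p q s, y)) fun s => (q - p) / 2 * v' (fromRef p q s, y)

section strip

variable {a b c d p q : ℝ} (hpq : p < q) (hsub : Icc p q ⊆ Icc a b)
include hpq hsub

theorem continuousOn_comp_fromRef_fst {v : ℝ × ℝ → ℝ} (hv : ContinuousOn v (Icc a b ×ˢ Icc c d))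
    {y : ℝ} (hy : y ∈ Icc c d) : ContinuousOn (fun s => v (fromRef p q s, y)) (Icc (-1) 1) :=
  hv.comp ((continuous_fromRef p q).prodMk continuous_const).continuousOn
    fun _ hs => ⟨hsub (fromRef_mem hpq hs), hy⟩

theorem hasDerivWithinAt_stripFunctional (e : Fin 4 → ℝ) (W : ℝ[X]) (hcd : c < d)
    {v v' w w' : ℝ × ℝ → ℝ}
    (hv : ContinuousOn v (Icc a b ×ˢ Icc c d)) (hw : ContinuousOn w (Icc a b ×ˢ Icc c d))
    (hvw : ∀ x ∈ Icc a b, ∀ y ∈ Icc c d,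
      HasDerivWithinAt (fun y => v (x, y)) (w (x, y)) (Icc c d) y)
    (hvw' : ∀ x ∈ Icc a b, ∀ y ∈ Icc c d,
      HasDerivWithinAt (fun y => v' (x, y)) (w' (x, y)) (Icc c d) y)
    {y : ℝ} (hy : y ∈ Icc c d) :
    HasDerivWithinAt (stripFunctional e W p q v v') (stripFunctional e W p q w w' y)
      (Icc c d) y := by
  have hm : ∀ s ∈ Icc (-1 : ℝ) 1, fromRef p q s ∈ Icc a b := fun s hs => hsub (fromRef_mem hpq hs)
  have h1 : ∀ s ∈ Icc (-1 : ℝ) 1, ∀ y ∈ Icc c d,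
      HasDerivWithinAt (fun y => v (fromRef p q s, y)) (w (fromRef p q s, y)) (Icc c d) y :=
    fun s hs y hy => hvw _ (hm s hs) y hy
  have h2 : ∀ s ∈ Icc (-1 : ℝ) 1, ∀ y ∈ Icc c d, HasDerivWithinAt
      (fun y => (q - p) / 2 * v' (fromRef p q s, y)) ((q - p) / 2 * w' (fromRef p q s, y))
      (Icc c d) y := fun s hs y hy => (hvw' _ (hm s hs) y hy).const_mul _
  have hst := hasDerivWithinAt_integral_strip (p := -1) (q := 1) (by norm_num) hcd.le
    (w := fun P => v (fromRef p q P.1, P.2) * W.eval P.1)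
    (w' := fun P => w (fromRef p q P.1, P.2) * W.eval P.1)
    ((hv.comp (((continuous_fromRef p q).comp continuous_fst).prodMk continuous_snd).continuousOn
      fun P hP => ⟨hm _ hP.1, hP.2⟩).mul (W.continuous.comp continuous_fst).continuousOn)
    ((hw.comp (((continuous_fromRef p q).comp continuous_fst).prodMk continuous_snd).continuousOn
      fun P hP => ⟨hm _ hP.1, hP.2⟩).mul (W.continuous.comp continuous_fst).continuousOn)
    (fun s hs t ht => (h1 s hs t ht).mul_const (W.eval s)) hy
  exact (((((h1 _ (by norm_num) y hy).const_mul _).add ((h1 _ (by norm_num) y hy).const_mul _)).add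
    ((h2 _ (by norm_num) y hy).const_mul _)).add ((h2 _ (by norm_num) y hy).const_mul _)).add hst

end strip

/-! ### Coefficients of C² functions on the mesh -/

namespace RectMesh

variable {a b c d : ℝ} (T : RectMesh a b c d)

theorem x_mono {i j : ℕ} (hij : i ≤ j) (hj : j ≤ T.M) : T.x i ≤ T.x j := by
  induction j, hij using Nat.le_induction with
  | base => exact le_rfl
  | succ j hij ih => exact (ih (by omega)).trans (T.x_lt j (by omega)).le

theorem y_mono {i j : ℕ} (hij : i ≤ j) (hj : j ≤ T.N) : T.y i ≤ T.y j := by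
  induction j, hij using Nat.le_induction with
  | base => exact le_rfl
  | succ j hij ih => exact (ih (by omega)).trans (T.y_lt j (by omega)).le

theorem x_mem {i : ℕ} (hi : i ≤ T.M) : T.x i ∈ Icc a b :=
  ⟨T.x_zero.symm.le.trans (T.x_mono (Nat.zero_le i) hi), (T.x_mono hi le_rfl).trans T.x_last.le⟩

theorem y_mem {j : ℕ} (hj : j ≤ T.N) : T.y j ∈ Icc c d :=
  ⟨T.y_zero.symm.le.trans (T.y_mono (Nat.zero_le j) hj), (T.y_mono hj le_rfl).trans T.y_last.le⟩

theorem x_sub {i : ℕ} (hi : i < T.M) : Icc (T.x i) (T.x (i + 1)) ⊆ Icc a b :=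
  Icc_subset_Icc (T.x_mem hi.le).1 (T.x_mem hi).2

theorem y_sub {j : ℕ} (hj : j < T.N) : Icc (T.y j) (T.y (j + 1)) ⊆ Icc c d :=
  Icc_subset_Icc (T.y_mem hj.le).1 (T.y_mem hj).2

include T in
theorem a_lt_b : a < b :=
  (T.x_mem T.M_pos.le).1.trans_lt ((T.x_lt 0 T.M_pos).trans_le (T.x_mem T.M_pos).2)

include T in
theorem c_lt_d : c < d :=
  (T.y_mem T.N_pos.le).1.trans_lt ((T.y_lt 0 T.N_pos).trans_le (T.y_mem T.N_pos).2)

theorem elem_subset {i j : ℕ} (hi : i < T.M) (hj : j < T.N) : T.elem i j ⊆ Icc a b ×ˢ Icc c d :=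
  prod_mono (T.x_sub hi) (T.y_sub hj)

variable {u : ℝ × ℝ → ℝ} (hu : ContDiffOn ℝ 2 u (Icc a b ×ˢ Icc c d))
include hu

theorem jacobiCoeff_strip {e : Fin 4 → ℝ} {W : ℝ[X]} {p : ℕ}
    (hp : ∀ v : ℝ → ℝ, ContinuousOn v (Icc (-1) 1) →
      jacobiCoeff p v = endpointFunctional e W v (derivWithin v (Icc (-1) 1)))
    {i : ℕ} (hi : i < T.M) {y : ℝ} (hy : y ∈ Icc c d) :
    jacobiCoeff p (fun s => u (fromRef (T.x i) (T.x (i + 1)) s, y)) =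
      stripFunctional e W (T.x i) (T.x (i + 1)) u (dX a b u) y := by
  rw [hp _ (continuousOn_comp_fromRef_fst (T.x_lt i hi) (T.x_sub hi) hu.continuousOn hy)]
  refine endpointFunctional_congr _ _ (fun s _ => rfl) fun s hs => ?_
  exact derivWithin_comp_fromRef (g := fun x => u (x, y)) (T.x_lt i hi) (T.x_sub hi) hs
    (hasDerivWithinAt_dX (hu.differentiableOn (by norm_num))
      (T.x_sub hi (fromRef_mem (T.x_lt i hi) hs)) hy)

/-- The inner coefficient involves u and u_x only. Differentiation in y replaces them by u_y and ∂_y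
u_x, both available for a C² function, up to the boundary. -/
theorem hasDerivWithinAt_jacobiCoeff_strip {e : Fin 4 → ℝ} {W : ℝ[X]} {p : ℕ}
    (hp : ∀ v : ℝ → ℝ, ContinuousOn v (Icc (-1) 1) →
      jacobiCoeff p v = endpointFunctional e W v (derivWithin v (Icc (-1) 1)))
    {i : ℕ} (hi : i < T.M) {y : ℝ} (hy : y ∈ Icc c d) :
    HasDerivWithinAt (fun y => jacobiCoeff p fun s => u (fromRef (T.x i) (T.x (i + 1)) s, y))
      (stripFunctional e W (T.x i) (T.x (i + 1)) (dY c d u) (dY c d (dX a b u)) y)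
      (Icc c d) y := by
  have hX : ContDiffOn ℝ 1 (dX a b u) (Icc a b ×ˢ Icc c d) :=
    contDiffOn_dX T.a_lt_b T.c_lt_d hu (by norm_num)
  have hY : ContDiffOn ℝ 1 (dY c d u) (Icc a b ×ˢ Icc c d) :=
    contDiffOn_dY T.a_lt_b T.c_lt_d hu (by norm_num)
  refine (hasDerivWithinAt_stripFunctional (T.x_lt i hi) (T.x_sub hi) e W T.c_lt_d
    hu.continuousOn hY.continuousOn
    (fun x hx y hy => hasDerivWithinAt_dY (hu.differentiableOn (by norm_num)) hx hy)
    (fun x hx y hy => hasDerivWithinAt_dY (hX.differentiableOn (by norm_num)) hx hy) hy).congr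
    (fun y hy => T.jacobiCoeff_strip hu hp hi hy) (T.jacobiCoeff_strip hu hp hi hy)

/-- Although two coefficient functionals are composed, no derivative of u beyond ∂_y u_x occurs.
Convergence of u, its gradient and this mixed derivative is therefore enough for convergence of the
projection. -/
theorem coeff_eq {e e' : Fin 4 → ℝ} {W W' : ℝ[X]} {p q : ℕ}
    (hp : ∀ v : ℝ → ℝ, ContinuousOn v (Icc (-1) 1) →
      jacobiCoeff p v = endpointFunctional e W v (derivWithin v (Icc (-1) 1)))
    (hq : ∀ v : ℝ → ℝ, ContinuousOn v (Icc (-1) 1) →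
      jacobiCoeff q v = endpointFunctional e' W' v (derivWithin v (Icc (-1) 1)))
    {i j : ℕ} (hi : i < T.M) (hj : j < T.N) :
    T.coeff u i j p q = endpointFunctional e' W'
      (fun t => stripFunctional e W (T.x i) (T.x (i + 1)) u (dX a b u)
        (fromRef (T.y j) (T.y (j + 1)) t))
      fun t => (T.y (j + 1) - T.y j) / 2 * stripFunctional e W (T.x i) (T.x (i + 1)) (dY c d u)
        (dY c d (dX a b u)) (fromRef (T.y j) (T.y (j + 1)) t) := by
  have hd : ∀ y ∈ Icc c d, _ := fun y hy => T.hasDerivWithinAt_jacobiCoeff_strip hu hp hi hy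
  have hm : ∀ t ∈ Icc (-1 : ℝ) 1, fromRef (T.y j) (T.y (j + 1)) t ∈ Icc c d := fun t ht =>
    T.y_sub hj (fromRef_mem (T.y_lt j hj) ht)
  rw [coeff, hq]
  · refine endpointFunctional_congr _ _ (fun t ht => T.jacobiCoeff_strip hu hp hi (hm t ht))
      fun t ht => ?_
    exact derivWithin_comp_fromRef (g := fun y => jacobiCoeff p fun s =>
      u (fromRef (T.x i) (T.x (i + 1)) s, y)) (T.y_lt j hj) (T.y_sub hj) ht (hd _ (hm t ht))
  · have hc : ContinuousOn (fun y => jacobiCoeff p fun s => u (fromRef (T.x i) (T.x (i + 1)) s, y))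
      (Icc c d) := fun y hy => (hd y hy).continuousWithinAt
    exact hc.comp (continuous_fromRef _ _).continuousOn hm

omit hu in
/-- The Jacobi coefficients depend continuously on the function in the `C²` norm. -/
theorem exists_coeff_sub_bound {i j : ℕ} (hi : i < T.M) (hj : j < T.N) (p q : ℕ) :
    ∃ C : ℝ, ∀ (u w : ℝ × ℝ → ℝ) (η : ℝ), ContDiffOn ℝ 2 u (Icc a b ×ˢ Icc c d) →
      ContDiffOn ℝ 2 w (Icc a b ×ˢ Icc c d) →
      (∀ P ∈ Icc a b ×ˢ Icc c d, |u P - w P| ≤ η) →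
      (∀ P ∈ Icc a b ×ˢ Icc c d, |dX a b u P - dX a b w P| ≤ η) →
      (∀ P ∈ Icc a b ×ˢ Icc c d, |dY c d u P - dY c d w P| ≤ η) →
      (∀ P ∈ Icc a b ×ˢ Icc c d, |dY c d (dX a b u) P - dY c d (dX a b w) P| ≤ η) →
      |T.coeff u i j p q - T.coeff w i j p q| ≤ C * η := by
  obtain ⟨e, W, hp⟩ := exists_jacobiCoeff_eq p
  obtain ⟨e', W', hq⟩ := exists_jacobiCoeff_eq q
  obtain ⟨C, hC0, hC⟩ := endpointFunctional_bound e W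
  obtain ⟨C', hC0', hC'⟩ := endpointFunctional_bound e' W'
  have hx := T.x_lt i hi
  have hy := T.y_lt j hj
  set hx' := (T.x (i + 1) - T.x i) / 2 with hhx
  set hy' := (T.y (j + 1) - T.y j) / 2 with hhy
  have hx0 : 0 < hx' := by rw [hhx]; linarith
  have hy0 : 0 < hy' := by rw [hhy]; linarith
  have hm : ∀ t ∈ Icc (-1 : ℝ) 1, fromRef (T.y j) (T.y (j + 1)) t ∈ Icc c d := fun t ht =>
    T.y_sub hj (fromRef_mem hy ht)
  have hmx : ∀ t ∈ Icc (-1 : ℝ) 1, fromRef (T.x i) (T.x (i + 1)) t ∈ Icc a b := fun t ht =>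
    T.x_sub hi (fromRef_mem hx ht)
  have strip : ∀ (v v' w w' : ℝ × ℝ → ℝ) (η : ℝ), ContinuousOn v (Icc a b ×ˢ Icc c d) →
      ContinuousOn w (Icc a b ×ˢ Icc c d) → (∀ P ∈ Icc a b ×ˢ Icc c d, |v P - w P| ≤ η) →
      (∀ P ∈ Icc a b ×ˢ Icc c d, |v' P - w' P| ≤ η) → ∀ y ∈ Icc c d,
      |stripFunctional e W (T.x i) (T.x (i + 1)) v v' y -
        stripFunctional e W (T.x i) (T.x (i + 1)) w w' y| ≤ C * ((1 + hx') * η) := by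
    intro v v' w w' η hv hw h h' y hy
    have hη : 0 ≤ η := (abs_nonneg _).trans (h (a, c)
      ⟨⟨le_rfl, T.a_lt_b.le⟩, ⟨le_rfl, T.c_lt_d.le⟩⟩)
    rw [stripFunctional, stripFunctional, ← endpointFunctional_sub _ _
      (continuousOn_comp_fromRef_fst hx (T.x_sub hi) hv hy)
      (continuousOn_comp_fromRef_fst hx (T.x_sub hi) hw hy)]
    refine hC _ _ _ (fun s hs => (h (fromRef (T.x i) (T.x (i + 1)) s, y) ⟨hmx s hs, hy⟩).trans
      (by nlinarith)) fun s hs => ?_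
    rw [← mul_sub, abs_mul, abs_of_pos hx0]
    have := h' (fromRef (T.x i) (T.x (i + 1)) s, y) ⟨hmx s hs, hy⟩
    nlinarith
  refine ⟨C' * ((1 + hy') * (C * (1 + hx'))), ?_⟩
  intro u w η hu hw h0 hX hY hXY
  have hη : 0 ≤ η := (abs_nonneg _).trans (h0 (a, c)
      ⟨⟨le_rfl, T.a_lt_b.le⟩, ⟨le_rfl, T.c_lt_d.le⟩⟩)
  have c1 : ∀ {u : ℝ × ℝ → ℝ}, ContDiffOn ℝ 2 u (Icc a b ×ˢ Icc c d) →
      ContinuousOn (fun t => stripFunctional e W (T.x i) (T.x (i + 1)) u (dX a b u)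
        (fromRef (T.y j) (T.y (j + 1)) t)) (Icc (-1) 1) := by
    intro u hu
    have hc : ContinuousOn (stripFunctional e W (T.x i) (T.x (i + 1)) u (dX a b u)) (Icc c d) := by
      refine ContinuousOn.congr (f := fun y => jacobiCoeff p fun s =>
        u (fromRef (T.x i) (T.x (i + 1)) s, y)) (fun y hy =>
        (T.hasDerivWithinAt_jacobiCoeff_strip hu hp hi hy).continuousWithinAt) fun y hy =>
        (T.jacobiCoeff_strip hu hp hi hy).symm
    exact hc.comp (continuous_fromRef _ _).continuousOn hm
  rw [T.coeff_eq hu hp hq hi hj, T.coeff_eq hw hp hq hi hj,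
    ← endpointFunctional_sub _ _ (c1 hu) (c1 hw)]
  have hYc : ∀ {u : ℝ × ℝ → ℝ}, ContDiffOn ℝ 2 u (Icc a b ×ˢ Icc c d) →
      ContinuousOn (dY c d u) (Icc a b ×ˢ Icc c d) := fun hu =>
    (contDiffOn_dY (m := 1) T.a_lt_b T.c_lt_d hu (by norm_num)).continuousOn
  set B := C * ((1 + hx') * η) with hB
  have hB0 : 0 ≤ B := by positivity
  refine (hC' _ _ ((1 + hy') * B) (fun t ht => ?_) fun t ht => ?_).trans_eq (by rw [hB]; ring)
  · have := strip u (dX a b u) w (dX a b w) η hu.continuousOn hw.continuousOn h0 hX _ (hm t ht)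
    nlinarith
  · rw [← mul_sub, abs_mul, abs_of_pos hy0]
    have := strip (dY c d u) (dY c d (dX a b u)) (dY c d w) (dY c d (dX a b w)) η (hYc hu)
      (hYc hw) hY hXY _ (hm t ht)
    nlinarith

end RectMesh

/-! ### Gluing of the local projections -/

theorem iterate_derivative_jacobiNeg_eval_one {m : ℕ} (hm : m ≤ 1) (p : ℕ) :
    (derivative^[m] (jacobiNeg p)).eval 1 = if p = 2 * m + 1 then 1 else 0 := by
  interval_cases m
  · exact jacobiNeg_eval_one p
  · exact derivative_jacobiNeg_eval_one p

theorem iterate_derivative_jacobiNeg_eval_neg_one {m : ℕ} (hm : m ≤ 1) (p : ℕ) :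
    (derivative^[m] (jacobiNeg p)).eval (-1) = if p = 2 * m then 1 else 0 := by
  interval_cases m
  · exact jacobiNeg_eval_neg_one p
  · exact derivative_jacobiNeg_eval_neg_one p

theorem toRef_left (p q : ℝ) (h : p < q) : toRef p q p = -1 := by
  have := toRef_fromRef h (-1)
  rwa [fromRef_neg_one] at this

theorem toRef_right (p q : ℝ) (h : p < q) : toRef p q q = 1 := by
  have := toRef_fromRef h 1
  rwa [fromRef_one] at this

namespace RectMesh

variable {a b c d : ℝ} (T : RectMesh a b c d)

/-- The smallest index of a mesh interval in the `x`-direction that contains `x`. -/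
noncomputable def xIdx (x : ℝ) : ℕ := sInf {i | x ≤ T.x (i + 1)}

/-- The smallest index of a mesh interval in the `y`-direction that contains `y`. -/
noncomputable def yIdx (y : ℝ) : ℕ := sInf {j | y ≤ T.y (j + 1)}

/-- The left inequality is the minimality of the index; the last interval shows that the set of
admissible indices is nonempty. -/
theorem xIdx_spec {x : ℝ} (hx : x ∈ Icc a b) :
    T.xIdx x < T.M ∧ x ∈ Icc (T.x (T.xIdx x)) (T.x (T.xIdx x + 1)) := by
  have hM := T.M_pos
  have hmem : T.M - 1 ∈ {i | x ≤ T.x (i + 1)} := by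
    rw [mem_ofPred_eq, Nat.sub_add_cancel hM, T.x_last]; exact hx.2
  have h1 : T.xIdx x ∈ {i | x ≤ T.x (i + 1)} := Nat.sInf_mem ⟨_, hmem⟩
  have h2 : T.xIdx x ≤ T.M - 1 := Nat.sInf_le hmem
  refine ⟨by omega, ?_, h1⟩
  rcases Nat.eq_zero_or_pos (T.xIdx x) with h0 | h0
  · rw [h0, T.x_zero]; exact hx.1
  · by_contra! hlt
    have : T.xIdx x ≤ T.xIdx x - 1 := Nat.sInf_le (by
      rw [mem_ofPred_eq, Nat.sub_add_cancel h0]; exact hlt.le)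
    omega

theorem yIdx_spec {y : ℝ} (hy : y ∈ Icc c d) :
    T.yIdx y < T.N ∧ y ∈ Icc (T.y (T.yIdx y)) (T.y (T.yIdx y + 1)) := by
  have hN := T.N_pos
  have hmem : T.N - 1 ∈ {j | y ≤ T.y (j + 1)} := by
    rw [mem_ofPred_eq, Nat.sub_add_cancel hN, T.y_last]; exact hy.2
  have h1 : T.yIdx y ∈ {j | y ≤ T.y (j + 1)} := Nat.sInf_mem ⟨_, hmem⟩
  have h2 : T.yIdx y ≤ T.N - 1 := Nat.sInf_le hmem
  refine ⟨by omega, ?_, h1⟩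
  rcases Nat.eq_zero_or_pos (T.yIdx y) with h0 | h0
  · rw [h0, T.y_zero]; exact hy.1
  · by_contra! hlt
    have : T.yIdx y ≤ T.yIdx y - 1 := Nat.sInf_le (by
      rw [mem_ofPred_eq, Nat.sub_add_cancel h0]; exact hlt.le)
    omega

theorem eq_or_adjacent_x {i i' : ℕ} (hi' : i' < T.M) (h : i ≤ i') {x : ℝ}
    (hx : x ∈ Icc (T.x i) (T.x (i + 1))) (hx' : x ∈ Icc (T.x i') (T.x (i' + 1))) :
    i = i' ∨ (i' = i + 1 ∧ x = T.x (i + 1)) := by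
  rcases h.eq_or_lt with h | h
  · exact Or.inl h
  right
  have h1 : T.x (i + 1) ≤ T.x i' := T.x_mono h hi'.le
  have h2 : x = T.x (i + 1) := le_antisymm hx.2 (h1.trans hx'.1)
  refine ⟨?_, h2⟩
  by_contra hne
  have h3 : T.x (i + 1) < T.x (i + 1 + 1) := T.x_lt _ (by omega)
  have h4 : T.x (i + 1 + 1) ≤ T.x i' := T.x_mono (by omega) hi'.le
  linarith [hx'.1]

theorem eq_or_adjacent_y {j j' : ℕ} (hj' : j' < T.N) (h : j ≤ j') {y : ℝ}
    (hy : y ∈ Icc (T.y j) (T.y (j + 1))) (hy' : y ∈ Icc (T.y j') (T.y (j' + 1))) :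
    j = j' ∨ (j' = j + 1 ∧ y = T.y (j + 1)) := by
  rcases h.eq_or_lt with h | h
  · exact Or.inl h
  right
  have h1 : T.y (j + 1) ≤ T.y j' := T.y_mono h hj'.le
  have h2 : y = T.y (j + 1) := le_antisymm hy.2 (h1.trans hy'.1)
  refine ⟨?_, h2⟩
  by_contra hne
  have h3 : T.y (j + 1) < T.y (j + 1 + 1) := T.y_lt _ (by omega)
  have h4 : T.y (j + 1 + 1) ≤ T.y j' := T.y_mono (by omega) hj'.le
  linarith [hy'.1]

section traces

variable {k : ℕ} (u : ℝ × ℝ → ℝ) (i j m n : ℕ)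

/-- On an edge only one basis polynomial has a nonzero m-th derivative for m ≤ 1, so the double sum
collapses to a sum along the edge. The same holds for the other three sides. -/
theorem localDeriv_right (hk : 3 ≤ k) (hi : i < T.M) (hm : m ≤ 1) (y : ℝ) :
    T.localDeriv k u i j m n (T.x (i + 1), y) = ∑ q ∈ Finset.range (k + 1),
      (T.coeff u i j (2 * m + 1) q * (2 / (T.x (i + 1) - T.x i)) ^ m) *
      ((2 / (T.y (j + 1) - T.y j)) ^ n *
        (derivative^[n] (jacobiNeg q)).eval (toRef (T.y j) (T.y (j + 1)) y)) := by
  rw [localDeriv, Finset.sum_comm]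
  refine Finset.sum_congr rfl fun q _ => ?_
  rw [← Finset.sum_mul]
  congr 1
  simp only [toRef_right _ _ (T.x_lt i hi), iterate_derivative_jacobiNeg_eval_one hm, mul_ite,
    mul_one, mul_zero, Finset.sum_ite_eq', Finset.mem_range]
  rw [if_pos (by omega)]

theorem localDeriv_left (hk : 3 ≤ k) (hi : i < T.M) (hm : m ≤ 1) (y : ℝ) :
    T.localDeriv k u i j m n (T.x i, y) = ∑ q ∈ Finset.range (k + 1),
      (T.coeff u i j (2 * m) q * (2 / (T.x (i + 1) - T.x i)) ^ m) *
      ((2 / (T.y (j + 1) - T.y j)) ^ n *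
        (derivative^[n] (jacobiNeg q)).eval (toRef (T.y j) (T.y (j + 1)) y)) := by
  rw [localDeriv, Finset.sum_comm]
  refine Finset.sum_congr rfl fun q _ => ?_
  rw [← Finset.sum_mul]
  congr 1
  simp only [toRef_left _ _ (T.x_lt i hi), iterate_derivative_jacobiNeg_eval_neg_one hm, mul_ite,
    mul_one, mul_zero, Finset.sum_ite_eq', Finset.mem_range]
  rw [if_pos (by omega)]

theorem localDeriv_top (hk : 3 ≤ k) (hj : j < T.N) (hn : n ≤ 1) (x : ℝ) :
    T.localDeriv k u i j m n (x, T.y (j + 1)) = ∑ p ∈ Finset.range (k + 1),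
      (T.coeff u i j p (2 * n + 1) * (2 / (T.y (j + 1) - T.y j)) ^ n) *
      ((2 / (T.x (i + 1) - T.x i)) ^ m *
        (derivative^[m] (jacobiNeg p)).eval (toRef (T.x i) (T.x (i + 1)) x)) := by
  rw [localDeriv]
  refine Finset.sum_congr rfl fun p _ => ?_
  simp only [toRef_right _ _ (T.y_lt j hj), iterate_derivative_jacobiNeg_eval_one hn, mul_ite,
    mul_one, mul_zero, Finset.sum_ite_eq', Finset.mem_range]
  rw [if_pos (by omega)]
  ring

theorem localDeriv_bottom (hk : 3 ≤ k) (hj : j < T.N) (hn : n ≤ 1) (x : ℝ) :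
    T.localDeriv k u i j m n (x, T.y j) = ∑ p ∈ Finset.range (k + 1),
      (T.coeff u i j p (2 * n) * (2 / (T.y (j + 1) - T.y j)) ^ n) *
      ((2 / (T.x (i + 1) - T.x i)) ^ m *
        (derivative^[m] (jacobiNeg p)).eval (toRef (T.x i) (T.x (i + 1)) x)) := by
  rw [localDeriv]
  refine Finset.sum_congr rfl fun p _ => ?_
  simp only [toRef_left _ _ (T.y_lt j hj), iterate_derivative_jacobiNeg_eval_neg_one hn, mul_ite,
    mul_one, mul_zero, Finset.sum_ite_eq', Finset.mem_range]
  rw [if_pos (by omega)]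
  ring

end traces

theorem two_div_mul_half {h z : ℝ} (hh : h ≠ 0) : h / 2 * z * (2 / h) = z := by
  field_simp

section C2

variable {u : ℝ × ℝ → ℝ} (hu : ContDiffOn ℝ 2 u (Icc a b ×ˢ Icc c d))
include hu

/-- The slope coefficients in x are, up to the chain-rule factor, the coefficients of u_x along a
vertical edge, which two neighbours have in common. -/
theorem coeff_x_deriv {i j : ℕ} (hi : i < T.M) (hj : j < T.N) (q : ℕ) :
    T.coeff u i j 2 q = (T.x (i + 1) - T.x i) / 2 *
        jacobiCoeff q (fun t => dX a b u (T.x i, fromRef (T.y j) (T.y (j + 1)) t)) ∧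
      T.coeff u i j 3 q = (T.x (i + 1) - T.x i) / 2 *
        jacobiCoeff q (fun t => dX a b u (T.x (i + 1), fromRef (T.y j) (T.y (j + 1)) t)) := by
  have key : ∀ s ∈ Icc (-1 : ℝ) 1, ∀ t ∈ Icc (-1 : ℝ) 1,
      derivWithin (fun s => u (fromRef (T.x i) (T.x (i + 1)) s, fromRef (T.y j) (T.y (j + 1)) t))
        (Icc (-1) 1) s = (T.x (i + 1) - T.x i) / 2 *
        dX a b u (fromRef (T.x i) (T.x (i + 1)) s, fromRef (T.y j) (T.y (j + 1)) t) := by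
    intro s hs t ht
    exact derivWithin_comp_fromRef
      (g := fun x => u (x, fromRef (T.y j) (T.y (j + 1)) t)) (T.x_lt i hi) (T.x_sub hi) hs
      (hasDerivWithinAt_dX (hu.differentiableOn (by norm_num))
        (T.x_sub hi (fromRef_mem (T.x_lt i hi) hs)) (T.y_sub hj (fromRef_mem (T.y_lt j hj) ht)))
  constructor
  · rw [← jacobiCoeff_const_mul]
    refine jacobiCoeff_congr q fun t ht => ?_
    have := key (-1) (by norm_num) t ht
    rwa [fromRef_neg_one] at this
  · rw [← jacobiCoeff_const_mul]
    refine jacobiCoeff_congr q fun t ht => ?_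
    have := key 1 (by norm_num) t ht
    rwa [fromRef_one] at this

theorem coeff_x_adjacent {i j m : ℕ} (hm : m ≤ 1) (hi : i + 1 < T.M) (hj : j < T.N) (q : ℕ) :
    T.coeff u i j (2 * m + 1) q * (2 / (T.x (i + 1) - T.x i)) ^ m =
      T.coeff u (i + 1) j (2 * m) q * (2 / (T.x (i + 1 + 1) - T.x (i + 1))) ^ m := by
  interval_cases m
  · simp only [coeff, jacobiCoeff, pow_zero, mul_one, fromRef_one, fromRef_neg_one]
  · have h1 := T.x_lt i (by omega)
    have h2 := T.x_lt (i + 1) hi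
    simp only [mul_one, pow_one]
    rw [(T.coeff_x_deriv hu (by omega) hj q).2, (T.coeff_x_deriv hu hi hj q).1,
      two_div_mul_half (by linarith), two_div_mul_half (by linarith)]

/-- Here the slope is taken by the outer functional, after integration in x. Both neighbours
differentiate the same function of y on [c, d] at the same point, and its derivative within [c, d]
exists. -/
theorem coeff_y_adjacent {i j n : ℕ} (hn : n ≤ 1) (hi : i < T.M) (hj : j + 1 < T.N) (p : ℕ) :
    T.coeff u i j p (2 * n + 1) * (2 / (T.y (j + 1) - T.y j)) ^ n =
      T.coeff u i (j + 1) p (2 * n) * (2 / (T.y (j + 1 + 1) - T.y (j + 1))) ^ n := by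
  interval_cases n
  · simp only [coeff, jacobiCoeff, pow_zero, mul_one, fromRef_one, fromRef_neg_one]
  · have h1 := T.y_lt j (by omega)
    have h2 := T.y_lt (j + 1) hj
    obtain ⟨e, W, hp⟩ := exists_jacobiCoeff_eq p
    have hd := fun y hy => T.hasDerivWithinAt_jacobiCoeff_strip hu hp hi (y := y) hy
    have e1 : T.coeff u i j p 3 = _ := derivWithin_comp_fromRef (g := fun y => jacobiCoeff p fun s =>
      u (fromRef (T.x i) (T.x (i + 1)) s, y)) h1 (T.y_sub (by omega)) (t := 1) (by norm_num)
      (hd _ (by rw [fromRef_one]; exact T.y_mem (by omega)))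
    have e2 : T.coeff u i (j + 1) p 2 = _ := derivWithin_comp_fromRef
      (g := fun y => jacobiCoeff p fun s => u (fromRef (T.x i) (T.x (i + 1)) s, y)) h2
      (T.y_sub (by omega)) (t := -1) (by norm_num)
      (hd _ (by rw [fromRef_neg_one]; exact T.y_mem (by omega)))
    simp only [mul_one, pow_one]
    rw [e1, e2, two_div_mul_half (by linarith), two_div_mul_half (by linarith), fromRef_one,
      fromRef_neg_one]

theorem localDeriv_congr_x {k : ℕ} (hk : 3 ≤ k) {i i' j m : ℕ} (hm : m ≤ 1) (n : ℕ) (hi : i < T.M)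
    (hi' : i' < T.M) (hj : j < T.N) {P : ℝ × ℝ} (hP : P.1 ∈ Icc (T.x i) (T.x (i + 1)))
    (hP' : P.1 ∈ Icc (T.x i') (T.x (i' + 1))) :
    T.localDeriv k u i j m n P = T.localDeriv k u i' j m n P := by
  wlog h : i ≤ i' generalizing i i'
  · exact (this hi' hi hP' hP (by omega)).symm
  rcases T.eq_or_adjacent_x hi' h hP hP' with rfl | ⟨rfl, h2⟩
  · rfl
  obtain ⟨x, y⟩ := P
  simp only at h2
  rw [h2, T.localDeriv_right u i j m n hk hi hm, T.localDeriv_left u (i + 1) j m n hk hi' hm]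
  simp only [T.coeff_x_adjacent hu hm hi' hj]

theorem localDeriv_congr_y {k : ℕ} (hk : 3 ≤ k) {i j j' n : ℕ} (m : ℕ) (hn : n ≤ 1) (hi : i < T.M)
    (hj : j < T.N) (hj' : j' < T.N) {P : ℝ × ℝ} (hP : P.2 ∈ Icc (T.y j) (T.y (j + 1)))
    (hP' : P.2 ∈ Icc (T.y j') (T.y (j' + 1))) :
    T.localDeriv k u i j m n P = T.localDeriv k u i j' m n P := by
  wlog h : j ≤ j' generalizing j j'
  · exact (this hj' hj hP' hP (by omega)).symm
  rcases T.eq_or_adjacent_y hj' h hP hP' with rfl | ⟨rfl, h2⟩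
  · rfl
  obtain ⟨x, y⟩ := P
  simp only at h2
  rw [h2, T.localDeriv_top u i j m n hk hj hn, T.localDeriv_bottom u i (j + 1) m n hk hj' hn]
  simp only [T.coeff_y_adjacent hu hn hi hj']

/-- Go first along the row and then along the column; the intermediate element with indices `i'`,
`j` also contains the point, so elements that meet only in a corner are covered. -/
theorem localDeriv_congr {k : ℕ} (hk : 3 ≤ k) {i i' j j' m n : ℕ} (hm : m ≤ 1) (hn : n ≤ 1)
    (hi : i < T.M) (hi' : i' < T.M) (hj : j < T.N) (hj' : j' < T.N) {P : ℝ × ℝ}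
    (hP : P ∈ T.elem i j) (hP' : P ∈ T.elem i' j') :
    T.localDeriv k u i j m n P = T.localDeriv k u i' j' m n P :=
  (T.localDeriv_congr_x hu hk hm n hi hi' hj hP.1 hP'.1).trans
    (T.localDeriv_congr_y hu hk m hn hi' hj hj' hP.2 hP'.2)

/-- On every closed element the projection is given by the local expansion. -/
theorem proj_eq_localProj {k : ℕ} (hk : 3 ≤ k) {i j : ℕ} (hi : i < T.M) (hj : j < T.N) {P : ℝ × ℝ}
    (hP : P ∈ T.elem i j) : T.proj k u P = T.localProj k u i j P := by
  have hR := T.elem_subset hi hj hP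
  obtain ⟨h1, h2⟩ := T.xIdx_spec hR.1
  obtain ⟨h3, h4⟩ := T.yIdx_spec hR.2
  rw [← T.localDeriv_zero_zero]
  refine Eq.trans ?_ (T.localDeriv_congr hu hk zero_le_one zero_le_one h1 hi h3 hj ⟨h2, h4⟩ hP)
  rw [T.localDeriv_zero_zero]
  rfl

end C2

theorem exists_mem_elem {P : ℝ × ℝ} (hP : P ∈ Icc a b ×ˢ Icc c d) :
    ∃ i < T.M, ∃ j < T.N, P ∈ T.elem i j := by
  obtain ⟨h1, h2⟩ := T.xIdx_spec hP.1
  obtain ⟨h3, h4⟩ := T.yIdx_spec hP.2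
  exact ⟨_, h1, _, h3, h2, h4⟩

/-! ### Derivatives of the local expansions and C¹ regularity of the projection -/

section derivatives

variable (k : ℕ) (u : ℝ × ℝ → ℝ) (i j m n : ℕ)

theorem hasDerivAt_eval_toRef (q : ℝ[X]) (p p' x : ℝ) :
    HasDerivAt (fun x => (2 / (p' - p)) ^ m * (derivative^[m] q).eval (toRef p p' x))
      ((2 / (p' - p)) ^ (m + 1) * (derivative^[m + 1] q).eval (toRef p p' x)) x := by
  have h1 := (((derivative^[m] q).hasDerivAt (toRef p p' x)).comp x
    (hasDerivAt_toRef x)).const_mul ((2 / (p' - p)) ^ m)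
  rw [← Function.iterate_succ_apply' (f := ⇑(derivative (R := ℝ)))] at h1
  exact h1.congr_deriv (by rw [pow_succ, Nat.succ_eq_add_one]; ring)

theorem hasDerivAt_localDeriv_fst (x y : ℝ) :
    HasDerivAt (fun x => T.localDeriv k u i j m n (x, y))
      (T.localDeriv k u i j (m + 1) n (x, y)) x := by
  simp only [localDeriv]
  refine HasDerivAt.fun_sum fun p _ => HasDerivAt.fun_sum fun q _ => ?_
  exact ((hasDerivAt_eval_toRef m (jacobiNeg p) (T.x i) (T.x (i + 1)) x).const_mul _).mul_const _

theorem hasDerivAt_localDeriv_snd (x y : ℝ) :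
    HasDerivAt (fun y => T.localDeriv k u i j m n (x, y))
      (T.localDeriv k u i j m (n + 1) (x, y)) y := by
  simp only [localDeriv]
  refine HasDerivAt.fun_sum fun p _ => HasDerivAt.fun_sum fun q _ => ?_
  exact (hasDerivAt_eval_toRef n (jacobiNeg q) (T.y j) (T.y (j + 1)) y).const_mul _

theorem contDiff_localDeriv : ContDiff ℝ ∞ (T.localDeriv k u i j m n) := by
  have h : ∀ p p' : ℝ, ContDiff ℝ ∞ (toRef p p') := fun p p' => by
    have : toRef p p' = fun x => (2 * x - p' - p) / (p' - p) := rfl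
    rw [this]; fun_prop
  unfold localDeriv
  refine ContDiff.sum fun p _ => ContDiff.sum fun q _ => ?_
  exact (contDiff_const.mul (contDiff_const.mul ((contDiff_eval _).comp
    ((h _ _).comp contDiff_fst)))).mul (contDiff_const.mul ((contDiff_eval _).comp
    ((h _ _).comp contDiff_snd)))

/-- The total derivative of the local expansion. -/
noncomputable def localFDeriv (P : ℝ × ℝ) : ℝ × ℝ →L[ℝ] ℝ :=
  T.localDeriv k u i j 1 0 P • ContinuousLinearMap.fst ℝ ℝ ℝ +
    T.localDeriv k u i j 0 1 P • ContinuousLinearMap.snd ℝ ℝ ℝ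

theorem hasFDerivAt_localProj (P : ℝ × ℝ) :
    HasFDerivAt (T.localProj k u i j) (T.localFDeriv k u i j P) P := by
  rw [← T.localDeriv_zero_zero]
  have hd := differentiable_of_smooth (T.contDiff_localDeriv k u i j 0 0) P
  have h1 : fderiv ℝ (T.localDeriv k u i j 0 0) P = T.localFDeriv k u i j P := by
    have e1 := (pdX_eq_fderiv hd).symm.trans (T.hasDerivAt_localDeriv_fst k u i j 0 0 P.1 P.2).deriv
    have e2 := (pdY_eq_fderiv hd).symm.trans (T.hasDerivAt_localDeriv_snd k u i j 0 0 P.1 P.2).deriv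
    ext
    · simp [localFDeriv, e1]
    · simp [localFDeriv, e2]
  rw [← h1]
  exact hd.hasFDerivAt

end derivatives

section C2

variable {u : ℝ × ℝ → ℝ} (hu : ContDiffOn ℝ 2 u (Icc a b ×ˢ Icc c d))

/-- The total derivative of the projection. -/
noncomputable def projFDeriv (k : ℕ) (u : ℝ × ℝ → ℝ) (P : ℝ × ℝ) : ℝ × ℝ →L[ℝ] ℝ :=
  T.localFDeriv k u (T.xIdx P.1) (T.yIdx P.2) P

include hu

theorem projFDeriv_eq {k : ℕ} (hk : 3 ≤ k) {i j : ℕ} (hi : i < T.M) (hj : j < T.N) {P : ℝ × ℝ}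
    (hP : P ∈ T.elem i j) : T.projFDeriv k u P = T.localFDeriv k u i j P := by
  have hR := T.elem_subset hi hj hP
  obtain ⟨h1, h2⟩ := T.xIdx_spec hR.1
  obtain ⟨h3, h4⟩ := T.yIdx_spec hR.2
  rw [projFDeriv, localFDeriv, localFDeriv,
    T.localDeriv_congr hu hk le_rfl zero_le_one h1 hi h3 hj ⟨h2, h4⟩ hP,
    T.localDeriv_congr hu hk zero_le_one le_rfl h1 hi h3 hj ⟨h2, h4⟩ hP]

omit hu in
theorem rect_eq_iUnion : (Icc a b ×ˢ Icc c d : Set (ℝ × ℝ)) =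
    ⋃ z : Fin T.M × Fin T.N, T.elem z.1 z.2 := by
  ext P
  simp only [mem_iUnion]
  constructor
  · intro hP
    obtain ⟨i, hi, j, hj, h⟩ := T.exists_mem_elem hP
    exact ⟨(⟨i, hi⟩, ⟨j, hj⟩), h⟩
  · rintro ⟨z, hz⟩
    exact T.elem_subset z.1.2 z.2.2 hz

omit hu in
theorem isClosed_elem (i j : ℕ) : IsClosed (T.elem i j) := isClosed_Icc.prod isClosed_Icc

/-- The rectangle is a finite union of closed elements, and derivatives within sets with a common
value pass to unions. -/
theorem hasFDerivWithinAt_proj {k : ℕ} (hk : 3 ≤ k) {P : ℝ × ℝ} :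
    HasFDerivWithinAt (T.proj k u) (T.projFDeriv k u P) (Icc a b ×ˢ Icc c d) P := by
  rw [T.rect_eq_iUnion]
  have h1 : ∀ z : Fin T.M × Fin T.N,
      HasFDerivWithinAt (T.proj k u) (T.projFDeriv k u P) (T.elem z.1 z.2) P := by
    intro z
    by_cases hP : P ∈ T.elem z.1 z.2
    · rw [T.projFDeriv_eq hu hk z.1.2 z.2.2 hP]
      exact (T.hasFDerivAt_localProj k u z.1 z.2 P).hasFDerivWithinAt.congr
        (fun Q hQ => T.proj_eq_localProj hu hk z.1.2 z.2.2 hQ)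
        (T.proj_eq_localProj hu hk z.1.2 z.2.2 hP)
    -- A closed element that misses `P` imposes no condition.
    · exact .of_notMem_closure (by rwa [(T.isClosed_elem _ _).closure_eq])
  have h2 : ∀ S : Finset (Fin T.M × Fin T.N), HasFDerivWithinAt (T.proj k u) (T.projFDeriv k u P)
      (⋃ z ∈ S, T.elem z.1 z.2) P := by
    intro S
    induction S using Finset.induction_on with
    | empty => simp [HasFDerivWithinAt.of_notMem_closure]
    | insert z S _ ih =>
      rw [Finset.set_biUnion_insert]
      exact (h1 z).union ih
  simpa using h2 Finset.univ

theorem contDiffOn_proj {k : ℕ} (hk : 3 ≤ k) :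
    ContDiffOn ℝ 1 (T.proj k u) (Icc a b ×ˢ Icc c d) := by
  have hc : ContinuousOn (T.projFDeriv k u) (Icc a b ×ˢ Icc c d) := by
    rw [T.rect_eq_iUnion]
    refine (locallyFinite_of_finite _).continuousOn_iUnion (fun z => T.isClosed_elem _ _)
      fun z => ?_
    refine ContinuousOn.congr (f := T.localFDeriv k u z.1 z.2) ?_ fun Q hQ =>
      T.projFDeriv_eq hu hk z.1.2 z.2.2 hQ
    have c1 := (T.contDiff_localDeriv k u z.1 z.2 1 0).continuous
    have c2 := (T.contDiff_localDeriv k u z.1 z.2 0 1).continuous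
    exact ((c1.smul continuous_const).add (c2.smul continuous_const)).continuousOn
  have hs := uniqueDiffOn_rect T.a_lt_b T.c_lt_d
  rw [← zero_add (1 : WithTop ℕ∞), contDiffOn_succ_iff_hasFDerivWithinAt_of_uniqueDiffOn hs]
  exact ⟨by simp, T.projFDeriv k u, contDiffOn_zero.mpr hc,
    fun P _ => T.hasFDerivWithinAt_proj hu hk⟩

theorem memV_proj {k : ℕ} (hk : 3 ≤ k) : T.MemV k (T.proj k u) := by
  refine ⟨T.contDiffOn_proj hu hk, fun i hi j hj => ?_⟩
  have hpoly : ∀ (p : ℕ) (z w : ℝ), p ≤ k → ∃ e : ℕ → ℝ, ∀ x, (jacobiNeg p).eval (toRef z w x) =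
      ∑ m ∈ Finset.range (k + 1), e m * x ^ m := by
    intro p z w hp
    -- The reference map is itself a polynomial of degree at most 1, so composition does not raise
    -- the degree; the bound 3 ≤ k covers the four cubics.
    set L : ℝ[X] := C (2 / (w - z)) * X + C (-(w + z) / (w - z)) with hL
    refine ⟨((jacobiNeg p).comp L).coeff, fun x => ?_⟩
    have h1 : toRef z w x = L.eval x := by
      simp only [hL, toRef, eval_add, eval_mul, eval_C, eval_X]
      ring
    rw [h1, ← eval_comp]
    refine eval_eq_sum_range' (Nat.lt_succ_of_le (natDegree_comp_le.trans ?_)) x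
    have h2 : L.natDegree ≤ 1 := natDegree_linear_le
    have h3 := natDegree_jacobiNeg_le p
    calc _ ≤ max p 3 * 1 := Nat.mul_le_mul h3 h2
      _ ≤ k := by omega
  choose! e he using hpoly
  refine ⟨fun m n => ∑ p ∈ Finset.range (k + 1), ∑ q ∈ Finset.range (k + 1), T.coeff u i j p q *
    e p (T.x i) (T.x (i + 1)) m * e q (T.y j) (T.y (j + 1)) n, fun P hP => ?_⟩
  rw [T.proj_eq_localProj hu hk hi hj hP, localProj]
  have h1 : ∀ p ∈ Finset.range (k + 1), ∀ q ∈ Finset.range (k + 1),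
      T.coeff u i j p q * (jacobiNeg p).eval (toRef (T.x i) (T.x (i + 1)) P.1) *
        (jacobiNeg q).eval (toRef (T.y j) (T.y (j + 1)) P.2) =
      ∑ m ∈ Finset.range (k + 1), ∑ n ∈ Finset.range (k + 1), T.coeff u i j p q *
        e p (T.x i) (T.x (i + 1)) m * e q (T.y j) (T.y (j + 1)) n * P.1 ^ m * P.2 ^ n := by
    intro p hp q hq
    rw [he p _ _ (by simpa [Nat.lt_succ_iff] using hp), he q _ _ (by simpa [Nat.lt_succ_iff] using hq),
      mul_assoc, Finset.sum_mul_sum, Finset.mul_sum]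
    refine Finset.sum_congr rfl fun m _ => ?_
    rw [Finset.mul_sum]
    exact Finset.sum_congr rfl fun n _ => by ring
  rw [Finset.sum_congr rfl fun p hp => Finset.sum_congr rfl (h1 p hp)]
  simp only [Finset.sum_mul]
  rw [Finset.sum_congr rfl fun p _ => Finset.sum_comm, Finset.sum_comm]
  refine Finset.sum_congr rfl fun m _ => ?_
  rw [Finset.sum_congr rfl fun p _ => Finset.sum_comm, Finset.sum_comm]

end C2

end RectMesh

/-! ### Derivatives of the error -/

/-- If the derivative on the large interval exists, it equals the one on the subinterval; otherwise
`derivWithin` is 0. An upper bound for the absolute value holds in both cases. -/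
theorem abs_derivWithin_le_of_hasDerivWithinAt {a b p q x f' : ℝ} {f : ℝ → ℝ} (hpq : p < q)
    (hsub : Icc p q ⊆ Icc a b) (hx : x ∈ Icc p q) (hf : HasDerivWithinAt f f' (Icc p q) x) :
    |derivWithin f (Icc a b) x| ≤ |f'| := by
  by_cases hd : DifferentiableWithinAt ℝ f (Icc a b) x
  · rw [(uniqueDiffOn_Icc hpq x hx).eq_deriv _ (hd.hasDerivWithinAt.mono hsub) hf]
  · rw [derivWithin_zero_of_not_differentiableWithinAt hd, abs_zero]
    exact abs_nonneg _

namespace RectMesh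

variable {a b c d : ℝ} (T : RectMesh a b c d)

section C2

variable {u : ℝ × ℝ → ℝ} (hu : ContDiffOn ℝ 2 u (Icc a b ×ˢ Icc c d)) {k : ℕ} (hk : 3 ≤ k)
  {i j : ℕ} (hi : i < T.M) (hj : j < T.N) {P : ℝ × ℝ} (hP : P ∈ T.elem i j)
include hu hk hi hj hP

theorem err_eq_on_elem : T.err k u P = u P - T.localDeriv k u i j 0 0 P := by
  rw [err, T.proj_eq_localProj hu hk hi hj hP, T.localDeriv_zero_zero]

theorem dX_err_eq_on_elem :
    dX a b (T.err k u) P = dX a b u P - T.localDeriv k u i j 1 0 P := by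
  have hR := T.elem_subset hi hj hP
  have h1 := hasDerivWithinAt_slice_fst (x := P.1) (y := P.2) hR.2
    (T.hasFDerivWithinAt_proj hu hk (P := P))
  have h2 := hasDerivWithinAt_dX (hu.differentiableOn (by norm_num)) hR.1 hR.2
  rw [T.projFDeriv_eq hu hk hi hj hP] at h1
  refine ((h2.sub h1).derivWithin (uniqueDiffOn_Icc T.a_lt_b _ hR.1)).trans ?_
  simp [localFDeriv]

theorem dY_err_eq_on_elem :
    dY c d (T.err k u) P = dY c d u P - T.localDeriv k u i j 0 1 P := by
  have hR := T.elem_subset hi hj hP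
  have h1 := hasDerivWithinAt_slice_snd (x := P.1) (y := P.2) hR.1
    (T.hasFDerivWithinAt_proj hu hk (P := P))
  have h2 := hasDerivWithinAt_dY (hu.differentiableOn (by norm_num)) hR.1 hR.2
  rw [T.projFDeriv_eq hu hk hi hj hP] at h1
  refine ((h2.sub h1).derivWithin (uniqueDiffOn_Icc T.c_lt_d _ hR.2)).trans ?_
  simp [localFDeriv]

/-- The projection is only C^1 across mesh lines, where its second derivative may jump. Hence an
inequality here, in contrast to the first derivatives. -/
theorem abs_dX_dX_err_le :
    |dX a b (dX a b (T.err k u)) P| ≤ |dX a b (dX a b u) P - T.localDeriv k u i j 2 0 P| := by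
  have hR := T.elem_subset hi hj hP
  have h2 := hasDerivWithinAt_dX ((contDiffOn_dX (m := 1) T.a_lt_b T.c_lt_d hu
    (by norm_num)).differentiableOn (by norm_num)) hR.1 hR.2
  have h1 := ((h2.mono (T.x_sub hi)).sub
    (T.hasDerivAt_localDeriv_fst k u i j 1 0 P.1 P.2).hasDerivWithinAt)
  refine abs_derivWithin_le_of_hasDerivWithinAt (T.x_lt i hi) (T.x_sub hi) hP.1
    (h1.congr (fun x hx => ?_) ?_)
  · exact T.dX_err_eq_on_elem hu hk hi hj (P := (x, P.2)) ⟨hx, hP.2⟩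
  · exact T.dX_err_eq_on_elem hu hk hi hj hP

theorem abs_dX_dY_err_le :
    |dX a b (dY c d (T.err k u)) P| ≤ |dX a b (dY c d u) P - T.localDeriv k u i j 1 1 P| := by
  have hR := T.elem_subset hi hj hP
  have h2 := hasDerivWithinAt_dX ((contDiffOn_dY (m := 1) T.a_lt_b T.c_lt_d hu
    (by norm_num)).differentiableOn (by norm_num)) hR.1 hR.2
  have h1 := ((h2.mono (T.x_sub hi)).sub
    (T.hasDerivAt_localDeriv_fst k u i j 0 1 P.1 P.2).hasDerivWithinAt)
  refine abs_derivWithin_le_of_hasDerivWithinAt (T.x_lt i hi) (T.x_sub hi) hP.1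
    (h1.congr (fun x hx => ?_) ?_)
  · exact T.dY_err_eq_on_elem hu hk hi hj (P := (x, P.2)) ⟨hx, hP.2⟩
  · exact T.dY_err_eq_on_elem hu hk hi hj hP

theorem abs_dY_dY_err_le :
    |dY c d (dY c d (T.err k u)) P| ≤ |dY c d (dY c d u) P - T.localDeriv k u i j 0 2 P| := by
  have hR := T.elem_subset hi hj hP
  have h2 := hasDerivWithinAt_dY ((contDiffOn_dY (m := 1) T.a_lt_b T.c_lt_d hu
    (by norm_num)).differentiableOn (by norm_num)) hR.1 hR.2
  have h1 := ((h2.mono (T.y_sub hj)).sub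
    (T.hasDerivAt_localDeriv_snd k u i j 0 1 P.1 P.2).hasDerivWithinAt)
  refine abs_derivWithin_le_of_hasDerivWithinAt (T.y_lt j hj) (T.y_sub hj) hP.2
    (h1.congr (fun y hy => ?_) ?_)
  · exact T.dY_err_eq_on_elem hu hk hi hj (P := (P.1, y)) ⟨hP.1, hy⟩
  · exact T.dY_err_eq_on_elem hu hk hi hj hP

end C2

/-! ### Interpolation at the mesh nodes -/

theorem x_mem_elem {i e : ℕ} (hi : i < T.M) (he : e ≤ 1) :
    T.x (i + e) ∈ Icc (T.x i) (T.x (i + 1)) ∧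
      fromRef (T.x i) (T.x (i + 1)) (2 * e - 1) = T.x (i + e) := by
  have := T.x_lt i hi
  interval_cases e
  · exact ⟨⟨le_rfl, this.le⟩, by norm_num [fromRef_neg_one]⟩
  · exact ⟨⟨this.le, le_rfl⟩, by norm_num [fromRef_one]⟩

theorem y_mem_elem {j f : ℕ} (hj : j < T.N) (hf : f ≤ 1) :
    T.y (j + f) ∈ Icc (T.y j) (T.y (j + 1)) ∧
      fromRef (T.y j) (T.y (j + 1)) (2 * f - 1) = T.y (j + f) := by
  have := T.y_lt j hj
  interval_cases f
  · exact ⟨⟨le_rfl, this.le⟩, by norm_num [fromRef_neg_one]⟩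
  · exact ⟨⟨this.le, le_rfl⟩, by norm_num [fromRef_one]⟩

/-- The first four basis polynomials are numbered so that 2m + e belongs to the m-th derivative at
the end e, that is, at the reference point 2e - 1. At a corner a single coefficient survives. -/
theorem localDeriv_corner {k : ℕ} (hk : 3 ≤ k) (u : ℝ × ℝ → ℝ) {i j e f m n : ℕ} (hi : i < T.M)
    (hj : j < T.N) (he : e ≤ 1) (hf : f ≤ 1) (hm : m ≤ 1) (hn : n ≤ 1) :
    T.localDeriv k u i j m n (T.x (i + e), T.y (j + f)) =
      T.coeff u i j (2 * m + e) (2 * n + f) * (2 / (T.x (i + 1) - T.x i)) ^ m *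
        (2 / (T.y (j + 1) - T.y j)) ^ n := by
  have hX : ∀ p, (derivative^[m] (jacobiNeg p)).eval (toRef (T.x i) (T.x (i + 1)) (T.x (i + e))) =
      if p = 2 * m + e then 1 else 0 := by
    intro p
    interval_cases e
    · rw [add_zero, toRef_left _ _ (T.x_lt i hi)]
      exact iterate_derivative_jacobiNeg_eval_neg_one hm p
    · rw [toRef_right _ _ (T.x_lt i hi)]
      exact iterate_derivative_jacobiNeg_eval_one hm p
  have hY : ∀ p, (derivative^[n] (jacobiNeg p)).eval (toRef (T.y j) (T.y (j + 1)) (T.y (j + f))) =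
      if p = 2 * n + f then 1 else 0 := by
    intro p
    interval_cases f
    · rw [add_zero, toRef_left _ _ (T.y_lt j hj)]
      exact iterate_derivative_jacobiNeg_eval_neg_one hn p
    · rw [toRef_right _ _ (T.y_lt j hj)]
      exact iterate_derivative_jacobiNeg_eval_one hn p
  rw [localDeriv, Finset.sum_eq_single (2 * m + e), Finset.sum_eq_single (2 * n + f)]
  · simp only [hX, hY, if_true]; ring
  · intro q _ hq; simp only [hY, if_neg hq, mul_zero]
  · intro h; exact absurd (Finset.mem_range.mpr (by omega)) h
  · intro p _ hp; simp only [hX, if_neg hp, mul_zero, zero_mul, Finset.sum_const_zero]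
  · intro h; exact absurd (Finset.mem_range.mpr (by omega)) h

theorem jacobiCoeff_value {e : ℕ} (he : e ≤ 1) (v : ℝ → ℝ) : jacobiCoeff e v = v (2 * e - 1) := by
  interval_cases e
  · norm_num [jacobiCoeff]
  · norm_num [jacobiCoeff]

theorem jacobiCoeff_slope {e : ℕ} (he : e ≤ 1) (v : ℝ → ℝ) :
    jacobiCoeff (2 + e) v = derivWithin v (Icc (-1) 1) (2 * e - 1) := by
  interval_cases e
  · norm_num [jacobiCoeff]
  · norm_num [jacobiCoeff]

theorem corner_mem_ref {e : ℕ} (he : e ≤ 1) : (2 * e - 1 : ℝ) ∈ Icc (-1 : ℝ) 1 := by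
  interval_cases e <;> norm_num

/-- The projection interpolates values and gradients at the mesh nodes. -/
theorem err_node {u : ℝ × ℝ → ℝ} (hu : ContDiffOn ℝ 2 u (Icc a b ×ˢ Icc c d)) {k : ℕ}
    (hk : 3 ≤ k) {i j : ℕ} (hiM : i ≤ T.M) (hjN : j ≤ T.N) :
    T.err k u (T.x i, T.y j) = 0 ∧ dX a b (T.err k u) (T.x i, T.y j) = 0 ∧
      dY c d (T.err k u) (T.x i, T.y j) = 0 := by
  -- A node is the left end of the interval with its own index, except the last node, which is a
  -- right end (e = 1).
  obtain ⟨i, e, hi, he, rfl⟩ : ∃ i' e, i' < T.M ∧ e ≤ 1 ∧ i = i' + e := by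
    have := T.M_pos
    rcases hiM.lt_or_eq with h | h
    · exact ⟨i, 0, h, by omega, rfl⟩
    · exact ⟨T.M - 1, 1, by omega, le_rfl, by omega⟩
  obtain ⟨j, f, hj, hf, rfl⟩ : ∃ j' f, j' < T.N ∧ f ≤ 1 ∧ j = j' + f := by
    have := T.N_pos
    rcases hjN.lt_or_eq with h | h
    · exact ⟨j, 0, h, by omega, rfl⟩
    · exact ⟨T.N - 1, 1, by omega, le_rfl, by omega⟩
  obtain ⟨hx, hxe⟩ := T.x_mem_elem hi he
  obtain ⟨hy, hyf⟩ := T.y_mem_elem hj hf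
  have hP : ((T.x (i + e), T.y (j + f)) : ℝ × ℝ) ∈ T.elem i j := ⟨hx, hy⟩
  have hR := T.elem_subset hi hj hP
  have hxl := T.x_lt i hi
  have hyl := T.y_lt j hj
  have hd := hu.differentiableOn (by norm_num)
  rw [T.err_eq_on_elem hu hk hi hj hP, T.dX_err_eq_on_elem hu hk hi hj hP,
    T.dY_err_eq_on_elem hu hk hi hj hP, T.localDeriv_corner hk u hi hj he hf zero_le_one zero_le_one,
    T.localDeriv_corner hk u hi hj he hf le_rfl zero_le_one,
    T.localDeriv_corner hk u hi hj he hf zero_le_one le_rfl]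
  simp only [mul_zero, zero_add, mul_one, pow_zero, pow_one, sub_eq_zero]
  refine ⟨?_, ?_, ?_⟩
  · rw [coeff, jacobiCoeff_value hf, jacobiCoeff_value he, hxe, hyf]
  · have h1 := derivWithin_comp_fromRef (g := fun x => u (x, T.y (j + f))) hxl (T.x_sub hi)
      (corner_mem_ref he) (hasDerivWithinAt_dX hd (by rw [hxe]; exact hR.1) hR.2)
    rw [coeff, jacobiCoeff_value hf, jacobiCoeff_slope he, hyf, h1, hxe,
      two_div_mul_half (by linarith)]
  · have h1 := derivWithin_comp_fromRef (g := fun y => u (T.x (i + e), y)) hyl (T.y_sub hj)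
      (corner_mem_ref hf) (hasDerivWithinAt_dY hd hR.1 (by rw [hyf]; exact hR.2))
    simp only [coeff, jacobiCoeff_value he, jacobiCoeff_slope hf, hxe]
    rw [h1, hyf, two_div_mul_half (by linarith)]

end RectMesh

/-! ### Mollification -/

theorem pdX_affine (e α β γ : ℝ) (f : ℝ × ℝ → ℝ) :
    pdX (fun P => e * f (α * P.1 + β, α * P.2 + γ)) =
      fun P => e * α * pdX f (α * P.1 + β, α * P.2 + γ) := by
  ext P
  have h := deriv_comp_mul_left α (fun z => f (z + β, α * P.2 + γ)) P.1
  rw [deriv_comp_add_const (f := fun z => f (z, α * P.2 + γ)), smul_eq_mul] at h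
  rw [pdX, deriv_const_mul_field]
  simp only [pdX]
  rw [mul_assoc, ← h]

theorem pdY_affine (e α β γ : ℝ) (f : ℝ × ℝ → ℝ) :
    pdY (fun P => e * f (α * P.1 + β, α * P.2 + γ)) =
      fun P => e * α * pdY f (α * P.1 + β, α * P.2 + γ) := by
  ext P
  have h := deriv_comp_mul_left α (fun z => f (α * P.1 + β, z + γ)) P.2
  rw [deriv_comp_add_const (f := fun z => f (α * P.1 + β, z)), smul_eq_mul] at h
  rw [pdY, deriv_const_mul_field]
  simp only [pdY]
  rw [mul_assoc, ← h]

/-- Used with α = -1 for the reflected kernel and with α = 1 - δ for the homothety. -/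
theorem classicalDeriv_affine (α β γ : ℝ) (f : ℝ × ℝ → ℝ) (i j : ℕ) :
    classicalDeriv i j (fun P => f (α * P.1 + β, α * P.2 + γ)) =
      fun P => α ^ (i + j) * classicalDeriv i j f (α * P.1 + β, α * P.2 + γ) := by
  have h1 : ∀ j, pdY^[j] (fun P => f (α * P.1 + β, α * P.2 + γ)) =
      fun P => α ^ j * (pdY^[j] f) (α * P.1 + β, α * P.2 + γ) := by
    intro j
    induction j with
    | zero => simp
    | succ j ih =>
      rw [Function.iterate_succ_apply', ih, pdY_affine, Function.iterate_succ_apply', pow_succ]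
  rw [classicalDeriv_eq, h1]
  induction i with
  | zero => simp [classicalDeriv_eq]
  | succ i ih =>
    rw [Function.iterate_succ_apply', ih, pdX_affine, pdX_classicalDeriv, ← pow_succ]
    simp only [add_right_comm]

theorem tsupport_pdX_subset {f : ℝ × ℝ → ℝ} (hf : ContDiff ℝ ∞ f) : tsupport (pdX f) ⊆ tsupport f := by
  rw [show pdX f = fun P => fderiv ℝ f P (1, 0) from
    funext fun P => pdX_eq_fderiv (differentiable_of_smooth hf P)]
  exact tsupport_fderiv_apply_subset ℝ _

theorem tsupport_pdY_subset {f : ℝ × ℝ → ℝ} (hf : ContDiff ℝ ∞ f) : tsupport (pdY f) ⊆ tsupport f := by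
  rw [show pdY f = fun P => fderiv ℝ f P (0, 1) from
    funext fun P => pdY_eq_fderiv (differentiable_of_smooth hf P)]
  exact tsupport_fderiv_apply_subset ℝ _

theorem hasCompactSupport_pdX {f : ℝ × ℝ → ℝ} (hf : ContDiff ℝ ∞ f) (hc : HasCompactSupport f) :
    HasCompactSupport (pdX f) :=
  hc.of_isClosed_subset (isClosed_tsupport _) (tsupport_pdX_subset hf)

theorem hasCompactSupport_pdY {f : ℝ × ℝ → ℝ} (hf : ContDiff ℝ ∞ f) (hc : HasCompactSupport f) :
    HasCompactSupport (pdY f) :=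
  hc.of_isClosed_subset (isClosed_tsupport _) (tsupport_pdY_subset hf)

/-- The convolution of `w` with the kernel `φ`. -/
noncomputable def mollify (w φ : ℝ × ℝ → ℝ) (P : ℝ × ℝ) : ℝ := ∫ Z, w Z * φ (P - Z)

section mollify

variable {w φ : ℝ × ℝ → ℝ} (hw : LocallyIntegrable w) (hφ : ContDiff ℝ ∞ φ)
  (hc : HasCompactSupport φ)
include hw hφ hc

theorem contDiff_mollify : ContDiff ℝ ∞ (mollify w φ) :=
  hc.contDiff_convolution_right (ContinuousLinearMap.mul ℝ ℝ) hw hφ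

theorem fderiv_mollify (P v : ℝ × ℝ) :
    fderiv ℝ (mollify w φ) P v = mollify w (fun Q => fderiv ℝ φ Q v) P := by
  have h1 := (hc.hasFDerivAt_convolution_right (ContinuousLinearMap.mul ℝ ℝ) (μ := volume) hw
    (hφ.of_le (by simp)) P).fderiv
  have h2 := convolution_precompR_apply (ContinuousLinearMap.mul ℝ ℝ) hw (hc.fderiv ℝ)
    (hφ.continuous_fderiv (by simp)) P v
  rw [← h1] at h2
  exact h2

theorem pdX_mollify : pdX (mollify w φ) = mollify w (pdX φ) := by
  ext P
  rw [pdX_eq_fderiv (differentiable_of_smooth (contDiff_mollify hw hφ hc) P),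
    fderiv_mollify hw hφ hc]
  exact congrArg (mollify w · P) (funext fun Q => (pdX_eq_fderiv (differentiable_of_smooth hφ Q)).symm)

theorem pdY_mollify : pdY (mollify w φ) = mollify w (pdY φ) := by
  ext P
  rw [pdY_eq_fderiv (differentiable_of_smooth (contDiff_mollify hw hφ hc) P),
    fderiv_mollify hw hφ hc]
  exact congrArg (mollify w · P) (funext fun Q => (pdY_eq_fderiv (differentiable_of_smooth hφ Q)).symm)

omit hw in
theorem hasCompactSupport_classicalDeriv (i j : ℕ) :
    HasCompactSupport (classicalDeriv i j φ) := by
  have h1 : ∀ j, HasCompactSupport (pdY^[j] φ) := by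
    intro j
    induction j with
    | zero => exact hc
    | succ j ih =>
      rw [Function.iterate_succ_apply']
      exact hasCompactSupport_pdY (contDiff_pdY_iterate hφ j) ih
  induction i with
  | zero => exact h1 j
  | succ i ih =>
    rw [← pdX_classicalDeriv]
    exact hasCompactSupport_pdX (contDiff_classicalDeriv hφ i j) ih

theorem classicalDeriv_mollify (i j : ℕ) :
    classicalDeriv i j (mollify w φ) = mollify w (classicalDeriv i j φ) := by
  have h1 : ∀ j, pdY^[j] (mollify w φ) = mollify w (pdY^[j] φ) := by
    intro j
    induction j with
    | zero => rfl
    | succ j ih =>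
      rw [Function.iterate_succ_apply', ih, Function.iterate_succ_apply',
        pdY_mollify hw (contDiff_pdY_iterate hφ j)
          (hasCompactSupport_classicalDeriv hφ hc 0 j)]
  rw [classicalDeriv_eq, h1]
  induction i with
  | zero => rfl
  | succ i ih =>
    rw [Function.iterate_succ_apply', ih, pdX_mollify hw (contDiff_classicalDeriv hφ i j)
      (hasCompactSupport_classicalDeriv hφ hc i j), pdX_classicalDeriv]

end mollify

/-! ### Classical derivatives are weak derivatives -/

section weak

variable {Ω : Set (ℝ × ℝ)}

theorem integrable_mul_of_tsupport_subset {w φ : ℝ × ℝ → ℝ} (hw : ContinuousOn w Ω)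
    (hφ : Continuous φ) (hc : HasCompactSupport φ) (hs : tsupport φ ⊆ Ω) :
    Integrable fun P => w P * φ P := by
  refine (integrableOn_iff_integrable_of_support_subset (s := tsupport φ) ?_).mp
    (((hw.mono hs).mul hφ.continuousOn).integrableOn_compact hc)
  exact (Function.support_mul_subset_right w φ).trans (subset_tsupport φ)

theorem setIntegral_mul_eq_integral {w φ : ℝ × ℝ → ℝ} (hs : tsupport φ ⊆ Ω) :
    ∫ P in Ω, w P * φ P = ∫ P, w P * φ P :=
  setIntegral_eq_integral_of_forall_compl_eq_zero fun P hP => by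
    rw [image_eq_zero_of_notMem_tsupport fun h => hP (hs h), mul_zero]

/-- There are no boundary terms because the support of `φ` is compact in `Ω`, and `w` has to be
differentiable on that support only. -/
theorem integral_mul_lineDeriv {w w' φ φ' : ℝ × ℝ → ℝ} {v : ℝ × ℝ} (hw : ContinuousOn w Ω)
    (hw' : ContinuousOn w' Ω) (hd : ∀ P ∈ Ω, HasLineDerivAt ℝ w (w' P) P v)
    (hφ : Continuous φ) (hφ' : Continuous φ') (hdφ : ∀ P, HasLineDerivAt ℝ φ (φ' P) P v)
    (hc : HasCompactSupport φ) (hs : tsupport φ ⊆ Ω) (hs' : tsupport φ' ⊆ tsupport φ) :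
    ∫ P in Ω, w P * φ' P = -∫ P in Ω, w' P * φ P := by
  rw [setIntegral_mul_eq_integral hs, setIntegral_mul_eq_integral (hs'.trans hs)]
  exact integral_bilinear_hasLineDerivAt_right_eq_neg_left_of_integrable
    (B := ContinuousLinearMap.mul ℝ ℝ) (integrable_mul_of_tsupport_subset hw' hφ hc hs)
    (integrable_mul_of_tsupport_subset hw hφ' (hc.of_isClosed_subset (isClosed_tsupport _) hs')
      (hs'.trans hs)) (integrable_mul_of_tsupport_subset hw hφ hc hs)
    (fun P hP => hd P (hs hP)) fun P _ => hdφ P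

variable {a b c d : ℝ} {w : ℝ × ℝ → ℝ}

theorem rect_interior_subset : (Ioo a b ×ˢ Ioo c d : Set (ℝ × ℝ)) ⊆ Icc a b ×ˢ Icc c d :=
  prod_mono Ioo_subset_Icc_self Ioo_subset_Icc_self

theorem hasLineDerivAt_fst {f : ℝ × ℝ → ℝ} {f' : ℝ} {P : ℝ × ℝ}
    (h : HasDerivAt (fun s => f (s, P.2)) f' P.1) : HasLineDerivAt ℝ f f' P (1, 0) := by
  have h1 : HasDerivAt (fun t : ℝ => P.1 + t) 1 0 := (hasDerivAt_id (0 : ℝ)).const_add P.1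
  have h2 := HasDerivAt.comp (h₂ := fun s => f (s, P.2)) (0 : ℝ) (by simpa using h) h1
  rw [mul_one] at h2
  refine h2.congr_of_eventuallyEq (Filter.Eventually.of_forall fun t => ?_)
  simp only [Function.comp]
  congr 1
  ext <;> simp

theorem hasLineDerivAt_snd {f : ℝ × ℝ → ℝ} {f' : ℝ} {P : ℝ × ℝ}
    (h : HasDerivAt (fun t => f (P.1, t)) f' P.2) : HasLineDerivAt ℝ f f' P (0, 1) := by
  have h1 : HasDerivAt (fun t : ℝ => P.2 + t) 1 0 := (hasDerivAt_id (0 : ℝ)).const_add P.2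
  have h2 := HasDerivAt.comp (h₂ := fun s => f (P.1, s)) (0 : ℝ) (by simpa using h) h1
  rw [mul_one] at h2
  refine h2.congr_of_eventuallyEq (Filter.Eventually.of_forall fun t => ?_)
  simp only [Function.comp]
  congr 1
  ext <;> simp

theorem integral_mul_pdX (hab : a < b) (hcd : c < d) (hw : ContDiffOn ℝ 1 w (Icc a b ×ˢ Icc c d))
    {φ : ℝ × ℝ → ℝ} (hφ : ContDiff ℝ ∞ φ) (hc : HasCompactSupport φ)
    (hs : tsupport φ ⊆ Ioo a b ×ˢ Ioo c d) :
    ∫ P in Ioo a b ×ˢ Ioo c d, w P * pdX φ P = -∫ P in Ioo a b ×ˢ Ioo c d, dX a b w P * φ P := by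
  refine integral_mul_lineDeriv (v := (1, 0)) (hw.continuousOn.mono rect_interior_subset)
    ((contDiffOn_dX (m := 0) hab hcd hw (by simp)).continuousOn.mono rect_interior_subset)
    (fun P hP => hasLineDerivAt_fst ?_) hφ.continuous (contDiff_pdX hφ).continuous
    (fun P => hasLineDerivAt_fst (hasDerivAt_pdX (differentiable_of_smooth hφ) _ _)) hc hs
    (tsupport_pdX_subset hφ)
  exact (hasDerivWithinAt_dX (hw.differentiableOn (by simp)) (Ioo_subset_Icc_self hP.1)
    (Ioo_subset_Icc_self hP.2)).hasDerivAt (Icc_mem_nhds hP.1.1 hP.1.2)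

theorem integral_mul_pdY (hab : a < b) (hcd : c < d) (hw : ContDiffOn ℝ 1 w (Icc a b ×ˢ Icc c d))
    {φ : ℝ × ℝ → ℝ} (hφ : ContDiff ℝ ∞ φ) (hc : HasCompactSupport φ)
    (hs : tsupport φ ⊆ Ioo a b ×ˢ Ioo c d) :
    ∫ P in Ioo a b ×ˢ Ioo c d, w P * pdY φ P = -∫ P in Ioo a b ×ˢ Ioo c d, dY c d w P * φ P := by
  refine integral_mul_lineDeriv (v := (0, 1)) (hw.continuousOn.mono rect_interior_subset)
    ((contDiffOn_dY (m := 0) hab hcd hw (by simp)).continuousOn.mono rect_interior_subset)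
    (fun P hP => hasLineDerivAt_snd ?_) hφ.continuous (contDiff_pdY hφ).continuous
    (fun P => hasLineDerivAt_snd (hasDerivAt_pdY (differentiable_of_smooth hφ) _ _)) hc hs
    (tsupport_pdY_subset hφ)
  exact (hasDerivWithinAt_dY (hw.differentiableOn (by simp)) (Ioo_subset_Icc_self hP.1)
    (Ioo_subset_Icc_self hP.2)).hasDerivAt (Icc_mem_nhds hP.2.1 hP.2.2)

theorem isWeakDeriv_of_continuousOn {i j : ℕ} {g : ℝ × ℝ → ℝ}
    (hg : ContinuousOn g (Icc a b ×ˢ Icc c d))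
    (h : ∀ φ : ℝ × ℝ → ℝ, ContDiff ℝ ∞ φ → HasCompactSupport φ → tsupport φ ⊆ Ioo a b ×ˢ Ioo c d →
      ∫ P in Ioo a b ×ˢ Ioo c d, w P * classicalDeriv i j φ P =
        (-1) ^ (i + j) * ∫ P in Ioo a b ×ˢ Ioo c d, g P * φ P) :
    IsWeakDeriv (Ioo a b ×ˢ Ioo c d) w i j g :=
  ⟨((hg.integrableOn_compact (isCompact_Icc.prod isCompact_Icc)).mono_set
    rect_interior_subset).locallyIntegrableOn, h⟩

variable (hab : a < b) (hcd : c < d) (hw : ContDiffOn ℝ 2 w (Icc a b ×ˢ Icc c d))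

include hw in
theorem isWeakDeriv_zero_zero : IsWeakDeriv (Ioo a b ×ˢ Ioo c d) w 0 0 w :=
  isWeakDeriv_of_continuousOn hw.continuousOn fun φ _ _ _ => by simp [classicalDeriv_eq]

include hab hcd hw

theorem isWeakDeriv_dX : IsWeakDeriv (Ioo a b ×ˢ Ioo c d) w 1 0 (dX a b w) :=
  isWeakDeriv_of_continuousOn (contDiffOn_dX (m := 0) hab hcd hw (by simp)).continuousOn
    fun φ h1 h2 h3 => by
      rw [show classicalDeriv 1 0 φ = pdX φ from rfl,
        integral_mul_pdX hab hcd (hw.of_le (by norm_num)) h1 h2 h3]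
      ring

theorem isWeakDeriv_dY : IsWeakDeriv (Ioo a b ×ˢ Ioo c d) w 0 1 (dY c d w) :=
  isWeakDeriv_of_continuousOn (contDiffOn_dY (m := 0) hab hcd hw (by simp)).continuousOn
    fun φ h1 h2 h3 => by
      rw [show classicalDeriv 0 1 φ = pdY φ from rfl,
        integral_mul_pdY hab hcd (hw.of_le (by norm_num)) h1 h2 h3]
      ring

theorem isWeakDeriv_dX_dX : IsWeakDeriv (Ioo a b ×ˢ Ioo c d) w 2 0 (dX a b (dX a b w)) := by
  have hd := contDiffOn_dX (m := 1) hab hcd hw (by norm_num)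
  refine isWeakDeriv_of_continuousOn (contDiffOn_dX (m := 0) hab hcd hd (by simp)).continuousOn
    fun φ h1 h2 h3 => ?_
  rw [show classicalDeriv 2 0 φ = pdX (pdX φ) from rfl,
    integral_mul_pdX hab hcd (hw.of_le (by norm_num)) (contDiff_pdX h1) (hasCompactSupport_pdX h1 h2)
      ((tsupport_pdX_subset h1).trans h3), integral_mul_pdX hab hcd hd h1 h2 h3]
  ring

theorem isWeakDeriv_dY_dX : IsWeakDeriv (Ioo a b ×ˢ Ioo c d) w 1 1 (dY c d (dX a b w)) := by
  have hd := contDiffOn_dX (m := 1) hab hcd hw (by norm_num)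
  refine isWeakDeriv_of_continuousOn (contDiffOn_dY (m := 0) hab hcd hd (by simp)).continuousOn
    fun φ h1 h2 h3 => ?_
  rw [show classicalDeriv 1 1 φ = pdX (pdY φ) from rfl,
    integral_mul_pdX hab hcd (hw.of_le (by norm_num)) (contDiff_pdY h1) (hasCompactSupport_pdY h1 h2)
      ((tsupport_pdY_subset h1).trans h3), integral_mul_pdY hab hcd hd h1 h2 h3]
  ring

/-- The order of differentiation is exchanged on the test function. So ∂_x u_y, which is to be
estimated, and ∂_y u_x, which enters the coefficients, represent the same weak derivative. -/
theorem isWeakDeriv_dX_dY : IsWeakDeriv (Ioo a b ×ˢ Ioo c d) w 1 1 (dX a b (dY c d w)) := by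
  have hd := contDiffOn_dY (m := 1) hab hcd hw (by norm_num)
  refine isWeakDeriv_of_continuousOn (contDiffOn_dX (m := 0) hab hcd hd (by simp)).continuousOn
    fun φ h1 h2 h3 => ?_
  rw [show classicalDeriv 1 1 φ = pdX (pdY φ) from rfl, pdX_pdY_comm h1,
    integral_mul_pdY hab hcd (hw.of_le (by norm_num)) (contDiff_pdX h1) (hasCompactSupport_pdX h1 h2)
      ((tsupport_pdX_subset h1).trans h3), integral_mul_pdX hab hcd hd h1 h2 h3]
  ring

theorem isWeakDeriv_dY_dY : IsWeakDeriv (Ioo a b ×ˢ Ioo c d) w 0 2 (dY c d (dY c d w)) := by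
  have hd := contDiffOn_dY (m := 1) hab hcd hw (by norm_num)
  refine isWeakDeriv_of_continuousOn (contDiffOn_dY (m := 0) hab hcd hd (by simp)).continuousOn
    fun φ h1 h2 h3 => ?_
  rw [show classicalDeriv 0 2 φ = pdY (pdY φ) from rfl,
    integral_mul_pdY hab hcd (hw.of_le (by norm_num)) (contDiff_pdY h1) (hasCompactSupport_pdY h1 h2)
      ((tsupport_pdY_subset h1).trans h3), integral_mul_pdY hab hcd hd h1 h2 h3]
  ring

end weak

/-! ### Smooth approximation of functions on a rectangle -/

/-! ### Averages against a probability density -/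

section average

variable {α : Type*} [MeasurableSpace α] {μ : Measure α} {g κ : α → ℝ} (hκ : Integrable κ μ)
  (hκ0 : ∀ z, 0 ≤ κ z) (hκ1 : ∫ z, κ z ∂μ = 1)
include hκ hκ0 hκ1

theorem abs_integral_mul_le {B : ℝ} (hB : ∀ᵐ z ∂μ, |g z| ≤ B) : |∫ z, g z * κ z ∂μ| ≤ B := by
  have h := norm_integral_le_of_norm_le (f := fun z => g z * κ z) (hκ.const_mul B) (by
    filter_upwards [hB] with z hz
    rw [norm_mul, Real.norm_eq_abs, Real.norm_of_nonneg (hκ0 z)]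
    exact mul_le_mul_of_nonneg_right hz (hκ0 z))
  rwa [integral_const_mul, hκ1, mul_one] at h

theorem abs_integral_mul_sub_le {m η : ℝ} (hg : Integrable (fun z => g z * κ z) μ)
    (hm : ∀ᵐ z ∂μ, κ z ≠ 0 → |g z - m| ≤ η) : |∫ z, g z * κ z ∂μ - m| ≤ η := by
  have h := norm_integral_le_of_norm_le (f := fun z => g z * κ z - m * κ z) (hκ.const_mul η) (by
    filter_upwards [hm] with z hz
    rw [← sub_mul, norm_mul, Real.norm_eq_abs, Real.norm_of_nonneg (hκ0 z)]
    rcases eq_or_ne (κ z) 0 with h0 | h0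
    · rw [h0, mul_zero, mul_zero]
    · exact mul_le_mul_of_nonneg_right (hz h0) (hκ0 z))
  rwa [integral_sub hg (hκ.const_mul m), integral_const_mul, integral_const_mul, hκ1, mul_one,
    mul_one] at h

/-- Jensen's inequality for the square: the variance is nonnegative. -/
theorem sq_integral_mul_le (hg : Integrable (fun z => g z * κ z) μ)
    (hg2 : Integrable (fun z => g z ^ 2 * κ z) μ) :
    (∫ z, g z * κ z ∂μ) ^ 2 ≤ ∫ z, g z ^ 2 * κ z ∂μ := by
  set m := ∫ z, g z * κ z ∂μ with hm
  have h0 : 0 ≤ ∫ z, (g z - m) ^ 2 * κ z ∂μ :=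
    integral_nonneg fun z => mul_nonneg (sq_nonneg _) (hκ0 z)
  have h1 : ∫ z, (g z - m) ^ 2 * κ z ∂μ =
      ∫ z, (g z ^ 2 * κ z - 2 * m * (g z * κ z)) + m ^ 2 * κ z ∂μ :=
    integral_congr_ae (Filter.Eventually.of_forall fun z => by ring)
  have h2 : Integrable (fun z => g z ^ 2 * κ z - 2 * m * (g z * κ z)) μ := hg2.sub (hg.const_mul _)
  rw [h1, integral_add h2 (hκ.const_mul _), integral_sub hg2 (hg.const_mul _), integral_const_mul, integral_const_mul, hκ1, ← hm] at h0
  linarith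

end average

section kernel

variable {φ : ℝ × ℝ → ℝ} {ε : ℝ} (hφ : ContDiff ℝ ∞ φ) (hs : ∀ z, ε < ‖z‖ → φ z = 0)

include hs in
theorem hasCompactSupport_kernel : HasCompactSupport φ :=
  HasCompactSupport.intro (isCompact_closedBall 0 ε) fun z hz => hs z (by simpa using hz)

include hs in
theorem tsupport_sub_left_subset (Q : ℝ × ℝ) :
    tsupport (fun Z => φ (Q - Z)) ⊆ Metric.closedBall Q ε := by
  refine closure_minimal (fun Z hZ => ?_) Metric.isClosed_closedBall
  rw [Metric.mem_closedBall, dist_comm, dist_eq_norm]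
  by_contra! h
  exact hZ (hs _ h)

include hφ hs

/-- A derivative of a mollified function is the mollification of the weak derivative. -/
theorem classicalDeriv_mollify_indicator {Ω : Set (ℝ × ℝ)} (hΩ : MeasurableSet Ω)
    {u g : ℝ × ℝ → ℝ} (hu : IntegrableOn u Ω) {i j : ℕ} (hg : IsWeakDeriv Ω u i j g) {Q : ℝ × ℝ}
    (hQ : Metric.closedBall Q ε ⊆ Ω) :
    classicalDeriv i j (mollify (Ω.indicator u) φ) Q = ∫ Z in Ω, g Z * φ (Q - Z) := by
  have hc := hasCompactSupport_kernel hs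
  have hψ : (fun Z : ℝ × ℝ => φ (Q - Z)) =
      fun Z => φ (-1 * Z.1 + Q.1, -1 * Z.2 + Q.2) := by
    ext Z
    congr 1
    ext <;> simp <;> ring
  have ht := (tsupport_sub_left_subset hs Q).trans hQ
  -- The ball lies in `Ω`, so the reflected and translated kernel is an admissible test function.
  -- The sign from the reflection cancels the one in the definition of the weak derivative.
  have h1 := hg.2 (fun Z => φ (Q - Z)) (hφ.comp (contDiff_const.sub contDiff_id))
    ((isCompact_closedBall Q ε).of_isClosed_subset (isClosed_tsupport _)
      (tsupport_sub_left_subset hs Q)) ht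
  have h2 : classicalDeriv i j (fun Z => φ (Q - Z)) =
      fun Z => (-1) ^ (i + j) * classicalDeriv i j φ (Q - Z) := by
    rw [hψ, classicalDeriv_affine]
    ext Z
    congr 2
    ext <;> simp <;> ring
  rw [h2] at h1
  simp only [mul_left_comm (u _)] at h1
  rw [integral_const_mul] at h1
  rw [classicalDeriv_mollify (hu.integrable_indicator hΩ).locallyIntegrable hφ hc, mollify,
    ← mul_left_cancel₀ (pow_ne_zero _ (by norm_num : (-1 : ℝ) ≠ 0)) h1, ← integral_indicator hΩ]
  refine integral_congr_ae (Filter.Eventually.of_forall fun Z => ?_)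
  by_cases hZ : Z ∈ Ω <;> simp [hZ]

end kernel

/-- A smooth mollifier with support of given size. -/
theorem exists_kernel {ε : ℝ} (hε : 0 < ε) : ∃ φ : ℝ × ℝ → ℝ, ContDiff ℝ ∞ φ ∧ (∀ z, 0 ≤ φ z) ∧
    (∀ z, ε < ‖z‖ → φ z = 0) ∧ ∫ z, φ z = 1 := by
  let f : ContDiffBump (0 : ℝ × ℝ) := ⟨ε / 2, ε, by positivity, by linarith⟩
  refine ⟨f.normed volume, f.contDiff_normed, f.nonneg_normed, fun z hz => ?_, f.integral_normed⟩
  by_contra h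
  have h1 : z ∈ Function.support (f.normed volume) := h
  rw [f.support_normed_eq, Metric.mem_ball, dist_zero_right] at h1
  exact lt_asymm hz h1

section rect

variable {a b c d : ℝ} {φ : ℝ × ℝ → ℝ} {ε δ : ℝ}

/-- The homothety of ratio `1 - δ` that fixes the centre of the rectangle. -/
noncomputable def shrink (a b c d δ : ℝ) (P : ℝ × ℝ) : ℝ × ℝ :=
  ((1 - δ) * P.1 + δ * ((a + b) / 2), (1 - δ) * P.2 + δ * ((c + d) / 2))

theorem continuous_shrink : Continuous (shrink a b c d δ) := by
  unfold shrink; fun_prop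

theorem contDiff_shrink : ContDiff ℝ ∞ (shrink a b c d δ) := by
  unfold shrink; fun_prop

/-- The homothety leaves a margin of δ times the half-widths between its image and the boundary. -/
theorem closedBall_shrink_subset (hδ : δ ≤ 1) (h1 : ε < δ * ((b - a) / 2))
    (h2 : ε < δ * ((d - c) / 2)) {P : ℝ × ℝ} (hP : P ∈ Icc a b ×ˢ Icc c d) :
    Metric.closedBall (shrink a b c d δ P) ε ⊆ Ioo a b ×ˢ Ioo c d := by
  intro Z hZ
  rw [Metric.mem_closedBall, Prod.dist_eq, max_le_iff, Real.dist_eq, Real.dist_eq, abs_le,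
    abs_le] at hZ
  obtain ⟨⟨z1, z2⟩, z3, z4⟩ := hZ
  obtain ⟨⟨p1, p2⟩, p3, p4⟩ := hP
  simp only [shrink] at z1 z2 z3 z4
  have q1 := mul_le_mul_of_nonneg_left p1 (sub_nonneg.mpr hδ)
  have q2 := mul_le_mul_of_nonneg_left p2 (sub_nonneg.mpr hδ)
  have q3 := mul_le_mul_of_nonneg_left p3 (sub_nonneg.mpr hδ)
  have q4 := mul_le_mul_of_nonneg_left p4 (sub_nonneg.mpr hδ)
  refine ⟨⟨?_, ?_⟩, ?_, ?_⟩ <;> nlinarith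

theorem norm_shrink_sub_le (hδ0 : 0 ≤ δ) {P : ℝ × ℝ} (hP : P ∈ Icc a b ×ˢ Icc c d) :
    ‖shrink a b c d δ P - P‖ ≤ δ * max (b - a) (d - c) := by
  obtain ⟨⟨p1, p2⟩, p3, p4⟩ := hP
  have e1 : (shrink a b c d δ P - P).1 = δ * ((a + b) / 2 - P.1) := by simp [shrink]; ring
  have e2 : (shrink a b c d δ P - P).2 = δ * ((c + d) / 2 - P.2) := by simp [shrink]; ring
  rw [Prod.norm_def, e1, e2, norm_mul, norm_mul, Real.norm_of_nonneg hδ0]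
  refine max_le (mul_le_mul_of_nonneg_left (le_max_of_le_left ?_) hδ0)
    (mul_le_mul_of_nonneg_left (le_max_of_le_right ?_) hδ0) <;>
  · rw [Real.norm_eq_abs, abs_le]; constructor <;> linarith

theorem classicalDeriv_comp_shrink (f : ℝ × ℝ → ℝ) (i j : ℕ) (P : ℝ × ℝ) :
    classicalDeriv i j (fun P => f (shrink a b c d δ P)) P =
      (1 - δ) ^ (i + j) * classicalDeriv i j f (shrink a b c d δ P) :=
  congrFun (classicalDeriv_affine (1 - δ) (δ * ((a + b) / 2)) (δ * ((c + d) / 2)) f i j) P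

theorem integral_kernel_shrink (hδ : δ < 1) (h1 : ∫ z, φ z = 1) (Z : ℝ × ℝ) :
    ∫ P, φ (shrink a b c d δ P - Z) = ((1 - δ) ^ 2)⁻¹ := by
  have e : ∀ P, shrink a b c d δ P - Z =
      (1 - δ) • P + ((δ * ((a + b) / 2), δ * ((c + d) / 2)) - Z) := by
    intro P
    ext <;> simp [shrink] <;> ring
  simp only [e]
  rw [Measure.integral_comp_smul_of_nonneg (hR := by linarith) volume
    (fun x => φ (x + ((δ * ((a + b) / 2), δ * ((c + d) / 2)) - Z))),
    integral_add_right_eq_self (μ := volume) φ, h1]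
  simp

variable (hφ : ContDiff ℝ ∞ φ) (hφ0 : ∀ z, 0 ≤ φ z) (hs : ∀ z, ε < ‖z‖ → φ z = 0)
  (h1 : ∫ z, φ z = 1)
include hφ hs

theorem integrable_kernel_sub (Q : ℝ × ℝ) : Integrable fun Z => φ (Q - Z) :=
  (hφ.continuous.comp (by fun_prop)).integrable_of_hasCompactSupport
    ((isCompact_closedBall Q ε).of_isClosed_subset (isClosed_tsupport _)
      (tsupport_sub_left_subset hs Q))

theorem exists_kernel_bound : ∃ C, ∀ z, ‖φ z‖ ≤ C :=
  (hasCompactSupport_kernel hs).exists_bound_of_continuous hφ.continuous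

theorem integrable_mul_kernel {Ω : Set (ℝ × ℝ)} {g : ℝ × ℝ → ℝ} (hg : IntegrableOn g Ω)
    (Q : ℝ × ℝ) : Integrable (fun Z => g Z * φ (Q - Z)) (volume.restrict Ω) := by
  obtain ⟨C, hC⟩ := exists_kernel_bound hφ hs
  exact hg.mul_bdd (hφ.continuous.comp (by fun_prop)).aestronglyMeasurable
    (Filter.Eventually.of_forall fun Z => hC (Q - Z))

include h1 in
omit hφ in
theorem setIntegral_kernel_eq_one {Ω : Set (ℝ × ℝ)} {Q : ℝ × ℝ} (hQ : Metric.closedBall Q ε ⊆ Ω) :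
    ∫ Z in Ω, φ (Q - Z) = 1 := by
  rw [setIntegral_eq_integral_of_forall_compl_eq_zero, integral_sub_left_eq_self φ, h1]
  intro Z hZ
  refine image_eq_zero_of_notMem_tsupport (f := fun Z => φ (Q - Z)) fun h => hZ ?_
  exact hQ (tsupport_sub_left_subset hs Q h)

-- Jensen's inequality at each point, then Fubini: the integral of the kernel over the point of
-- evaluation is at most the inverse Jacobian of the homothety.
include hφ0 h1 in
theorem integral_sq_mollify_le (hδ : δ < 1) {R Ω : Set (ℝ × ℝ)} (hR : IsCompact R)
    (hΩ' : volume Ω < ⊤)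
    (hsub : ∀ P ∈ R, Metric.closedBall (shrink a b c d δ P) ε ⊆ Ω) {g v : ℝ × ℝ → ℝ}
    (hg : MemLp g 2 (volume.restrict Ω)) (hv : Continuous v)
    (hvg : ∀ P ∈ R, v P = ∫ Z in Ω, g Z * φ (shrink a b c d δ P - Z)) :
    ∫ P in R, v P ^ 2 ≤ ((1 - δ) ^ 2)⁻¹ * ∫ Z in Ω, g Z ^ 2 := by
  have : IsFiniteMeasure (volume.restrict Ω) := ⟨by simpa using hΩ'⟩
  have : IsFiniteMeasure (volume.restrict R) := ⟨by simpa using hR.measure_lt_top⟩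
  have hg1 : Integrable g (volume.restrict Ω) := hg.integrable (by norm_num)
  have hg2 : Integrable (fun Z => g Z ^ 2) (volume.restrict Ω) := hg.integrable_sq
  obtain ⟨C, hC⟩ := exists_kernel_bound hφ hs
  have hint : Integrable (fun z : (ℝ × ℝ) × (ℝ × ℝ) => g z.2 ^ 2 * φ (shrink a b c d δ z.1 - z.2))
      ((volume.restrict R).prod (volume.restrict Ω)) :=
    (hg2.comp_snd (volume.restrict R)).mul_bdd (hφ.continuous.comp
      ((continuous_shrink.comp continuous_fst).sub continuous_snd)).aestronglyMeasurable
      (Filter.Eventually.of_forall fun Z => hC _)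
  calc ∫ P in R, v P ^ 2
      ≤ ∫ P in R, ∫ Z in Ω, g Z ^ 2 * φ (shrink a b c d δ P - Z) := by
        refine setIntegral_mono_on ((hv.pow 2).continuousOn.integrableOn_compact hR)
          hint.integral_prod_left hR.measurableSet fun P hP => ?_
        rw [hvg P hP]
        exact sq_integral_mul_le (integrable_kernel_sub hφ hs _).integrableOn (fun Z => hφ0 _)
          (setIntegral_kernel_eq_one hs h1 (hsub P hP)) (integrable_mul_kernel hφ hs hg1 _)
          (integrable_mul_kernel hφ hs hg2 _)
    _ = ∫ Z in Ω, ∫ P in R, g Z ^ 2 * φ (shrink a b c d δ P - Z) := integral_integral_swap hint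
    _ ≤ ∫ Z in Ω, ((1 - δ) ^ 2)⁻¹ * g Z ^ 2 := by
        refine integral_mono hint.integral_prod_right (hg2.const_mul _) fun Z => ?_
        simp only
        rw [integral_const_mul, mul_comm]
        refine mul_le_mul_of_nonneg_right ?_ (sq_nonneg _)
        have e := integral_kernel_shrink (a := a) (b := b) (c := c) (d := d) hδ h1 Z
        rw [← e]
        refine setIntegral_le_integral (.of_integral_ne_zero ?_)
          (Filter.Eventually.of_forall fun P => hφ0 _)
        rw [e]
        have : 0 < 1 - δ := by linarith
        positivity
    _ = _ := integral_const_mul _ _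

end rect

variable {a b c d : ℝ} {u : ℝ × ℝ → ℝ}

theorem measurableSet_rect : MeasurableSet (Ioo a b ×ˢ Ioo c d : Set (ℝ × ℝ)) :=
  measurableSet_Ioo.prod measurableSet_Ioo

theorem isCompact_rect : IsCompact (Icc a b ×ˢ Icc c d : Set (ℝ × ℝ)) :=
  isCompact_Icc.prod isCompact_Icc

theorem volume_rect_lt_top : volume (Ioo a b ×ˢ Ioo c d : Set (ℝ × ℝ)) < ⊤ :=
  (measure_mono rect_interior_subset).trans_lt isCompact_rect.measure_lt_top

/-- Near the boundary a mollification would see values outside the domain, so it is evaluated at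
points moved towards the centre by more than the radius of the kernel. The chain-rule factor (1 -
δ)^(i+j) is at most 1, so the bounds lose no constant; one function serves all weak derivatives at
once. -/
theorem exists_smooth_approx_scale (hab : a < b) (hcd : c < d)
    (hu : IntegrableOn u (Ioo a b ×ˢ Ioo c d)) {δ : ℝ} (hδ0 : 0 < δ) (hδ1 : δ < 1) :
    ∃ f : ℝ × ℝ → ℝ, ContDiff ℝ ∞ f ∧
      ∀ (i j : ℕ) (g : ℝ × ℝ → ℝ), IsWeakDeriv (Ioo a b ×ˢ Ioo c d) u i j g →
      (∀ B, (∀ᵐ P ∂volume.restrict (Ioo a b ×ˢ Ioo c d), |g P| ≤ B) →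
        ∀ P ∈ Icc a b ×ˢ Icc c d, |classicalDeriv i j f P| ≤ B) ∧
      (1 ≤ i + j → MemLp g 2 (volume.restrict (Ioo a b ×ˢ Ioo c d)) →
        ∫ P in Icc a b ×ˢ Icc c d, classicalDeriv i j f P ^ 2 ≤
          ∫ P in Ioo a b ×ˢ Ioo c d, g P ^ 2) ∧
      (∀ η, IntegrableOn g (Ioo a b ×ˢ Ioo c d) →
        (∀ P ∈ Icc a b ×ˢ Icc c d, ∀ Z ∈ Icc a b ×ˢ Icc c d,
          dist Z P ≤ 2 * δ * max (b - a) (d - c) → |g Z - g P| ≤ η) →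
        ∀ P ∈ Icc a b ×ˢ Icc c d, |classicalDeriv i j f P - (1 - δ) ^ (i + j) * g P| ≤ η) := by
  set D := max (b - a) (d - c) with hD
  -- Less than the margin, which is δ times at least half of the shorter side.
  set ε := δ * (min (b - a) (d - c) / 4) with hε
  have hba : 0 < b - a := by linarith
  have hdc : 0 < d - c := by linarith
  have hmin : 0 < min (b - a) (d - c) := lt_min hba hdc
  have hm1 := min_le_left (b - a) (d - c)
  have hm2 := min_le_right (b - a) (d - c)
  have hDa := le_max_left (b - a) (d - c)
  obtain ⟨φ, hφ, hφ0, hs, h1⟩ := exists_kernel (ε := ε) (by positivity)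
  have hball : ∀ P ∈ Icc a b ×ˢ Icc c d,
      Metric.closedBall (shrink a b c d δ P) ε ⊆ Ioo a b ×ˢ Ioo c d := fun P hP =>
    closedBall_shrink_subset hδ1.le (mul_lt_mul_of_pos_left (by linarith) hδ0)
      (mul_lt_mul_of_pos_left (by linarith) hδ0) hP
  set Ω : Set (ℝ × ℝ) := Ioo a b ×ˢ Ioo c d with hΩ
  set v := mollify (Ω.indicator u) φ with hv
  have hvs : ContDiff ℝ ∞ v :=
    contDiff_mollify (hu.integrable_indicator measurableSet_rect).locallyIntegrable hφ
      (hasCompactSupport_kernel hs)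
  have hpow0 : ∀ m : ℕ, 0 ≤ (1 - δ) ^ m := fun m => pow_nonneg (by linarith) m
  have hpow1 : ∀ m : ℕ, (1 - δ) ^ m ≤ 1 := fun m => pow_le_one₀ (by linarith) (by linarith)
  refine ⟨fun P => v (shrink a b c d δ P), hvs.comp contDiff_shrink, fun i j g hg => ?_⟩
  have hvg : ∀ P ∈ Icc a b ×ˢ Icc c d, classicalDeriv i j v (shrink a b c d δ P) =
      ∫ Z in Ω, g Z * φ (shrink a b c d δ P - Z) := fun P hP =>
    classicalDeriv_mollify_indicator hφ hs measurableSet_rect hu hg (hball P hP)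
  refine ⟨fun B hB P hP => ?_, fun hij hg2 => ?_, fun η hgi hη P hP => ?_⟩
  · rw [classicalDeriv_comp_shrink, hvg P hP, abs_mul, abs_of_nonneg (hpow0 _)]
    have h := abs_integral_mul_le (integrable_kernel_sub hφ hs (shrink a b c d δ P)).integrableOn
      (fun Z => hφ0 _) (setIntegral_kernel_eq_one hs h1 (hball P hP)) hB
    exact (mul_le_of_le_one_left (abs_nonneg _) (hpow1 _)).trans h
  · have h := integral_sq_mollify_le hφ hφ0 hs h1 hδ1 isCompact_rect volume_rect_lt_top hball hg2
      ((contDiff_classicalDeriv hvs i j).continuous.comp continuous_shrink) hvg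
    simp only [classicalDeriv_comp_shrink, mul_pow]
    rw [integral_const_mul]
    have hl : 0 < 1 - δ := by linarith
    have h0 : 0 ≤ ∫ Z in Ω, g Z ^ 2 := integral_nonneg fun Z => sq_nonneg _
    calc _ ≤ ((1 - δ) ^ (i + j)) ^ 2 * (((1 - δ) ^ 2)⁻¹ * ∫ Z in Ω, g Z ^ 2) :=
          mul_le_mul_of_nonneg_left h (sq_nonneg _)
      -- For order at least 1 the chain-rule factor absorbs the inverse Jacobian (1 - δ)^(-2).
      _ = ((1 - δ) ^ (i + j - 1)) ^ 2 * ∫ Z in Ω, g Z ^ 2 := by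
          obtain ⟨m, hm⟩ := Nat.exists_eq_add_of_le hij
          rw [hm, Nat.add_sub_cancel_left, pow_add, pow_one, mul_pow]
          field_simp
      _ ≤ 1 * ∫ Z in Ω, g Z ^ 2 :=
          mul_le_mul_of_nonneg_right (pow_le_one₀ (hpow0 _) (hpow1 _)) h0
      _ = _ := one_mul _
  · rw [classicalDeriv_comp_shrink, hvg P hP, ← mul_sub, abs_mul, abs_of_nonneg (hpow0 _)]
    refine (mul_le_of_le_one_left (abs_nonneg _) (hpow1 _)).trans ?_
    refine abs_integral_mul_sub_le (integrable_kernel_sub hφ hs (shrink a b c d δ P)).integrableOn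
      (fun Z => hφ0 _) (setIntegral_kernel_eq_one hs h1 (hball P hP))
      (integrable_mul_kernel hφ hs hgi _) (Filter.Eventually.of_forall fun Z hZ => ?_)
    have hZ' : ‖shrink a b c d δ P - Z‖ ≤ ε := by
      by_contra! h
      exact hZ (hs _ h)
    have hZb : Z ∈ Metric.closedBall (shrink a b c d δ P) ε := by
      rwa [Metric.mem_closedBall, dist_comm, dist_eq_norm]
    refine hη P hP Z (rect_interior_subset (hball P hP hZb)) ?_
    calc dist Z P ≤ dist Z (shrink a b c d δ P) + dist (shrink a b c d δ P) P := dist_triangle _ _ _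
      _ ≤ ε + δ * D := add_le_add hZb (by
          rw [dist_eq_norm]; exact norm_shrink_sub_le hδ0.le hP)
      _ ≤ δ * D + δ * D := by
        have : ε ≤ δ * D := mul_le_mul_of_nonneg_left (by linarith) hδ0.le
        linarith
      _ = 2 * δ * D := by ring

/-- Smooth approximations whose derivatives are controlled by the weak derivatives, and converge
uniformly on the closed rectangle as long as the weak derivatives are continuous there. -/
theorem exists_smooth_approx (hab : a < b) (hcd : c < d)
    (hu : IntegrableOn u (Ioo a b ×ˢ Ioo c d)) :
    ∃ F : ℕ → ℝ × ℝ → ℝ, (∀ n, ContDiff ℝ ∞ (F n)) ∧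
      ∀ (i j : ℕ) (g : ℝ × ℝ → ℝ), IsWeakDeriv (Ioo a b ×ˢ Ioo c d) u i j g →
      (∀ B, (∀ᵐ P ∂volume.restrict (Ioo a b ×ˢ Ioo c d), |g P| ≤ B) →
        ∀ n, ∀ P ∈ Icc a b ×ˢ Icc c d, |classicalDeriv i j (F n) P| ≤ B) ∧
      (1 ≤ i + j → MemLp g 2 (volume.restrict (Ioo a b ×ˢ Ioo c d)) →
        ∀ n, ∫ P in Icc a b ×ˢ Icc c d, classicalDeriv i j (F n) P ^ 2 ≤
          ∫ P in Ioo a b ×ˢ Ioo c d, g P ^ 2) ∧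
      (ContinuousOn g (Icc a b ×ˢ Icc c d) → ∀ η > 0, ∀ᶠ n in Filter.atTop,
        ∀ P ∈ Icc a b ×ˢ Icc c d, |g P - classicalDeriv i j (F n) P| ≤ η) := by
  have hδ0 : ∀ n : ℕ, 0 < 1 / ((n : ℝ) + 2) := fun n => by positivity
  have hδ1 : ∀ n : ℕ, 1 / ((n : ℝ) + 2) < 1 := fun n => by
    rw [div_lt_one (by positivity)]; linarith [(Nat.cast_nonneg n : (0 : ℝ) ≤ n)]
  have hδ : Filter.Tendsto (fun n : ℕ => 1 / ((n : ℝ) + 2)) Filter.atTop (nhds 0) := by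
    simp only [one_div]
    exact (Filter.tendsto_atTop_add_const_right _ 2 tendsto_natCast_atTop_atTop).inv_tendsto_atTop
  choose F hF1 hF2 using fun n => exists_smooth_approx_scale hab hcd hu (hδ0 n) (hδ1 n)
  refine ⟨F, hF1, fun i j g hg => ⟨fun B hB n => (hF2 n i j g hg).1 B hB,
    fun h1 h2 n => (hF2 n i j g hg).2.1 h1 h2, fun hc η hη => ?_⟩⟩
  obtain ⟨G, hG⟩ := isCompact_rect.exists_bound_of_continuousOn hc
  obtain ⟨ρ, hρ, hρ'⟩ := Metric.uniformContinuousOn_iff_le.mp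
    (isCompact_rect.uniformContinuousOn_of_continuous hc) (η / 2) (by positivity)
  have t1 : Filter.Tendsto (fun n : ℕ => 2 * (1 / ((n : ℝ) + 2)) * max (b - a) (d - c))
      Filter.atTop (nhds 0) := by simpa using (hδ.const_mul 2).mul_const (max (b - a) (d - c))
  have t2 : Filter.Tendsto (fun n : ℕ => (1 - (1 - 1 / ((n : ℝ) + 2)) ^ (i + j)) * |G|)
      Filter.atTop (nhds 0) := by
    simpa using (((hδ.const_sub 1).pow (i + j)).const_sub 1).mul_const |G|
  -- Half of `η` is for the modulus of continuity of `g`, half for the factor (1 - δ)^(i+j), which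
  -- tends to 1 while `g` is bounded.
  filter_upwards [t1.eventually_le_const hρ, t2.eventually_le_const (half_pos hη)] with n h1 h2 P hP
  have h3 := (hF2 n i j g hg).2.2 (η / 2)
    ((hc.integrableOn_compact isCompact_rect).mono_set rect_interior_subset)
    (fun P hP Z hZ hd => hρ' Z hZ P hP (hd.trans h1)) P hP
  set e := (1 - 1 / ((n : ℝ) + 2)) ^ (i + j) with he
  have he1 : e ≤ 1 := pow_le_one₀ (by linarith [hδ1 n]) (by linarith [hδ0 n])
  have h4 : |(1 - e) * g P| ≤ (1 - e) * |G| := by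
    rw [abs_mul, abs_of_nonneg (by linarith)]
    exact mul_le_mul_of_nonneg_left ((hG P hP).trans (le_abs_self G)) (by linarith)
  calc |g P - classicalDeriv i j (F n) P|
      = |(1 - e) * g P - (classicalDeriv i j (F n) P - e * g P)| := by ring_nf
    _ ≤ |(1 - e) * g P| + |classicalDeriv i j (F n) P - e * g P| := abs_sub _ _
    _ ≤ η := by linarith

/-! ### Weak derivatives and Sobolev norms -/

section weakDeriv

variable {Ω : Set (ℝ × ℝ)} {u : ℝ × ℝ → ℝ} {i j l r : ℕ} {p : ℝ≥0∞}

theorem IsWeakDeriv.integrable_mul {g φ : ℝ × ℝ → ℝ} (hg : IsWeakDeriv Ω u i j g)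
    (hφ : Continuous φ) (hc : HasCompactSupport φ) (hs : tsupport φ ⊆ Ω) :
    Integrable fun P => g P * φ P := by
  obtain ⟨C, hC⟩ := hc.exists_bound_of_continuous hφ
  refine (integrableOn_iff_integrable_of_support_subset (s := tsupport φ) ?_).mp
    ((hg.1.integrableOn_compact_subset hs hc).mul_bdd hφ.aestronglyMeasurable
      (Filter.Eventually.of_forall hC))
  exact (Function.support_mul_subset_right g φ).trans (subset_tsupport φ)

/-- Fundamental lemma of the calculus of variations. It makes the chosen representative `weakDeriv`
inherit the integrability of any other one. -/
theorem IsWeakDeriv.ae_eq (hΩ : IsOpen Ω) {g g' : ℝ × ℝ → ℝ} (hg : IsWeakDeriv Ω u i j g)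
    (hg' : IsWeakDeriv Ω u i j g') : g =ᵐ[volume.restrict Ω] g' := by
  have h := hΩ.ae_eq_zero_of_integral_contDiff_smul_eq_zero (hg.1.sub hg'.1) fun φ h1 h2 h3 => by
    have e := (hg.2 φ h1 h2 h3).symm.trans (hg'.2 φ h1 h2 h3)
    rw [setIntegral_mul_eq_integral h3, setIntegral_mul_eq_integral h3] at e
    have e' := mul_left_cancel₀ (pow_ne_zero _ (by norm_num : (-1 : ℝ) ≠ 0)) e
    have e2 : ∀ P, φ P • (g - g') P = g P * φ P - g' P * φ P := fun P => by
      simp only [Pi.sub_apply, smul_eq_mul]; ring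
    simp only [e2]
    rw [integral_sub (hg.integrable_mul h1.continuous h2 h3)
      (hg'.integrable_mul h1.continuous h2 h3), e', sub_self]
  rw [Filter.EventuallyEq, ae_restrict_iff' hΩ.measurableSet]
  filter_upwards [h] with P hP hPΩ
  exact sub_eq_zero.mp (hP hPΩ)

theorem isWeakDeriv_weakDeriv (hu : MemSobolev l p Ω u) (hij : i + j ≤ l) :
    IsWeakDeriv Ω u i j (weakDeriv Ω u i j) := by
  obtain ⟨g, hg, -⟩ := hu.2 i j hij
  have h : ∃ g, IsWeakDeriv Ω u i j g := ⟨g, hg⟩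
  rw [weakDeriv, dif_pos h]
  exact h.choose_spec

theorem memLp_weakDeriv (hΩ : IsOpen Ω) (hu : MemSobolev l p Ω u) (hij : i + j ≤ l) :
    MemLp (weakDeriv Ω u i j) p (volume.restrict Ω) := by
  obtain ⟨g, hg, hg'⟩ := hu.2 i j hij
  exact hg'.ae_eq (hg.ae_eq hΩ (isWeakDeriv_weakDeriv hu hij))

theorem sobolevSum_nonneg (S : Finset (ℕ × ℕ)) : 0 ≤ sobolevSum S p Ω u := by
  rw [sobolevSum]
  split_ifs
  · exact ENNReal.toReal_nonneg
  · exact Real.rpow_nonneg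
      (Finset.sum_nonneg fun _ _ => Real.rpow_nonneg ENNReal.toReal_nonneg _) _

theorem sobolevNorm_nonneg (r : ℕ) (p : ℝ≥0∞) : 0 ≤ sobolevNorm r p Ω u := sobolevSum_nonneg _

theorem sobolevSeminorm_nonneg (r : ℕ) (p : ℝ≥0∞) : 0 ≤ sobolevSeminorm r p Ω u :=
  sobolevSum_nonneg _

theorem sobolevSum_top (S : Finset (ℕ × ℕ)) : sobolevSum S ⊤ Ω u =
    (S.sup fun s => eLpNorm (weakDeriv Ω u s.1 s.2) ⊤ (volume.restrict Ω)).toReal :=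
  if_pos rfl

theorem sup_eLpNorm_weakDeriv_lt_top (hΩ : IsOpen Ω) (hu : MemSobolev l ⊤ Ω u)
    {S : Finset (ℕ × ℕ)} (hS : ∀ s ∈ S, s.1 + s.2 ≤ l) :
    (S.sup fun s => eLpNorm (weakDeriv Ω u s.1 s.2) ⊤ (volume.restrict Ω)) < ⊤ :=
  (Finset.sup_lt_iff ENNReal.coe_lt_top).mpr fun s hs => (memLp_weakDeriv hΩ hu (hS s hs)).2

theorem mem_biUnion_antidiagonal {s : ℕ × ℕ} :
    s ∈ (Finset.range (r + 1)).biUnion Finset.HasAntidiagonal.antidiagonal ↔ s.1 + s.2 ≤ r := by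
  simp

theorem toReal_eLpNorm_le_sobolevSum_top (hΩ : IsOpen Ω) (hu : MemSobolev l ⊤ Ω u)
    {S : Finset (ℕ × ℕ)} (hS : ∀ s ∈ S, s.1 + s.2 ≤ l) {s : ℕ × ℕ} (hs : s ∈ S) :
    (eLpNorm (weakDeriv Ω u s.1 s.2) ⊤ (volume.restrict Ω)).toReal ≤ sobolevSum S ⊤ Ω u := by
  have hlt := sup_eLpNorm_weakDeriv_lt_top hΩ hu hS
  rw [sobolevSum_top]
  generalize hF : (fun s : ℕ × ℕ => eLpNorm (weakDeriv Ω u s.1 s.2) ⊤ (volume.restrict Ω)) = F at *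
  rw [show eLpNorm (weakDeriv Ω u s.1 s.2) ⊤ (volume.restrict Ω) = F s by rw [← hF]]
  exact ENNReal.toReal_mono hlt.ne (Finset.le_sup hs)

theorem ae_abs_weakDeriv_le (hΩ : IsOpen Ω) (hu : MemSobolev l ⊤ Ω u) (hr : r ≤ l)
    (hij : i + j = r) :
    ∀ᵐ P ∂volume.restrict Ω, |weakDeriv Ω u i j P| ≤ sobolevSeminorm r ⊤ Ω u := by
  have h1 : (eLpNorm (weakDeriv Ω u i j) ⊤ (volume.restrict Ω)).toReal ≤
      sobolevSeminorm r ⊤ Ω u := toReal_eLpNorm_le_sobolevSum_top (s := (i, j)) hΩ hu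
    (fun s hs => (Finset.HasAntidiagonal.mem_antidiagonal.mp hs).trans_le hr)
    (Finset.HasAntidiagonal.mem_antidiagonal.mpr hij)
  have hL := memLp_weakDeriv hΩ hu (hij.trans_le hr)
  filter_upwards [enorm_ae_le_eLpNormEssSup (weakDeriv Ω u i j) (volume.restrict Ω)] with P hP
  rw [← eLpNorm_exponent_top] at hP
  have h2 := ENNReal.toReal_mono hL.2.ne hP
  rw [toReal_enorm, Real.norm_eq_abs] at h2
  exact h2.trans h1

theorem sobolevSeminorm_top_le_sobolevNorm (hΩ : IsOpen Ω) (hu : MemSobolev l ⊤ Ω u)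
    (hr : r ≤ l) : sobolevSeminorm r ⊤ Ω u ≤ sobolevNorm r ⊤ Ω u := by
  rw [sobolevSeminorm, sobolevNorm, sobolevSum_top, sobolevSum_top]
  refine ENNReal.toReal_mono (sup_eLpNorm_weakDeriv_lt_top hΩ hu fun s hs =>
    (mem_biUnion_antidiagonal.mp hs).trans hr).ne (Finset.sup_mono fun s hs => ?_)
  exact mem_biUnion_antidiagonal.mpr (Finset.HasAntidiagonal.mem_antidiagonal.mp hs).le

theorem sobolevNorm_two_sq : sobolevNorm r 2 Ω u ^ 2 =
    ∑ s ∈ (Finset.range (r + 1)).biUnion Finset.HasAntidiagonal.antidiagonal,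
      (eLpNorm (weakDeriv Ω u s.1 s.2) 2 (volume.restrict Ω)).toReal ^ 2 := by
  rw [sobolevNorm, sobolevSum, if_neg (by norm_num)]
  simp only [ENNReal.toReal_ofNat, Real.rpow_ofNat]
  rw [← Real.sqrt_eq_rpow, Real.sq_sqrt (Finset.sum_nonneg fun _ _ => sq_nonneg _)]

theorem toReal_eLpNorm_le_sobolevNorm_two (hij : i + j ≤ r) :
    (eLpNorm (weakDeriv Ω u i j) 2 (volume.restrict Ω)).toReal ≤ sobolevNorm r 2 Ω u := by
  refine (sq_le_sq₀ ENNReal.toReal_nonneg (sobolevNorm_nonneg _ _)).mp ?_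
  rw [sobolevNorm_two_sq]
  have hs := mem_biUnion_antidiagonal (s := (i, j)).mpr hij
  generalize hF : (fun s : ℕ × ℕ => eLpNorm (weakDeriv Ω u s.1 s.2) 2 (volume.restrict Ω)) = F
  rw [show eLpNorm (weakDeriv Ω u i j) 2 (volume.restrict Ω) = F (i, j) by rw [← hF],
    show (fun s : ℕ × ℕ => (eLpNorm (weakDeriv Ω u s.1 s.2) 2 (volume.restrict Ω)).toReal ^ 2) =
      fun s => (F s).toReal ^ 2 by rw [← hF]]
  exact Finset.single_le_sum (f := fun s => (F s).toReal ^ 2) (fun _ _ => sq_nonneg _) hs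

theorem toReal_eLpNorm_two_sq {μ : Measure (ℝ × ℝ)} {f : ℝ × ℝ → ℝ} (hf : MemLp f 2 μ) :
    (eLpNorm f 2 μ).toReal ^ 2 = ∫ P, f P ^ 2 ∂μ := by
  have h0 : 0 ≤ ∫ P, f P ^ 2 ∂μ := integral_nonneg fun P => sq_nonneg _
  rw [hf.eLpNorm_eq_integral_rpow_norm (by norm_num) (by norm_num)]
  simp only [ENNReal.toReal_ofNat, Real.rpow_ofNat, Real.norm_eq_abs, sq_abs]
  rw [ENNReal.toReal_ofReal (Real.rpow_nonneg h0 _), ← one_div, ← Real.sqrt_eq_rpow,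
    Real.sq_sqrt h0]

end weakDeriv

/-! ### Comparison of the two kinds of Sobolev norms on a bounded rectangle -/

section rect

variable {a b c d : ℝ} {u : ℝ × ℝ → ℝ} {i j l r : ℕ}

theorem isOpen_rect : IsOpen (Ioo a b ×ˢ Ioo c d : Set (ℝ × ℝ)) := isOpen_Ioo.prod isOpen_Ioo

theorem isFiniteMeasure_rect : IsFiniteMeasure (volume.restrict (Ioo a b ×ˢ Ioo c d) : Measure (ℝ × ℝ)) :=
  ⟨by simpa using volume_rect_lt_top⟩

theorem memLp_two_weakDeriv (hu : MemSobolev l ⊤ (Ioo a b ×ˢ Ioo c d) u) (hij : i + j ≤ l) :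
    MemLp (weakDeriv (Ioo a b ×ˢ Ioo c d) u i j) 2 (volume.restrict (Ioo a b ×ˢ Ioo c d)) := by
  have := isFiniteMeasure_rect (a := a) (b := b) (c := c) (d := d)
  exact (memLp_weakDeriv isOpen_rect hu hij).mono_exponent le_top

theorem integral_sq_weakDeriv_le (hu : MemSobolev l ⊤ (Ioo a b ×ˢ Ioo c d) u) (hij : i + j ≤ r)
    (hr : r ≤ l) : ∫ P in Ioo a b ×ˢ Ioo c d, weakDeriv (Ioo a b ×ˢ Ioo c d) u i j P ^ 2 ≤
      sobolevNorm r 2 (Ioo a b ×ˢ Ioo c d) u ^ 2 := by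
  rw [← toReal_eLpNorm_two_sq (memLp_two_weakDeriv hu (hij.trans hr))]
  exact pow_le_pow_left₀ ENNReal.toReal_nonneg (toReal_eLpNorm_le_sobolevNorm_two hij) 2

/-- The seminorms for the exponent `∞` vanish with the norms for the exponent `2`. -/
theorem sobolevSeminorm_top_eq_zero (hu : MemSobolev l ⊤ (Ioo a b ×ˢ Ioo c d) u) (hr : r ≤ l)
    (h0 : sobolevNorm r 2 (Ioo a b ×ˢ Ioo c d) u = 0) :
    sobolevSeminorm r ⊤ (Ioo a b ×ˢ Ioo c d) u = 0 := by
  rw [sobolevSeminorm, sobolevSum_top]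
  refine (ENNReal.toReal_eq_zero_iff _).mpr (Or.inl ?_)
  rw [← bot_eq_zero, Finset.sup_eq_bot_iff]
  rintro ⟨i, j⟩ hs
  have hij : i + j = r := Finset.HasAntidiagonal.mem_antidiagonal.mp hs
  have h1 := toReal_eLpNorm_le_sobolevNorm_two (Ω := Ioo a b ×ˢ Ioo c d) (u := u) hij.le
  have hL := memLp_two_weakDeriv hu (hij.trans_le hr)
  rw [h0] at h1
  have h2 := ((ENNReal.toReal_eq_zero_iff _).mp
    (le_antisymm h1 ENNReal.toReal_nonneg)).resolve_right hL.2.ne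
  have h3 := (eLpNorm_eq_zero_iff hL.1 (by norm_num)).mp h2
  exact (eLpNorm_congr_ae h3).trans eLpNorm_zero

end rect

/-! ### Passage to the limit -/

section smooth

variable {a b c d : ℝ} {f : ℝ × ℝ → ℝ}

theorem dX_eq_classicalDeriv (hf : ContDiff ℝ ∞ f) {P : ℝ × ℝ} (hab : a < b) (hP : P.1 ∈ Icc a b) :
    dX a b f P = classicalDeriv 1 0 f P :=
  (hasDerivAt_pdX (differentiable_of_smooth hf) P.1 P.2).hasDerivWithinAt.derivWithin
    (uniqueDiffOn_Icc hab _ hP)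

theorem dY_eq_classicalDeriv (hf : ContDiff ℝ ∞ f) {P : ℝ × ℝ} (hcd : c < d) (hP : P.2 ∈ Icc c d) :
    dY c d f P = classicalDeriv 0 1 f P :=
  (hasDerivAt_pdY (differentiable_of_smooth hf) P.1 P.2).hasDerivWithinAt.derivWithin
    (uniqueDiffOn_Icc hcd _ hP)

theorem dY_dX_eq_classicalDeriv (hf : ContDiff ℝ ∞ f) {P : ℝ × ℝ} (hab : a < b) (hcd : c < d)
    (hP : P ∈ Icc a b ×ˢ Icc c d) : dY c d (dX a b f) P = classicalDeriv 1 1 f P := by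
  have h1 : dY c d (dX a b f) P = dY c d (classicalDeriv 1 0 f) P :=
    derivWithin_congr (fun t _ => dX_eq_classicalDeriv hf hab (P := (P.1, t)) hP.1)
      (dX_eq_classicalDeriv hf hab hP.1)
  rw [h1, dY_eq_classicalDeriv (contDiff_classicalDeriv hf 1 0) hcd hP.2]
  exact congrFun (pdY_classicalDeriv hf 1 0) P

end smooth

/-- `F n` is a sequence of smooth functions such that `F n`, its gradient and its mixed second
derivative converge to those of `u`, uniformly on the closed rectangle. -/
structure MixedConv (a b c d : ℝ) (u : ℝ × ℝ → ℝ) (F : ℕ → ℝ × ℝ → ℝ) : Prop where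
  smooth : ∀ n, ContDiff ℝ ∞ (F n)
  val : ∀ η > 0, ∀ᶠ n in Filter.atTop, ∀ P ∈ Icc a b ×ˢ Icc c d, |u P - F n P| ≤ η
  fst : ∀ η > 0, ∀ᶠ n in Filter.atTop, ∀ P ∈ Icc a b ×ˢ Icc c d,
    |dX a b u P - classicalDeriv 1 0 (F n) P| ≤ η
  snd : ∀ η > 0, ∀ᶠ n in Filter.atTop, ∀ P ∈ Icc a b ×ˢ Icc c d,
    |dY c d u P - classicalDeriv 0 1 (F n) P| ≤ η
  mixed : ∀ η > 0, ∀ᶠ n in Filter.atTop, ∀ P ∈ Icc a b ×ˢ Icc c d,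
    |dY c d (dX a b u) P - classicalDeriv 1 1 (F n) P| ≤ η

theorem tendsto_of_eventually_abs_sub_le {C y : ℝ} {x : ℕ → ℝ}
    (h : ∀ η > 0, ∀ᶠ n in Filter.atTop, |y - x n| ≤ C * η) :
    Filter.Tendsto x Filter.atTop (nhds y) := by
  rw [Metric.tendsto_nhds]
  intro ε hε
  have hC : 0 < |C| + 1 := by positivity
  filter_upwards [h (ε / (|C| + 1)) (by positivity)] with n hn
  rw [dist_comm, Real.dist_eq]
  calc |y - x n| ≤ C * (ε / (|C| + 1)) := hn
    _ < (|C| + 1) * (ε / (|C| + 1)) :=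
        mul_lt_mul_of_pos_right (by linarith [le_abs_self C]) (by positivity)
    _ = ε := by field_simp

namespace RectMesh

variable {a b c d : ℝ} (T : RectMesh a b c d) {u : ℝ × ℝ → ℝ} {F : ℕ → ℝ × ℝ → ℝ}
  (hu : ContDiffOn ℝ 2 u (Icc a b ×ˢ Icc c d)) (hF : MixedConv a b c d u F)
include hu hF

theorem tendsto_coeff {i j : ℕ} (hi : i < T.M) (hj : j < T.N) (p q : ℕ) :
    Filter.Tendsto (fun n => T.coeff (F n) i j p q) Filter.atTop (nhds (T.coeff u i j p q)) := by
  obtain ⟨C, hC⟩ := T.exists_coeff_sub_bound hi hj p q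
  refine tendsto_of_eventually_abs_sub_le (C := C) fun η hη => ?_
  filter_upwards [hF.val η hη, hF.fst η hη, hF.snd η hη, hF.mixed η hη] with n h1 h2 h3 h4
  have hs := hF.smooth n
  refine hC u (F n) η hu (contDiff_infty.mp hs 2).contDiffOn h1 (fun P hP => ?_)
    (fun P hP => ?_) fun P hP => ?_
  · rw [dX_eq_classicalDeriv hs T.a_lt_b hP.1]; exact h2 P hP
  · rw [dY_eq_classicalDeriv hs T.c_lt_d hP.2]; exact h3 P hP
  · rw [dY_dX_eq_classicalDeriv hs T.a_lt_b T.c_lt_d hP]; exact h4 P hP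

theorem tendsto_localDeriv {i j : ℕ} (hi : i < T.M) (hj : j < T.N) (k m n : ℕ) (P : ℝ × ℝ) :
    Filter.Tendsto (fun ν => T.localDeriv k (F ν) i j m n P) Filter.atTop
      (nhds (T.localDeriv k u i j m n P)) :=
  tendsto_finsetSum _ fun p _ => tendsto_finsetSum _ fun q _ =>
    ((T.tendsto_coeff hu hF hi hj p q).mul_const _).mul_const _

theorem tendsto_err (k : ℕ) {P : ℝ × ℝ} (hP : P ∈ Icc a b ×ˢ Icc c d) :
    Filter.Tendsto (fun ν => T.err k (F ν) P) Filter.atTop (nhds (T.err k u P)) := by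
  have h1 : Filter.Tendsto (fun ν => F ν P) Filter.atTop (nhds (u P)) :=
    tendsto_of_eventually_abs_sub_le (C := 1) fun η hη => by
      filter_upwards [hF.val η hη] with n hn
      rw [one_mul]; exact hn P hP
  -- The element used at `P` depends on the mesh alone, so convergence of one local expansion
  -- suffices.
  have h2 := T.tendsto_localDeriv hu hF (T.xIdx_spec hP.1).1 (T.yIdx_spec hP.2).1 k 0 0 P
  simp only [T.localDeriv_zero_zero] at h2
  exact h1.sub h2

end RectMesh

/-- Smooth approximations of `u` with derivatives controlled by the weak derivatives of `u`. -/
theorem exists_mixedConv {a b c d : ℝ} (hab : a < b) (hcd : c < d) {u : ℝ × ℝ → ℝ}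
    (hu : ContDiffOn ℝ 2 u (Icc a b ×ˢ Icc c d)) :
    ∃ F, MixedConv a b c d u F ∧
      ∀ (i j : ℕ) (g : ℝ × ℝ → ℝ), IsWeakDeriv (Ioo a b ×ˢ Ioo c d) u i j g →
      (∀ B, (∀ᵐ P ∂volume.restrict (Ioo a b ×ˢ Ioo c d), |g P| ≤ B) →
        ∀ n, ∀ P ∈ Icc a b ×ˢ Icc c d, |classicalDeriv i j (F n) P| ≤ B) ∧
      (1 ≤ i + j → MemLp g 2 (volume.restrict (Ioo a b ×ˢ Ioo c d)) →
        ∀ n, ∫ P in Icc a b ×ˢ Icc c d, classicalDeriv i j (F n) P ^ 2 ≤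
          ∫ P in Ioo a b ×ˢ Ioo c d, g P ^ 2) ∧
      (ContinuousOn g (Icc a b ×ˢ Icc c d) → ∀ η > 0, ∀ᶠ n in Filter.atTop,
        ∀ P ∈ Icc a b ×ˢ Icc c d, |g P - classicalDeriv i j (F n) P| ≤ η) := by
  obtain ⟨F, hF1, hF2⟩ := exists_smooth_approx hab hcd
    ((hu.continuousOn.integrableOn_compact isCompact_rect).mono_set rect_interior_subset)
  refine ⟨F, ⟨hF1, (hF2 0 0 u (isWeakDeriv_zero_zero hu)).2.2 hu.continuousOn,
    (hF2 1 0 _ (isWeakDeriv_dX hab hcd hu)).2.2 ?_, (hF2 0 1 _ (isWeakDeriv_dY hab hcd hu)).2.2 ?_,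
    (hF2 1 1 _ (isWeakDeriv_dY_dX hab hcd hu)).2.2 ?_⟩, hF2⟩
  · exact (contDiffOn_dX (m := 0) hab hcd hu (by simp)).continuousOn
  · exact (contDiffOn_dY (m := 0) hab hcd hu (by simp)).continuousOn
  · exact (contDiffOn_dY (m := 0) hab hcd (contDiffOn_dX (m := 1) hab hcd hu (by norm_num))
      (by simp)).continuousOn

/-- The error of the local expansion in terms of the Sobolev seminorm. -/
theorem error_bound {k : ℕ} (hk : 3 ≤ k) (σ : ℝ) :
    ∃ K : ℝ, 0 ≤ K ∧ ∀ (a b c d : ℝ) (T : RectMesh a b c d), T.h ≤ σ * T.hmin →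
      ∀ (l : ℕ) (u : ℝ × ℝ → ℝ), MemSobolev l ⊤ (Ioo a b ×ˢ Ioo c d) u →
      ContDiffOn ℝ 2 u (Icc a b ×ˢ Icc c d) →
      ∀ i < T.M, ∀ j < T.N, ∀ r : ℕ, 2 ≤ r → r ≤ k + 2 → r ≤ l → ∀ m n : ℕ, m + n ≤ 2 →
      ∀ g, IsWeakDeriv (Ioo a b ×ˢ Ioo c d) u m n g → ContinuousOn g (Icc a b ×ˢ Icc c d) →
      ∀ s ∈ Icc (-1 : ℝ) 1, ∀ t ∈ Icc (-1 : ℝ) 1,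
        (r = k + 2 → n = 0 → (derivative^[m] (jacobiNeg (k + 1))).eval s = 0) →
        (r = k + 2 → m = 0 → (derivative^[n] (jacobiNeg (k + 1))).eval t = 0) →
        |g (fromRef (T.x i) (T.x (i + 1)) s, fromRef (T.y j) (T.y (j + 1)) t) -
          T.localDeriv k u i j m n
            (fromRef (T.x i) (T.x (i + 1)) s, fromRef (T.y j) (T.y (j + 1)) t)| ≤
          K * T.h ^ (r - (m + n)) * sobolevSeminorm r ⊤ (Ioo a b ×ˢ Ioo c d) u := by
  obtain ⟨K, hK0, hK⟩ := smooth_error_bound hk σ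
  refine ⟨K, hK0, ?_⟩
  intro a b c d T hσ l u hS hu i hi j hj r hr2 hrk hrl m n hmn g hg hgc s hs t ht hcs hct
  obtain ⟨F, hF, hF'⟩ := exists_mixedConv T.a_lt_b T.c_lt_d hu
  set P : ℝ × ℝ := (fromRef (T.x i) (T.x (i + 1)) s, fromRef (T.y j) (T.y (j + 1)) t) with hP
  have hPe : P ∈ T.elem i j := ⟨fromRef_mem (T.x_lt i hi) hs, fromRef_mem (T.y_lt j hj) ht⟩
  have h1 : Filter.Tendsto (fun ν => classicalDeriv m n (F ν) P) Filter.atTop (nhds (g P)) :=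
    tendsto_of_eventually_abs_sub_le (C := 1) fun η hη => by
      filter_upwards [(hF' m n g hg).2.2 hgc η hη] with ν hν
      rw [one_mul]; exact hν P (T.elem_subset hi hj hPe)
  -- The bound for every approximant already contains the seminorm of u itself, so only its left
  -- side passes to the limit.
  refine le_of_tendsto ((h1.sub (T.tendsto_localDeriv hu hF hi hj k m n P)).abs)
    (Filter.Eventually.of_forall fun ν => ?_)
  refine hK a b c d T hσ i hi j hj (F ν) (hF.smooth ν) r _ hr2 hrk ?_ m n hmn s hs t ht hcs hct
  intro i' j' hij Q hQ
  exact (hF' i' j' _ (isWeakDeriv_weakDeriv hS (hij.trans_le hrl))).1 _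
    (ae_abs_weakDeriv_le isOpen_rect hS hrl hij) ν Q (T.elem_subset hi hj hQ)

/-! ### The error in the mean square norm -/

theorem setIntegral_Icc_prod_Icc {g : ℝ × ℝ → ℝ} (hg : Continuous g) {p q p' q' : ℝ} (h : p ≤ q)
    (h' : p' ≤ q') :
    ∫ P in Icc p q ×ˢ Icc p' q', g P = ∫ y in p'..q', ∫ x in p..q, g (x, y) := by
  rw [integral_integral_swap_of_continuous hg, Measure.volume_eq_prod,
    setIntegral_prod _ (hg.continuousOn.integrableOn_compact (isCompact_Icc.prod isCompact_Icc)),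
    integral_Icc_eq_integral_Ioc, ← intervalIntegral.integral_of_le h]
  simp only [integral_Icc_eq_integral_Ioc, ← intervalIntegral.integral_of_le h']

/-- An inequality is all that is needed, so the overlaps of closed elements along edges need no
discussion. -/
theorem setIntegral_iUnion_le {ι : Type*} [Fintype ι] {s : ι → Set (ℝ × ℝ)} {f : ℝ × ℝ → ℝ}
    (hf : ∀ P, 0 ≤ f P) (hi : ∀ z, IntegrableOn f (s z)) :
    ∫ P in ⋃ z, s z, f P ≤ ∑ z, ∫ P in s z, f P := by
  have hle : volume.restrict (⋃ z, s z) ≤ ∑ z, volume.restrict (s z) := by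
    rw [← Measure.sum_fintype]
    exact Measure.restrict_iUnion_le
  rw [← integral_finsetSum_measure fun z _ => hi z]
  exact integral_mono_measure hle (Filter.Eventually.of_forall hf)
    (integrable_finsetSum_measure.mpr fun z _ => hi z)

namespace RectMesh

variable {a b c d : ℝ} (T : RectMesh a b c d)

theorem sum_integral_elem {g : ℝ × ℝ → ℝ} (hg : Continuous g) :
    ∑ i ∈ Finset.range T.M, ∑ j ∈ Finset.range T.N,
      ∫ y in T.y j..T.y (j + 1), ∫ x in T.x i..T.x (i + 1), g (x, y) =
    ∫ y in c..d, ∫ x in a..b, g (x, y) := by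
  have h1 : ∀ i, ∑ j ∈ Finset.range T.N,
      ∫ y in T.y j..T.y (j + 1), ∫ x in T.x i..T.x (i + 1), g (x, y) =
      ∫ y in c..d, ∫ x in T.x i..T.x (i + 1), g (x, y) := fun i => by
    rw [intervalIntegral.sum_integral_adjacent_intervals fun j _ =>
      (continuous_integral_fst hg _ _).intervalIntegrable _ _, T.y_zero, T.y_last]
  simp only [h1]
  rw [← intervalIntegral.integral_finsetSum fun i _ =>
    (continuous_integral_fst hg _ _).intervalIntegrable _ _]
  refine intervalIntegral.integral_congr fun y _ => ?_
  rw [intervalIntegral.sum_integral_adjacent_intervals fun i _ =>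
    Continuous.intervalIntegrable (by fun_prop) _ _, T.x_zero, T.x_last]

theorem continuousOn_err {u : ℝ × ℝ → ℝ} (hu : ContDiffOn ℝ 2 u (Icc a b ×ˢ Icc c d)) {k : ℕ}
    (hk : 3 ≤ k) : ContinuousOn (T.err k u) (Icc a b ×ˢ Icc c d) :=
  hu.continuousOn.sub (T.contDiffOn_proj hu hk).continuousOn

end RectMesh

theorem smooth_eLpNorm_err_bound {k : ℕ} (hk : 3 ≤ k) :
    ∃ K : ℝ, 0 ≤ K ∧ ∀ (a b c d : ℝ) (T : RectMesh a b c d), ∀ f : ℝ × ℝ → ℝ, ContDiff ℝ ∞ f →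
      ∀ r : ℕ, 4 ≤ r → r ≤ k + 1 → ∀ B : ℝ, 0 ≤ B →
      (∀ i j : ℕ, i + j = r → ∫ P in Icc a b ×ˢ Icc c d, classicalDeriv i j f P ^ 2 ≤ B ^ 2) →
      eLpNorm (T.err k f) 2 (volume.restrict (Ioo a b ×ˢ Ioo c d)) ≤
        ENNReal.ofReal (K * T.h ^ r * B) := by
  obtain ⟨K, hK0, hK⟩ := smooth_L2_error_bound hk
  -- Three derivatives of order r enter the bound on an element, each with squared norm at most `B ^
  -- 2` on the whole rectangle; the root undoes the squares.
  refine ⟨√(3 * K), Real.sqrt_nonneg _, ?_⟩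
  intro a b c d T f hf r hr4 hrk B hB0 hB
  have hf2 : ContDiffOn ℝ 2 f (Icc a b ×ˢ Icc c d) := (contDiff_infty.mp hf 2).contDiffOn
  have hec := T.continuousOn_err hf2 hk
  have hh := T.h_pos
  have hab := T.a_lt_b
  have hcd := T.c_lt_d
  have hc : ∀ i j, Continuous fun P => classicalDeriv i j f P ^ 2 := fun i j =>
    (contDiff_classicalDeriv hf i j).continuous.pow 2
  have hmem : MemLp (T.err k f) 2 (volume.restrict (Ioo a b ×ˢ Ioo c d)) := by
    rw [memLp_two_iff_integrable_sq
      ((hec.mono rect_interior_subset).aestronglyMeasurable measurableSet_rect)]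
    exact ((hec.pow 2).integrableOn_compact isCompact_rect).mono_set rect_interior_subset
  have hGc : Continuous fun P => classicalDeriv r 0 f P ^ 2 + classicalDeriv 0 r f P ^ 2 +
      classicalDeriv 2 (r - 2) f P ^ 2 := ((hc r 0).add (hc 0 r)).add (hc 2 (r - 2))
  have hGsum : ∫ y in c..d, ∫ x in a..b, (classicalDeriv r 0 f (x, y) ^ 2 +
      classicalDeriv 0 r f (x, y) ^ 2 + classicalDeriv 2 (r - 2) f (x, y) ^ 2) ≤ 3 * B ^ 2 := by
    have e := setIntegral_Icc_prod_Icc hGc hab.le hcd.le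
    have hi := fun i j => (hc i j).continuousOn.integrableOn_compact (μ := volume)
      (isCompact_rect (a := a) (b := b) (c := c) (d := d))
    have hi' : IntegrableOn (fun P => classicalDeriv r 0 f P ^ 2 + classicalDeriv 0 r f P ^ 2)
      (Icc a b ×ˢ Icc c d) := (hi r 0).add (hi 0 r)
    rw [← e, integral_add hi' (hi _ _), integral_add (hi _ _) (hi _ _)]
    linarith [hB r 0 rfl, hB 0 r (zero_add r), hB 2 (r - 2) (by omega)]
  have h1 : ∫ P in Ioo a b ×ˢ Ioo c d, T.err k f P ^ 2 ≤ K * (T.h ^ r) ^ 2 * (3 * B ^ 2) := by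
    calc ∫ P in Ioo a b ×ˢ Ioo c d, T.err k f P ^ 2
        ≤ ∫ P in Icc a b ×ˢ Icc c d, T.err k f P ^ 2 :=
          setIntegral_mono_set ((hec.pow 2).integrableOn_compact isCompact_rect)
            (Filter.Eventually.of_forall fun P => sq_nonneg _)
            (Filter.Eventually.of_forall rect_interior_subset)
      _ ≤ ∑ z : Fin T.M × Fin T.N, ∫ P in T.elem z.1 z.2, T.err k f P ^ 2 := by
          rw [T.rect_eq_iUnion]
          refine setIntegral_iUnion_le (fun P => sq_nonneg _) fun z => ?_
          exact ((hec.pow 2).integrableOn_compact isCompact_rect).mono_set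
            (T.elem_subset z.1.2 z.2.2)
      _ ≤ ∑ z : Fin T.M × Fin T.N, K * (T.h ^ r) ^ 2 *
          ∫ y in T.y z.2..T.y (z.2 + 1), ∫ x in T.x z.1..T.x (z.1 + 1),
          (classicalDeriv r 0 f (x, y) ^ 2 + classicalDeriv 0 r f (x, y) ^ 2 +
            classicalDeriv 2 (r - 2) f (x, y) ^ 2) := by
          refine Finset.sum_le_sum fun z _ => ?_
          refine le_of_eq_of_le ?_ (hK a b c d T z.1 z.1.2 z.2 z.2.2 f hf r hr4 hrk)
          have hl : Continuous (T.localProj k f z.1 z.2) := by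
            rw [← T.localDeriv_zero_zero]
            exact (T.contDiff_localDeriv k f z.1 z.2 0 0).continuous
          rw [← setIntegral_Icc_prod_Icc (g := fun P => (f P - T.localProj k f z.1 z.2 P) ^ 2)
            ((hf.continuous.sub hl).pow 2) (T.x_lt _ z.1.2).le (T.y_lt _ z.2.2).le]
          refine setIntegral_congr_fun (T.isClosed_elem z.1 z.2).measurableSet fun P hP => ?_
          simp only [RectMesh.err, T.proj_eq_localProj hf2 hk z.1.2 z.2.2 hP]
      _ = K * (T.h ^ r) ^ 2 * ∫ y in c..d, ∫ x in a..b, (classicalDeriv r 0 f (x, y) ^ 2 +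
            classicalDeriv 0 r f (x, y) ^ 2 + classicalDeriv 2 (r - 2) f (x, y) ^ 2) := by
          rw [← Finset.mul_sum, ← T.sum_integral_elem hGc, Fintype.sum_prod_type,
            ← Fin.sum_univ_eq_sum_range]
          congr 1
          refine Finset.sum_congr rfl fun i _ => ?_
          rw [← Fin.sum_univ_eq_sum_range]
      _ ≤ _ := mul_le_mul_of_nonneg_left hGsum (by positivity)
  rw [← ENNReal.ofReal_toReal hmem.2.ne]
  refine ENNReal.ofReal_le_ofReal ((sq_le_sq₀ ENNReal.toReal_nonneg (by positivity)).mp ?_)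
  rw [toReal_eLpNorm_two_sq hmem, mul_pow, mul_pow, Real.sq_sqrt (by positivity)]
  linarith

/-- The errors of the approximants converge pointwise, and the mean square norm is lower
semicontinuous under such convergence (Fatou). -/
theorem eLpNorm_err_bound {k : ℕ} (hk : 3 ≤ k) :
    ∃ K : ℝ, 0 ≤ K ∧ ∀ (a b c d : ℝ) (T : RectMesh a b c d) (l : ℕ) (u : ℝ × ℝ → ℝ),
      MemSobolev l ⊤ (Ioo a b ×ˢ Ioo c d) u → ContDiffOn ℝ 2 u (Icc a b ×ˢ Icc c d) →
      ∀ r : ℕ, 4 ≤ r → r ≤ k + 1 → r ≤ l →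
      eLpNorm (T.err k u) 2 (volume.restrict (Ioo a b ×ˢ Ioo c d)) ≤
        ENNReal.ofReal (K * T.h ^ r * sobolevNorm r 2 (Ioo a b ×ˢ Ioo c d) u) := by
  obtain ⟨K, hK0, hK⟩ := smooth_eLpNorm_err_bound hk
  refine ⟨K, hK0, ?_⟩
  intro a b c d T l u hS hu r hr4 hrk hrl
  obtain ⟨F, hF, hF'⟩ := exists_mixedConv T.a_lt_b T.c_lt_d hu
  refine Lp.eLpNorm_le_of_ae_tendsto (f := fun n => T.err k (F n)) (u := Filter.atTop)
    (Filter.Eventually.of_forall fun n => ?_) (fun n => ?_) ?_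
  · refine hK a b c d T (F n) (hF.smooth n) r hr4 hrk _ (sobolevNorm_nonneg _ _) fun i j hij => ?_
    exact ((hF' i j _ (isWeakDeriv_weakDeriv hS (hij.trans_le hrl))).2.1 (by omega)
      (memLp_two_weakDeriv hS (hij.trans_le hrl)) n).trans (integral_sq_weakDeriv_le hS hij.le hrl)
  · exact ((T.continuousOn_err (contDiff_infty.mp (hF.smooth n) 2).contDiffOn hk).mono
      rect_interior_subset).aestronglyMeasurable measurableSet_rect
  · filter_upwards [ae_restrict_mem measurableSet_rect] with P hP
    exact T.tendsto_err hu hF k (rect_interior_subset hP)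

/-! ### Error bounds on elements, lines and points -/

theorem derivative_iterate_jacobiNeg_eval_eq_zero_of_gauss {k : ℕ} (hk : 3 ≤ k) {s : ℝ}
    (hs : s ∈ gaussPoints k) : (derivative^[2] (jacobiNeg (k + 1))).eval s = 0 := by
  obtain ⟨m, rfl⟩ := Nat.exists_eq_add_of_le' hk
  have h := derivative_iterate_jacobiNeg m
  rw [show m + 3 + 1 = m + 4 by ring, h, eval_mul]
  have h2 := hs.2
  rw [show m + 3 - 1 = m + 2 by omega] at h2
  rw [h2, mul_zero]

namespace RectMesh

variable {a b c d : ℝ} (T : RectMesh a b c d)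

theorem exists_ref_x {x : ℝ} (hx : x ∈ Icc a b) :
    ∃ i < T.M, ∃ s ∈ Icc (-1 : ℝ) 1, fromRef (T.x i) (T.x (i + 1)) s = x := by
  obtain ⟨hi, h⟩ := T.xIdx_spec hx
  exact ⟨_, hi, _, toRef_mem (T.x_lt _ hi) h, fromRef_toRef (T.x_lt _ hi) x⟩

theorem exists_ref_y {y : ℝ} (hy : y ∈ Icc c d) :
    ∃ j < T.N, ∃ t ∈ Icc (-1 : ℝ) 1, fromRef (T.y j) (T.y (j + 1)) t = y := by
  obtain ⟨hj, h⟩ := T.yIdx_spec hy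
  exact ⟨_, hj, _, toRef_mem (T.y_lt _ hj) h, fromRef_toRef (T.y_lt _ hj) y⟩

end RectMesh

theorem pointwise_error_bounds {k : ℕ} (hk : 3 ≤ k) (σ : ℝ) :
    ∃ K : ℝ, 0 ≤ K ∧ ∀ (a b c d : ℝ) (T : RectMesh a b c d), T.h ≤ σ * T.hmin →
      ∀ (l : ℕ) (u : ℝ × ℝ → ℝ), MemSobolev l ⊤ (Ioo a b ×ˢ Ioo c d) u →
      ContDiffOn ℝ 2 u (Icc a b ×ˢ Icc c d) → ∀ r : ℕ, 2 ≤ r → r ≤ l →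
      (r ≤ k + 1 → ∀ P ∈ Icc a b ×ˢ Icc c d,
        |T.err k u P| ≤ K * T.h ^ r * sobolevSeminorm r ⊤ (Ioo a b ×ˢ Ioo c d) u) ∧
      (r ≤ k + 2 →
        (∀ P ∈ T.gridX (jacobiRoots k) ×ˢ T.gridY (jacobiRoots k),
          |T.err k u P| ≤ K * T.h ^ r * sobolevSeminorm r ⊤ (Ioo a b ×ˢ Ioo c d) u) ∧
        (∀ P ∈ T.gridX (lobattoPoints k) ×ˢ Icc c d, |dX a b (T.err k u) P| ≤
          K * T.h ^ (r - 1) * sobolevSeminorm r ⊤ (Ioo a b ×ˢ Ioo c d) u) ∧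
        (∀ P ∈ Icc a b ×ˢ T.gridY (lobattoPoints k), |dY c d (T.err k u) P| ≤
          K * T.h ^ (r - 1) * sobolevSeminorm r ⊤ (Ioo a b ×ˢ Ioo c d) u) ∧
        (∀ P ∈ T.gridX (gaussPoints k) ×ˢ Icc c d, |dX a b (dX a b (T.err k u)) P| ≤
          K * T.h ^ (r - 2) * sobolevSeminorm r ⊤ (Ioo a b ×ˢ Ioo c d) u) ∧
        (∀ P ∈ Icc a b ×ˢ T.gridY (gaussPoints k), |dY c d (dY c d (T.err k u)) P| ≤
          K * T.h ^ (r - 2) * sobolevSeminorm r ⊤ (Ioo a b ×ˢ Ioo c d) u) ∧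
        ∀ P ∈ T.gridX (lobattoPoints k) ×ˢ T.gridY (lobattoPoints k),
          |dX a b (dY c d (T.err k u)) P| ≤
            K * T.h ^ (r - 2) * sobolevSeminorm r ⊤ (Ioo a b ×ˢ Ioo c d) u) := by
  obtain ⟨K, hK0, hK⟩ := error_bound hk σ
  refine ⟨K, hK0, ?_⟩
  intro a b c d T hσ l u hS hu r hr2 hrl
  have hab := T.a_lt_b
  have hcd := T.c_lt_d
  have hcX := contDiffOn_dX (m := 1) hab hcd hu (by norm_num)
  have hcY := contDiffOn_dY (m := 1) hab hcd hu (by norm_num)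
  have hmem : ∀ i < T.M, ∀ j < T.N, ∀ s ∈ Icc (-1 : ℝ) 1, ∀ t ∈ Icc (-1 : ℝ) 1,
      ((fromRef (T.x i) (T.x (i + 1)) s, fromRef (T.y j) (T.y (j + 1)) t) : ℝ × ℝ) ∈ T.elem i j :=
    fun i hi j hj s hs t ht => ⟨fromRef_mem (T.x_lt i hi) hs, fromRef_mem (T.y_lt j hj) ht⟩
  refine ⟨fun hrk => ?_, fun hrk => ⟨?_, ?_, ?_, ?_, ?_, ?_⟩⟩
  · rintro ⟨x, y⟩ ⟨hx, hy⟩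
    obtain ⟨i, hi, s, hs, rfl⟩ := T.exists_ref_x hx
    obtain ⟨j, hj, t, ht, rfl⟩ := T.exists_ref_y hy
    rw [T.err_eq_on_elem hu hk hi hj (hmem i hi j hj s hs t ht)]
    exact hK a b c d T hσ l u hS hu i hi j hj r hr2 (by omega) hrl 0 0 (by norm_num) u
      -- For r ≤ k + 1 both cancellation conditions are vacuous, so every point of the rectangle is
      -- admitted.
      (isWeakDeriv_zero_zero hu) hu.continuousOn s hs t ht (by omega) (by omega)
  · rintro ⟨x, y⟩ ⟨⟨i, hi, s, ⟨hs, hs0⟩, rfl⟩, ⟨j, hj, t, ⟨ht, ht0⟩, rfl⟩⟩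
    replace hs := Ioo_subset_Icc_self hs
    replace ht := Ioo_subset_Icc_self ht
    rw [T.err_eq_on_elem hu hk hi hj (hmem i hi j hj s hs t ht)]
    exact hK a b c d T hσ l u hS hu i hi j hj r hr2 hrk hrl 0 0 (by norm_num) u
      (isWeakDeriv_zero_zero hu) hu.continuousOn s hs t ht (fun _ _ => hs0) fun _ _ => ht0
  · rintro ⟨x, y⟩ ⟨⟨i, hi, s, ⟨hs, hs0⟩, rfl⟩, hy⟩
    obtain ⟨j, hj, t, ht, rfl⟩ := T.exists_ref_y hy
    rw [T.dX_err_eq_on_elem hu hk hi hj (hmem i hi j hj s hs t ht)]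
    exact hK a b c d T hσ l u hS hu i hi j hj r hr2 hrk hrl 1 0 (by norm_num) _
      (isWeakDeriv_dX hab hcd hu) hcX.continuousOn s hs t ht (fun _ _ => hs0) (by omega)
  · rintro ⟨x, y⟩ ⟨hx, ⟨j, hj, t, ⟨ht, ht0⟩, rfl⟩⟩
    obtain ⟨i, hi, s, hs, rfl⟩ := T.exists_ref_x hx
    rw [T.dY_err_eq_on_elem hu hk hi hj (hmem i hi j hj s hs t ht)]
    exact hK a b c d T hσ l u hS hu i hi j hj r hr2 hrk hrl 0 1 (by norm_num) _
      (isWeakDeriv_dY hab hcd hu) hcY.continuousOn s hs t ht (by omega) fun _ _ => ht0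
  · rintro ⟨x, y⟩ ⟨⟨i, hi, s, hsg, rfl⟩, hy⟩
    obtain ⟨j, hj, t, ht, rfl⟩ := T.exists_ref_y hy
    refine (T.abs_dX_dX_err_le hu hk hi hj (hmem i hi j hj s hsg.1 t ht)).trans ?_
    exact hK a b c d T hσ l u hS hu i hi j hj r hr2 hrk hrl 2 0 (by norm_num) _
      (isWeakDeriv_dX_dX hab hcd hu) (contDiffOn_dX (m := 0) hab hcd hcX (by simp)).continuousOn
      s hsg.1 t ht (fun _ _ => derivative_iterate_jacobiNeg_eval_eq_zero_of_gauss hk hsg) (by omega)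
  · rintro ⟨x, y⟩ ⟨hx, ⟨j, hj, t, htg, rfl⟩⟩
    obtain ⟨i, hi, s, hs, rfl⟩ := T.exists_ref_x hx
    refine (T.abs_dY_dY_err_le hu hk hi hj (hmem i hi j hj s hs t htg.1)).trans ?_
    exact hK a b c d T hσ l u hS hu i hi j hj r hr2 hrk hrl 0 2 (by norm_num) _
      (isWeakDeriv_dY_dY hab hcd hu) (contDiffOn_dY (m := 0) hab hcd hcY (by simp)).continuousOn
      s hs t htg.1 (by omega) fun _ _ => derivative_iterate_jacobiNeg_eval_eq_zero_of_gauss hk htg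
  -- With one derivative in each variable both cancellation conditions are vacuous.
  · rintro ⟨x, y⟩ ⟨⟨i, hi, s, ⟨hs, _⟩, rfl⟩, ⟨j, hj, t, ⟨ht, _⟩, rfl⟩⟩
    refine (T.abs_dX_dY_err_le hu hk hi hj (hmem i hi j hj s hs t ht)).trans ?_
    exact hK a b c d T hσ l u hS hu i hi j hj r hr2 hrk hrl 1 1 (by norm_num) _
      (isWeakDeriv_dX_dY hab hcd hu) (contDiffOn_dX (m := 0) hab hcd hcY (by simp)).continuousOn
      s hs t ht (by omega) (by omega)

/-- A mean square estimate of order `2 ≤ r` whose constant depends on `u` but not on the mesh. -/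
theorem exists_eLpNorm_err_bound_of_pointwise {k : ℕ} {K : ℝ} (hK0 : 0 ≤ K) {a b c d : ℝ} {l : ℕ}
    {u : ℝ × ℝ → ℝ} (hS : MemSobolev l ⊤ (Ioo a b ×ˢ Ioo c d) u) :
    ∃ Ku : ℝ, 0 < Ku ∧ ∀ (T : RectMesh a b c d) (r : ℕ), r ≤ l →
      (∀ P ∈ Icc a b ×ˢ Icc c d,
        |T.err k u P| ≤ K * T.h ^ r * sobolevSeminorm r ⊤ (Ioo a b ×ˢ Ioo c d) u) →
      eLpNorm (T.err k u) 2 (volume.restrict (Ioo a b ×ˢ Ioo c d)) ≤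
        ENNReal.ofReal (Ku * T.h ^ r * sobolevNorm r 2 (Ioo a b ×ˢ Ioo c d) u) := by
  set Ω : Set (ℝ × ℝ) := Ioo a b ×ˢ Ioo c d with hΩ
  set V := (volume.restrict Ω) univ ^ (2 : ℝ≥0∞).toReal⁻¹ with hV
  have hVtop : V ≠ ⊤ := by
    refine ENNReal.rpow_ne_top_of_nonneg (by positivity) ?_
    rw [Measure.restrict_apply_univ]
    exact volume_rect_lt_top.ne
  -- The quotient of the two norms of u, times the root of the area; summing over all r ≤ l gives
  -- one constant for all orders and all meshes.
  set q : ℕ → ℝ := fun r => V.toReal * K * sobolevSeminorm r ⊤ Ω u / sobolevNorm r 2 Ω u with hq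
  have hq0 : ∀ r, 0 ≤ q r := fun r => by
    have h1 := sobolevSeminorm_nonneg (Ω := Ω) (u := u) r ⊤
    have h2 := sobolevNorm_nonneg (Ω := Ω) (u := u) r 2
    have h3 := ENNReal.toReal_nonneg (a := V)
    positivity
  have hsum : 0 ≤ ∑ r ∈ Finset.range (l + 1), q r := Finset.sum_nonneg fun r _ => hq0 r
  refine ⟨1 + ∑ r ∈ Finset.range (l + 1), q r, by linarith, fun T r hr hP => ?_⟩
  have h1 := eLpNorm_le_of_ae_bound (p := 2) (f := T.err k u) (μ := volume.restrict Ω)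
    (C := K * T.h ^ r * sobolevSeminorm r ⊤ Ω u)
    ((ae_restrict_mem measurableSet_rect).mono fun P hPΩ => hP P (rect_interior_subset hPΩ))
  refine h1.trans ?_
  rw [← hV, ← ENNReal.ofReal_toReal hVtop, ← ENNReal.ofReal_mul ENNReal.toReal_nonneg]
  refine ENNReal.ofReal_le_ofReal ?_
  have hN := sobolevNorm_nonneg (Ω := Ω) (u := u) r 2
  have hh := pow_pos T.h_pos r
  rcases hN.eq_or_lt with h0 | h0
  -- If the denominator vanishes, so does the seminorm, and both sides are 0.
  · rw [sobolevSeminorm_top_eq_zero hS hr h0.symm, ← h0, mul_zero, mul_zero, mul_zero]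
  · have h2 : q r ≤ ∑ r ∈ Finset.range (l + 1), q r :=
      Finset.single_le_sum (fun r _ => hq0 r) (Finset.mem_range.mpr (by omega))
    calc V.toReal * (K * T.h ^ r * sobolevSeminorm r ⊤ Ω u)
        = q r * T.h ^ r * sobolevNorm r 2 Ω u := by rw [hq]; field_simp
      _ ≤ _ := by gcongr; linarith

end JacobiProjection

/-! ### The theorem -/

open JacobiProjection
theorem proposition4p1 (k : ℕ) (hk : 3 ≤ k) (σ : ℝ) :
    ∃ K : ℝ, 0 < K ∧
    ∀ (a b c d : ℝ), a < b → c < d →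
    ∀ (l : ℕ), 2 ≤ l →
    ∀ u : ℝ × ℝ → ℝ,
      MemSobolev l ∞ (Ioo a b ×ˢ Ioo c d) u →
      ContDiffOn ℝ 2 u (Icc a b ×ˢ Icc c d) →
    ∃ Ku : ℝ, 0 < Ku ∧
    ∀ T : RectMesh a b c d, T.h ≤ σ * T.hmin →
      -- the projection belongs to the finite element space
      T.MemV k (T.proj k u) ∧
      -- 1. optimal error estimates in the maximum norm and in the mean square norm
      (∀ r : ℕ, 2 ≤ r → r ≤ min (k + 1) l →
        eLpNorm (T.err k u) ∞ (volume.restrict (Ioo a b ×ˢ Ioo c d)) ≤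
          ENNReal.ofReal (K * T.h ^ r * sobolevNorm r ∞ (Ioo a b ×ˢ Ioo c d) u)) ∧
      (∀ r : ℕ, 4 ≤ r → r ≤ min (k + 1) l →
        eLpNorm (T.err k u) 2 (volume.restrict (Ioo a b ×ˢ Ioo c d)) ≤
          ENNReal.ofReal (K * T.h ^ r * sobolevNorm r 2 (Ioo a b ×ˢ Ioo c d) u)) ∧
      (∀ r : ℕ, 2 ≤ r → r ≤ min (k + 1) l →
        eLpNorm (T.err k u) 2 (volume.restrict (Ioo a b ×ˢ Ioo c d)) ≤
          ENNReal.ofReal (Ku * T.h ^ r * sobolevNorm r 2 (Ioo a b ×ˢ Ioo c d) u)) ∧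
      -- 2. exactness at the mesh nodes
      (∀ i ≤ T.M, ∀ j ≤ T.N,
        T.err k u (T.x i, T.y j) = 0 ∧
        dX a b (T.err k u) (T.x i, T.y j) = 0 ∧
        dY c d (T.err k u) (T.x i, T.y j) = 0) ∧
      -- 3. function values at the roots of the Jacobi polynomials
      (∀ r : ℕ, 2 ≤ r → r ≤ min (k + 2) l →
        ∀ P ∈ T.gridX (jacobiRoots k) ×ˢ T.gridY (jacobiRoots k),
          |T.err k u P| ≤ K * T.h ^ r * sobolevSeminorm r ∞ (Ioo a b ×ˢ Ioo c d) u) ∧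
      -- 4. first derivatives on the Lobatto lines
      (∀ r : ℕ, 2 ≤ r → r ≤ min (k + 2) l →
        ∀ P₁ ∈ T.gridX (lobattoPoints k) ×ˢ Icc c d,
        ∀ Q₁ ∈ Icc a b ×ˢ T.gridY (lobattoPoints k),
          |dX a b (T.err k u) P₁| + |dY c d (T.err k u) Q₁| ≤
            K * T.h ^ (r - 1) * sobolevSeminorm r ∞ (Ioo a b ×ˢ Ioo c d) u) ∧
      -- 5. second derivatives on the Gauss lines and at the Lobatto points
      (∀ r : ℕ, 2 ≤ r → r ≤ min (k + 2) l →
        ∀ P₂ ∈ T.gridX (gaussPoints k) ×ˢ Icc c d,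
        ∀ Q₂ ∈ Icc a b ×ˢ T.gridY (gaussPoints k),
        ∀ P₃ ∈ T.gridX (lobattoPoints k) ×ˢ T.gridY (lobattoPoints k),
          |dX a b (dX a b (T.err k u)) P₂| + |dY c d (dY c d (T.err k u)) Q₂| +
              |dX a b (dY c d (T.err k u)) P₃| ≤
            K * T.h ^ (r - 2) * sobolevSeminorm r ∞ (Ioo a b ×ˢ Ioo c d) u) := by
  obtain ⟨K₁, h1, H1⟩ := pointwise_error_bounds hk σ
  obtain ⟨K₂, h2, H2⟩ := eLpNorm_err_bound hk
  -- At most three pointwise bounds are added in one estimate; the mean square bound needs `K₂`, and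
  -- 1 ensures positivity.
  refine ⟨3 * K₁ + K₂ + 1, by linarith, ?_⟩
  intro a b c d _ _ l hl u hS hu
  obtain ⟨Ku, hKu, HKu⟩ := exists_eLpNorm_err_bound_of_pointwise (k := k) h1 hS
  refine ⟨Ku, hKu, fun T hσ => ?_⟩
  have hh := T.h_pos
  have H := H1 a b c d T hσ l u hS hu
  set Ω : Set (ℝ × ℝ) := Ioo a b ×ˢ Ioo c d with hΩ
  have hB : ∀ r, 0 ≤ sobolevSeminorm r ∞ Ω u := fun r => sobolevSeminorm_nonneg r ∞
  have mono : ∀ (e : ℝ) (m r : ℕ), 0 ≤ e → e ≤ 3 → e * (K₁ * T.h ^ m * sobolevSeminorm r ∞ Ω u) ≤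
      (3 * K₁ + K₂ + 1) * T.h ^ m * sobolevSeminorm r ∞ Ω u := by
    intro e m r he0 he3
    have := mul_nonneg (pow_pos hh m).le (hB r)
    have h3 : e * K₁ ≤ 3 * K₁ + K₂ + 1 := by nlinarith
    nlinarith
  refine ⟨T.memV_proj hu hk, ?_, ?_, ?_, fun i hi j hj => T.err_node hu hk hi hj, ?_, ?_, ?_⟩
  · intro r hr2 hr
    rw [eLpNorm_exponent_top]
    refine eLpNormEssSup_le_of_ae_bound ?_
    filter_upwards [ae_restrict_mem measurableSet_rect] with P hP
    have e1 := (H r hr2 (by omega)).1 (by omega) P (rect_interior_subset hP)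
    have e2 := mono 1 r r (by norm_num) (by norm_num)
    have e3 := sobolevSeminorm_top_le_sobolevNorm isOpen_rect hS (r := r) (by omega)
    rw [one_mul] at e2
    exact (e1.trans e2).trans (mul_le_mul_of_nonneg_left e3 (by positivity))
  · intro r hr4 hr
    refine (H2 a b c d T l u hS hu r hr4 (by omega) (by omega)).trans (ENNReal.ofReal_le_ofReal ?_)
    have := sobolevNorm_nonneg (Ω := Ω) (u := u) r 2
    gcongr
    linarith
  · intro r hr2 hr
    exact HKu T r (by omega) ((H r hr2 (by omega)).1 (by omega))
  · intro r hr2 hr P hP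
    have e1 := ((H r hr2 (by omega)).2 (by omega)).1 P hP
    have e2 := mono 1 r r (by norm_num) (by norm_num)
    linarith
  · intro r hr2 hr P₁ hP₁ Q₁ hQ₁
    obtain ⟨-, e1, e2, -⟩ := (H r hr2 (by omega)).2 (by omega)
    linarith [e1 P₁ hP₁, e2 Q₁ hQ₁, mono 2 (r - 1) r (by norm_num) (by norm_num)]
  · intro r hr2 hr P₂ hP₂ Q₂ hQ₂ P₃ hP₃
    obtain ⟨-, -, -, e1, e2, e3⟩ := (H r hr2 (by omega)).2 (by omega)
    linarith [e1 P₂ hP₂, e2 Q₂ hQ₂, e3 P₃ hP₃, mono 3 (r - 2) r (by norm_num) le_rfl]
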